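/- Let $\mathcal{C}$ be a site, $S$ an object of $\mathcal{C}$, and $\mathcal{U}^\bullet:\mathcal{V}_A\to\mathcal{U}_I\to S$ a $1$-hypercover: a covering family $\{U_i\to S\}_{i\in I}$, for all $i,j\in I$ a covering family $\{V_{ij}^\alpha\to U_i\times_S U_j\}_\alpha$, and the $1$-coskeletal simplicial object $\mathcal{U}^\bullet$ (in formal coproducts of objects of $\mathcal{C}$, augmented over $S$) with these terms in degrees $0$ and $1$. Denote the terms of $\mathcal{U}^\bullet$ in degree $p$ by $U_{p,b}$; those of degree $2$ are the $V_{ijk}^{\alpha\beta\gamma}$ with faces $V_{ij}^\alpha$, $V_{jk}^\beta$, $V_{ik}^\gamma$. Let $X$ be a presheaf of pointed Kan complexes on $\mathcal{C}$, and let $X_{\mathcal{U}}$ be the pointed cosimplicial space $X_{\mathcal{U}}^p=\prod_b X(U_{p,b})$. Let $t\ge 1$. For $q\ge 1$ let $\check{H}^0(\mathcal{U}^\bullet,\pi_qX)$ be the equalizer of the two cofaces $\prod_i\pi_qX(U_i)\rightrightarrows\prod_{i,j,\alpha}\pi_qX(V_{ij}^\alpha)$ and, for $q\ge 2$, let $\check{H}^2(\mathcal{U}^\bullet,\pi_qX)$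 be the second cohomology of the cochain complex $p\mapsto\prod_b\pi_qX(U_{p,b})$ with the alternating sum of the cofaces as differential. Let $r:X_{\mathcal{U}}\to Z$ be any levelwise weak equivalence of pointed cosimplicial spaces with $Z$ Reedy fibrant, and let $$d_2:\check{H}^0(\mathcal{U}^\bullet,\pi_tX)\to\check{H}^2(\mathcal{U}^\bullet,\pi_{t+1}X)$$ be the differential of the spectral sequence of the tower $\cdots\to\mathrm{Tot}_2Z\to\mathrm{Tot}_1Z\to\mathrm{Tot}_0Z$. Explicitly, for $a\in\check H^0(\mathcal{U}^\bullet,\pi_tX)\subseteq\pi_tX^0_{\mathcal{U}}\cong\pi_tZ^0=\pi_t\mathrm{Tot}_0Z$, lift $a$ to a class represented by a simplex $x:\Delta^t\to\mathrm{Tot}_1Z$ which is trivial on $\partial\Delta^t$, lift $x$ to $\theta:\Delta^t\to\mathrm{Tot}_2Z$ such that all faces of $\theta$ except the $0$-th one are trivial, and let $z:\Delta^{t-1}\to\mathrm{Tot}_2Z$ be the $0$-th face; $d_2(a)$ is the class of the cocycle in $\prod_b\pi_{t+1}X(U_{2,b})\cong\pi_{t+1}Z^2$ given by the component $\Delta^{t-1}\times\Delta^2\to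 Z^2$ of $z$, which is trivial on the boundary of $\Delta^{t-1}\times\Delta^2$. Here and below a map from $\Delta^m\times\Delta^s$ to a pointed Kan complex $K$ which is trivial on the boundary is regarded as representing an element of $\pi_{m+s}(K)$ by means of the map of relative degree one $\Delta^m\times\Delta^s\to\Delta^{m+s}$ given on vertices by $(b,0)\mapsto b$ and $(b,a)\mapsto m+a$ for $a>0$. Then these choices can be made for every $a$, and $d_2(a)$ depends only on $a$, so that $d_2$ is a well-defined function. It can be described as follows. 1. Every element of $\check{H}^0(\mathcal{U}^\bullet,\pi_tX)$ is the class $[\delta]$ of some $\delta=(\delta_i)_i:S^t\to X_{\mathcal{U}}^0=\prod_iX(U_i)$, where $\delta_i$ is a simplex $\Delta^t\to X(U_i)$ that is trivial on $\partial\Delta^t$. Given any such $\delta$, the family $[\delta]$ of classes lies in $\check{H}^0(\mathcal{U}^\bullet,\pi_tX)$ if and only if $\delta_i$ and $\delta_j$ are homotopic relative to $\partial\Delta^t$ on $V_{ij}^\alpha$ for all $i,j,\alpha$. 2. Given any such $\delta$ and any choice of homotopies $y_{ij}^\alpha:\Delta^t\times\Delta^1\to X(V_{ij}^\alpha)$ relative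 to $\partial\Delta^t$ from $\delta_i|_{V_{ij}^\alpha}$ to $\delta_j|_{V_{ij}^\alpha}$, there is a unique map $w:\Delta^t\times\partial\Delta^2\to X_{\mathcal{U}}^2$ whose restriction to the $k$-th face of $\Delta^2$ is the $k$-th coface of the family $y$: on the edges $01$, $12$, $02$ of $\Delta^2$ its component in $X(V_{ijk}^{\alpha\beta\gamma})$ is given by the restrictions of $y_{ij}^\alpha$, $y_{jk}^\beta$, $y_{ik}^\gamma$. 3. For every horn $\Lambda^t_n\subseteq\Delta^t$ with $0\le n\le t$ there is a fill $\Phi:\Delta^t\times\Delta^2\to X_{\mathcal{U}}^2$ of $w$, i.e. a map that extends $w$ and is trivial on $\Lambda^t_n\times\Delta^2$. For every such fill, the components of the restriction of $\Phi$ to $\partial^n\Delta^t\times\Delta^2\cong\Delta^{t-1}\times\Delta^2$, where $\partial^n\Delta^t$ is the $n$-th face, represent unique elements of the groups $\pi_{t+1}X(U_{2,b})$. These form a $2$-cocycle, and its class in $\check{H}^2(\mathcal{U}^\bullet,\pi_{t+1}X)$ is $d_2\bigl([\delta]^{(-1)^n}\bigr)$, so it is $d_2[\delta]$ for $n$ even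 and $d_2([\delta]^{-1})$ for $n$ odd (the group structure of $\check{H}^0$ being written multiplicatively). -/

import Mathlib

open CategoryTheory Simplicial MonoidalCategory Opposite Limits
universe w v u

namespace CechDiff

namespace KanGroup

variable {X : SSet.{w}} {x : X _⦋0⦌} {n : ℕ}

/-- `IsBd v`: there is an `(n+1)`-simplex of `X` whose faces `d_{n+1}, d_n, …, d_0` are
`v 0, v 1, …, v (n+1)`. -/
def IsBd (v : ℕ → X.PtSimplex n x) : Prop :=
  ∃ W : Δ[n + 1] ⟶ X, ∀ j : Fin (n + 2), SSet.stdSimplex.δ j ≫ W = (v (n + 1 - j)).map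

/-- The sequence with the given first terms, followed by constant simplices. -/
def seq (l : List (X.PtSimplex n x)) : ℕ → X.PtSimplex n x := fun i => l.getD i .const

/-- The `l`-th row of a table of simplices, as in the faces of the faces of a simplex. -/
def row (F : ℕ → ℕ → X.PtSimplex n x) (l : ℕ) : ℕ → X.PtSimplex n x :=
  fun i => if i < l then F i l else F l (i + 1)

theorem isBd_row [SSet.KanComplex X] (F : ℕ → ℕ → X.PtSimplex n x) (k : ℕ) (hk : k ≤ n + 2)
    (h : ∀ l, l ≠ k → IsBd (row F l)) : IsBd (row F k) := by
  have : Nonempty (Δ[n + 1] ⟶ X) := ⟨SSet.const x⟩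
  choose! W hW using h
  let k' : Fin (n + 3) := ⟨n + 2 - k, by omega⟩
  have hc : SSet.horn.IsCompatible (i := k') (fun (j : Fin (n + 3)) _ => W (n + 2 - j)) := by
    rw [SSet.horn.isCompatible_iff]
    intro a b ha hb hab
    have ha' : n + 2 - (a : ℕ) ≠ k := by
      intro h; apply ha; ext; simp only [k']; omega
    have hb' : n + 2 - (b : ℕ) ≠ k := by
      intro h; apply hb; ext; simp only [k']; omega
    rw [hW _ ha', hW _ hb']
    congr 1
    have h1 : (a : ℕ) < b := hab
    have hbl : (b : ℕ) < n + 3 := b.2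
    simp only [row, Fin.val_pred, Fin.coe_castPred]
    have e1 : n + 1 - ((b : ℕ) - 1) < n + 2 - a := by omega
    have e2 : ¬ n + 1 - (a : ℕ) < n + 2 - b := by omega
    exact (if_pos e1).trans ((congrArg₂ F (by omega) (by omega)).trans (if_neg e2).symm)
  obtain ⟨V, hV⟩ := hc.exists_lift_of_kanComplex
  refine ⟨SSet.stdSimplex.δ k' ≫ V, fun j => ?_⟩
  have hkv : (k' : ℕ) = n + 2 - k := rfl
  have hjl : (j : ℕ) < n + 2 := j.2
  by_cases hj : j.castSucc < k'
  · obtain ⟨m, hm⟩ := Fin.eq_succ_of_ne_zero (Fin.ne_zero_of_lt hj)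
    have hjv : (j : ℕ) < k' := hj
    have hmv : (k' : ℕ) = m + 1 := by rw [hm]; simp
    rw [hm, SSet.stdSimplex.δ_comp_δ_assoc (by
      rw [Fin.le_def]; omega), hV _ (by rw [hm]; intro h; have := congrArg Fin.val h; simp at this; omega),
      hW _ (by simp; omega)]
    congr 1
    simp only [row, Fin.val_castSucc]
    rw [if_pos (by omega), if_neg (by omega)]
    congr 1 <;> omega
  · have hjv : ¬ (j : ℕ) < k' := hj
    obtain ⟨m, hm'⟩ := Fin.eq_castSucc_of_ne_last (x := k') (by
      intro h; have := congrArg Fin.val h; simp at this; omega)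
    have hm := hm'.symm
    have hmv : (k' : ℕ) = m := by rw [hm]; simp
    rw [hm, ← SSet.stdSimplex.δ_comp_δ_assoc (by
      rw [Fin.le_def]; omega), hV _ (by rw [hm]; intro h; have := congrArg Fin.val h; simp at this; omega),
      hW _ (by simp; omega)]
    congr 1
    simp only [row, Fin.val_succ]
    rw [if_neg (by omega), if_pos (by omega)]
    congr 1 <;> omega

theorem exists_isBd [SSet.KanComplex X] (v : ℕ → X.PtSimplex (n + 1) x) (k : ℕ) (hk : k ≤ n + 2) :
    ∃ s, IsBd (Function.update v k s) := by
  let k' : Fin (n + 3) := ⟨n + 2 - k, by omega⟩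
  have hc : SSet.horn.IsCompatible (i := k') (fun (j : Fin (n + 3)) _ => (v (n + 2 - j)).map) := by
    rw [SSet.horn.isCompatible_iff]
    intros
    simp
  obtain ⟨V, hV⟩ := hc.exists_lift_of_kanComplex
  refine ⟨⟨SSet.stdSimplex.δ k' ≫ V, SSet.boundary.hom_ext fun i => ?_⟩, V, fun j => ?_⟩
  · have : SSet.stdSimplex.δ i ≫ SSet.stdSimplex.δ k' ≫ V = SSet.const x := by
      by_cases hj : i.castSucc < k'
      · obtain ⟨m, hm⟩ := Fin.eq_succ_of_ne_zero (Fin.ne_zero_of_lt hj)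
        have hjv : (i : ℕ) < k' := hj
        have hmv : (k' : ℕ) = m + 1 := by rw [hm]; simp
        rw [hm, SSet.stdSimplex.δ_comp_δ_assoc (by rw [Fin.le_def]; omega), hV _ (by
          rw [hm]; intro h; have := congrArg Fin.val h; simp at this; omega)]
        simp
      · have hjv : ¬ (i : ℕ) < k' := hj
        obtain ⟨m, hm'⟩ := Fin.eq_castSucc_of_ne_last (x := k') (by
          intro h; have := congrArg Fin.val h; simp at this; omega)
        have hm := hm'.symm
        have hmv : (k' : ℕ) = m := by rw [hm]; simp
        rw [hm, ← SSet.stdSimplex.δ_comp_δ_assoc (by rw [Fin.le_def]; omega), hV _ (by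
          rw [hm]; intro h; have := congrArg Fin.val h; simp at this; omega)]
        simp
    simp [this]
  · by_cases hj : j = k'
    · subst hj
      have : n + 1 + 1 - (k' : ℕ) = k := by simp only [k']; omega
      rw [this, Function.update_self]
    · rw [hV j hj, Function.update_of_ne]
      intro h
      apply hj
      ext
      simp only [k']; have := j.2; omega

theorem isBd_deg (f : X.PtSimplex n x) (i : ℕ) (hi : i ≤ n) :
    IsBd (seq (List.replicate i .const ++ [f, f])) := by
  let r := SSet.PtSimplex.RelStruct.refl f ⟨n - i, by omega⟩
  refine ⟨r.map, fun j => ?_⟩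
  have hj := j.2
  rcases lt_trichotomy (n + 1 - (j : ℕ)) i with h | h | h
  · rw [r.δ_map_of_gt j (by rw [Fin.lt_def]; simp; omega)]
    simp [seq, List.getElem?_append_left, h]
  · have : j = (⟨n - i, by omega⟩ : Fin (n + 1)).succ := by ext; simp; omega
    rw [this, r.δ_succ_map]
    have : n + 1 - (n - i + 1) = i := by omega
    simp [seq, this]
  · by_cases h' : n + 1 - (j : ℕ) = i + 1
    · have : j = (⟨n - i, by omega⟩ : Fin (n + 1)).castSucc := by ext; simp; omega
      rw [this, r.δ_castSucc_map]
      have : n + 1 - (n - i) = i + 1 := by omega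
      simp [seq, this]
    · rw [r.δ_map_of_lt j (by rw [Fin.lt_def]; simp; omega)]
      have : (List.replicate i (SSet.RelativeMorphism.const : X.PtSimplex n x) ++ [f, f]).length ≤
        n + 1 - (j : ℕ) := by simp; omega
      simp only [seq, List.getD_eq_getElem?_getD]
      rw [List.getElem?_eq_none this]
      simp



/-- The constant simplex. -/
abbrev cst : X.PtSimplex n x := SSet.RelativeMorphism.const

theorem isBd_one : IsBd (seq ([] : List (X.PtSimplex n x))) := by
  have h := isBd_deg (n := n) (.const : X.PtSimplex n x) 0 (by omega)
  have e : seq (List.replicate 0 (cst : X.PtSimplex n x) ++ [cst, cst]) = seq [] := by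
    funext i; rcases i with _ | _ | i <;> rfl
  rwa [e] at h

/-- A table of simplices with prescribed entries above the diagonal in the first four rows. -/
def table4 (a b c d e f : X.PtSimplex n x) : ℕ → ℕ → X.PtSimplex n x := fun i j => match i, j with
  | 0, 1 => a
  | 0, 2 => b
  | 0, 3 => c
  | 1, 2 => d
  | 1, 3 => e
  | 2, 3 => f
  | _, _ => cst

theorem row4 (a b c d e f : X.PtSimplex n x) :
    row (table4 a b c d e f) 0 = seq [a, b, c] ∧ row (table4 a b c d e f) 1 = seq [a, d, e] ∧
    row (table4 a b c d e f) 2 = seq [b, d, f] ∧ row (table4 a b c d e f) 3 = seq [c, e, f] ∧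
    ∀ l : ℕ, row (table4 a b c d e f) (l + 4) = seq ([] : List (X.PtSimplex n x)) := by
  refine ⟨?_, ?_, ?_, ?_, fun l => ?_⟩
  · funext i; rcases i with _ | _ | _ | i <;> rfl
  · funext i; rcases i with _ | _ | _ | i <;> rfl
  · funext i; rcases i with _ | _ | _ | i <;> rfl
  · funext i; rcases i with _ | _ | _ | i <;> simp [row, table4, seq]
  · funext i
    rcases i with _ | _ | _ | i <;> simp [row, table4, seq]

theorem isBd_four [SSet.KanComplex X] (a b c d e f : X.PtSimplex (n + 1) x) (k : ℕ) (hk : k < 4)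
    (h0 : k ≠ 0 → IsBd (seq [a, b, c])) (h1 : k ≠ 1 → IsBd (seq [a, d, e]))
    (h2 : k ≠ 2 → IsBd (seq [b, d, f])) (h3 : k ≠ 3 → IsBd (seq [c, e, f])) :
    IsBd (row (table4 a b c d e f) k) := by
  obtain ⟨r0, r1, r2, r3, r4⟩ := row4 a b c d e f
  refine isBd_row _ k (by omega) fun l hl => ?_
  rcases l with _ | _ | _ | _ | l
  · rw [r0]; exact h0 hl.symm
  · rw [r1]; exact h1 hl.symm
  · rw [r2]; exact h2 hl.symm
  · rw [r3]; exact h3 hl.symm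
  · rw [r4]; exact isBd_one

/-- A table of simplices with prescribed entries above the diagonal in the first five rows. -/
def table5 (x01 x02 x03 x04 x12 x13 x14 x23 x24 x34 : X.PtSimplex n x) :
    ℕ → ℕ → X.PtSimplex n x := fun i j => match i, j with
  | 0, 1 => x01
  | 0, 2 => x02
  | 0, 3 => x03
  | 0, 4 => x04
  | 1, 2 => x12
  | 1, 3 => x13
  | 1, 4 => x14
  | 2, 3 => x23
  | 2, 4 => x24
  | 3, 4 => x34
  | _, _ => cst

theorem isBd_five [SSet.KanComplex X]
    (x01 x02 x03 x04 x12 x13 x14 x23 x24 x34 : X.PtSimplex (n + 2) x) (k : ℕ) (hk : k < 5)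
    (h0 : k ≠ 0 → IsBd (seq [x01, x02, x03, x04])) (h1 : k ≠ 1 → IsBd (seq [x01, x12, x13, x14]))
    (h2 : k ≠ 2 → IsBd (seq [x02, x12, x23, x24])) (h3 : k ≠ 3 → IsBd (seq [x03, x13, x23, x34]))
    (h4 : k ≠ 4 → IsBd (seq [x04, x14, x24, x34])) :
    IsBd (row (table5 x01 x02 x03 x04 x12 x13 x14 x23 x24 x34) k) := by
  refine isBd_row _ k (by omega) fun l hl => ?_
  rcases l with _ | _ | _ | _ | _ | l
  · convert h0 hl.symm using 1
    funext i; rcases i with _ | _ | _ | _ | i <;> rfl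
  · convert h1 hl.symm using 1
    funext i; rcases i with _ | _ | _ | _ | i <;> rfl
  · convert h2 hl.symm using 1
    funext i; rcases i with _ | _ | _ | _ | i <;> rfl
  · convert h3 hl.symm using 1
    funext i; rcases i with _ | _ | _ | _ | i <;> simp [row, table5, seq]
  · convert h4 hl.symm using 1
    funext i; rcases i with _ | _ | _ | _ | i <;> simp [row, table5, seq]
  · convert isBd_one (X := X) (x := x) using 1
    funext i; rcases i with _ | _ | _ | _ | i <;> simp [row, table5, seq]

section group

variable [SSet.KanComplex X] {a a' b b' c c' d e f : X.PtSimplex (n + 1) x}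

theorem seq_snoc_one (l : List (X.PtSimplex n x)) : seq (l ++ [cst]) = seq l := by
  funext i
  simp only [seq, List.getD_eq_getElem?_getD]
  rcases lt_trichotomy i l.length with h | h | h
  · rw [List.getElem?_append_left h]
  · subst h; simp
  · rw [List.getElem?_eq_none (by simp; omega), List.getElem?_eq_none h.le]

theorem isBd_diag (a : X.PtSimplex n x) : IsBd (seq [a, a]) := isBd_deg a 0 (by omega)

theorem isBd_one_diag (a : X.PtSimplex (n + 1) x) : IsBd (seq [cst, a, a]) :=
  isBd_deg a 1 (by omega)

theorem tet0 (h1 : IsBd (seq [a, d, e])) (h2 : IsBd (seq [b, d, f])) (h3 : IsBd (seq [c, e, f])) :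
    IsBd (seq [a, b, c]) := by
  rw [← (row4 a b c d e f).1]
  exact isBd_four _ _ _ _ _ _ 0 (by omega) (by simp) (fun _ => h1) (fun _ => h2) (fun _ => h3)

theorem tet1 (h0 : IsBd (seq [a, b, c])) (h2 : IsBd (seq [b, d, f])) (h3 : IsBd (seq [c, e, f])) :
    IsBd (seq [a, d, e]) := by
  rw [← (row4 a b c d e f).2.1]
  exact isBd_four _ _ _ _ _ _ 1 (by omega) (fun _ => h0) (by simp) (fun _ => h2) (fun _ => h3)

theorem tet2 (h0 : IsBd (seq [a, b, c])) (h1 : IsBd (seq [a, d, e])) (h3 : IsBd (seq [c, e, f])) :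
    IsBd (seq [b, d, f]) := by
  rw [← (row4 a b c d e f).2.2.1]
  exact isBd_four _ _ _ _ _ _ 2 (by omega) (fun _ => h0) (fun _ => h1) (by simp) (fun _ => h3)

theorem tet3 (h0 : IsBd (seq [a, b, c])) (h1 : IsBd (seq [a, d, e])) (h2 : IsBd (seq [b, d, f])) :
    IsBd (seq [c, e, f]) := by
  rw [← (row4 a b c d e f).2.2.2.1]
  exact isBd_four _ _ _ _ _ _ 3 (by omega) (fun _ => h0) (fun _ => h1) (fun _ => h2) (by simp)

theorem pad2 : IsBd (seq [a, b, cst]) ↔ IsBd (seq [a, b]) := by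
  rw [← seq_snoc_one [a, b]]; rfl

theorem one3 : IsBd (seq [(cst : X.PtSimplex (n + 1) x), cst, cst]) := by
  rw [pad2]; exact isBd_diag _

theorem isBd_symm (h : IsBd (seq [a, b])) : IsBd (seq [b, a]) :=
  pad2.1 (tet2 (pad2.2 h) (pad2.2 (isBd_diag a)) one3)

theorem isBd_trans (h : IsBd (seq [a, b])) (h' : IsBd (seq [b, c])) : IsBd (seq [a, c]) :=
  pad2.1 (tet1 (pad2.2 h) (pad2.2 h') one3)

theorem congr1 (h : IsBd (seq [a, b, c])) (hb : IsBd (seq [b, b'])) : IsBd (seq [a, b', c]) :=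
  tet1 h (pad2.2 hb) (pad2.2 (isBd_diag c))

theorem congr2 (h : IsBd (seq [a, b, c])) (hc : IsBd (seq [c, c'])) : IsBd (seq [a, b, c']) :=
  tet1 h (pad2.2 (isBd_diag b)) (pad2.2 hc)

theorem congr0 (h : IsBd (seq [a, b, c])) (ha : IsBd (seq [a, a'])) : IsBd (seq [a', b, c]) :=
  tet3 (congr2 (isBd_one_diag a) ha) (isBd_one_diag b) h

theorem unique1 (h : IsBd (seq [a, b, c])) (h' : IsBd (seq [a, b', c])) : IsBd (seq [b, b']) :=
  pad2.1 (tet2 h h' (pad2.2 (isBd_diag c)))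

theorem exists_mul (a c : X.PtSimplex (n + 1) x) : ∃ b, IsBd (seq [a, b, c]) := by
  obtain ⟨s, hs⟩ := exists_isBd (seq [a, cst, c]) 1 (by omega)
  refine ⟨s, ?_⟩
  convert hs using 1
  funext i; rcases i with _ | _ | _ | i <;> simp [seq, Function.update]

theorem exists_inv (c : X.PtSimplex (n + 1) x) : ∃ a, IsBd (seq [a, cst, c]) := by
  obtain ⟨s, hs⟩ := exists_isBd (seq [cst, cst, c]) 0 (by omega)
  refine ⟨s, ?_⟩
  convert hs using 1
  funext i; rcases i with _ | _ | _ | i <;> simp [seq, Function.update]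

theorem isBd_assoc {p q r pq qr pqr : X.PtSimplex (n + 1) x} (h1 : IsBd (seq [p, pq, q]))
    (h2 : IsBd (seq [q, qr, r])) (h3 : IsBd (seq [pq, pqr, r])) : IsBd (seq [p, pqr, qr]) :=
  tet1 h1 h3 h2

end group

section comm

variable [SSet.KanComplex X] {a b c s t u p q r : X.PtSimplex (n + 2) x}

theorem pad3 : IsBd (seq [a, b, c, cst]) ↔ IsBd (seq [a, b, c]) := by
  rw [← seq_snoc_one [a, b, c]]; rfl

theorem diag4 (a : X.PtSimplex (n + 2) x) : IsBd (seq [a, a, cst, cst]) :=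
  pad3.2 (pad2.2 (isBd_diag a))

theorem diag4' (a : X.PtSimplex (n + 2) x) : IsBd (seq [cst, a, a, cst]) := pad3.2 (isBd_one_diag a)

theorem diag4'' (a : X.PtSimplex (n + 2) x) : IsBd (seq [cst, cst, a, a]) := isBd_deg a 2 (by omega)

theorem one4 : IsBd (seq [(cst : X.PtSimplex (n + 2) x), cst, cst, cst]) := diag4 _

theorem comm_aux1 (h : IsBd (seq [u, t, p, cst])) (h' : IsBd (seq [cst, q, t, s])) :
    IsBd (seq [u, q, p, s]) := by
  have := isBd_five cst u u cst q t s p s cst 2 (by omega) (fun _ => diag4' u) (fun _ => h') (by simp)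
    (fun _ => h) (fun _ => diag4' s)
  convert this using 1
  funext i; rcases i with _ | _ | _ | _ | i <;> rfl

theorem comm_aux2 (h : IsBd (seq [u, q, p, s])) (h' : IsBd (seq [cst, q, t, s])) :
    IsBd (seq [u, t, p, cst]) := by
  have := isBd_five cst u u cst q t s p s cst 3 (by omega) (fun _ => diag4' u) (fun _ => h') (fun _ => h)
    (by simp) (fun _ => diag4' s)
  convert this using 1
  funext i; rcases i with _ | _ | _ | _ | i <;> simp [row, table5, seq]

theorem comm_aux3 (f : X.PtSimplex (n + 2) x) : IsBd (seq [f, cst, cst, f]) :=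
  comm_aux1 (diag4 f) (diag4'' f)

theorem comm_aux4 (h : IsBd (seq [r, q, cst, p])) : IsBd (seq [q, cst, p, r]) := by
  have := isBd_five q cst p r cst cst q cst cst p 0 (by omega) (by simp) (fun _ => comm_aux3 q)
    (fun _ => one4) (fun _ => comm_aux3 p) (fun _ => h)
  convert this using 1
  funext i; rcases i with _ | _ | _ | _ | i <;> rfl

theorem comm_aux5 (h : IsBd (seq [c, cst, b, a])) : IsBd (seq [cst, b, a, c]) := by
  have := isBd_five cst b a c cst cst cst cst b a 0 (by omega) (by simp) (fun _ => one4)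
    (fun _ => comm_aux3 b) (fun _ => comm_aux3 a) (fun _ => h)
  convert this using 1
  funext i; rcases i with _ | _ | _ | _ | i <;> rfl

theorem isBd_comm (h : IsBd (seq [c, b, a])) : IsBd (seq [a, b, c]) := by
  have h1 : IsBd (seq [c, cst, a, b]) := comm_aux1 (pad3.2 h) (diag4'' b)
  have h2 : IsBd (seq [cst, a, b, c]) := comm_aux5 h1
  have h3 : IsBd (seq [b, a, cst, c]) := comm_aux1 (diag4 b) h2
  have h4 : IsBd (seq [a, cst, c, b]) := comm_aux4 h3
  exact pad3.1 (comm_aux2 h4 (diag4'' b))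

end comm


theorem isBd_two_iff {f g : X.PtSimplex n x} :
    Nonempty (SSet.PtSimplex.RelStruct f g (Fin.last n)) ↔ IsBd (seq [g, f]) := by
  constructor
  · rintro ⟨r⟩
    refine ⟨r.map, fun j => ?_⟩
    have hj := j.2
    rcases (show j = (Fin.last n).succ ∨ j = (Fin.last n).castSucc ∨ (j : ℕ) < n by
      simp only [Fin.ext_iff, Fin.val_succ, Fin.val_last, Fin.val_castSucc]; omega) with rfl | rfl | h
    · rw [r.δ_succ_map]; simp [seq]
    · rw [r.δ_castSucc_map]
      have : n + 1 - n = 1 := by omega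
      simp [seq, this]
    · rw [r.δ_map_of_lt _ (by rw [Fin.lt_def]; simpa using h)]
      obtain ⟨m, hm⟩ : ∃ m, n + 1 - (j : ℕ) = m + 2 := ⟨n - 1 - j, by omega⟩
      rw [hm]; rfl
  · rintro ⟨W, hW⟩
    refine ⟨⟨W, ?_, ?_, fun j hj => ?_, fun j hj => ?_⟩⟩
    · rw [hW]
      have : n + 1 - n = 1 := by omega
      simp [seq, this]
    · rw [hW]; simp [seq]
    · rw [hW]
      have : (j : ℕ) < n := by simpa [Fin.lt_def] using hj
      obtain ⟨m, hm⟩ : ∃ m, n + 1 - (j : ℕ) = m + 2 := ⟨n - 1 - j, by omega⟩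
      rw [hm]; rfl
    · exfalso
      have : n + 1 < (j : ℕ) := by simpa [Fin.lt_def] using hj
      have := j.2
      omega

theorem isBd_three_iff {f g h : X.PtSimplex (n + 1) x} :
    Nonempty (SSet.PtSimplex.MulStruct f g h (Fin.last n)) ↔ IsBd (seq [f, h, g]) := by
  constructor
  · rintro ⟨r⟩
    refine ⟨r.map, fun j => ?_⟩
    have hj := j.2
    rcases (show j = (Fin.last n).succ.succ ∨ j = (Fin.last n).castSucc.succ ∨
        j = (Fin.last n).castSucc.castSucc ∨ (j : ℕ) < n by
      simp only [Fin.ext_iff, Fin.val_succ, Fin.val_last, Fin.val_castSucc]; omega) with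
      rfl | rfl | rfl | h
    · rw [r.δ_succ_succ_map]; simp [seq]
    · rw [r.δ_succ_castSucc_map]
      have : n + 1 + 1 - (n + 1) = 1 := by omega
      simp [seq, this]
    · rw [r.δ_castSucc_castSucc_map]
      have : n + 1 + 1 - n = 2 := by omega
      simp [seq, this]
    · rw [r.δ_map_of_lt _ (by rw [Fin.lt_def]; simpa using h)]
      obtain ⟨m, hm⟩ : ∃ m, n + 1 + 1 - (j : ℕ) = m + 3 := ⟨n - 1 - j, by omega⟩
      rw [hm]; rfl
  · rintro ⟨W, hW⟩
    refine ⟨⟨W, ?_, ?_, ?_, fun j hj => ?_, fun j hj => ?_⟩⟩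
    · rw [hW]
      have : n + 1 + 1 - n = 2 := by omega
      simp [seq, this]
    · rw [hW]
      have : n + 1 + 1 - (n + 1) = 1 := by omega
      simp [seq, this]
    · rw [hW]; simp [seq]
    · rw [hW]
      have : (j : ℕ) < n := by simpa [Fin.lt_def] using hj
      obtain ⟨m, hm⟩ : ∃ m, n + 1 + 1 - (j : ℕ) = m + 3 := ⟨n - 1 - j, by omega⟩
      rw [hm]; rfl
    · exfalso
      have : n + 2 < (j : ℕ) := by simpa [Fin.lt_def] using hj
      have := j.2
      omega

end KanGroup

open KanGroup

/-- The homotopy group (or pointed set, for `n = 0`) `π_n(X, x)` of a Kan complex `X`: simplices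
`Δ[n] ⟶ X` sending the boundary to the vertex `x`, up to simplicial homotopy. -/
def pi (n : ℕ) (X : SSet.{w}) (x : X _⦋0⦌) : Type w :=
  Quot fun f g : X.PtSimplex n x => Nonempty (SSet.PtSimplex.RelStruct f g (Fin.last n))

namespace pi

variable {n : ℕ} {X Y : SSet.{w}} {x : X _⦋0⦌} {y : Y _⦋0⦌}

/-- The class of a simplex with trivial boundary. -/
def mk (f : X.PtSimplex n x) : pi n X x := Quot.mk _ f

theorem mk_surjective : Function.Surjective (mk : X.PtSimplex n x → pi n X x) := Quot.mk_surjective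

theorem mk_eq_mk [SSet.KanComplex X] {f g : X.PtSimplex (n + 1) x} :
    mk f = mk g ↔ IsBd (seq [f, g]) := by
  constructor
  · intro h
    have h' := Quot.eqvGen_exact h
    clear h
    induction h' with
    | rel a b h => exact isBd_symm (isBd_two_iff.1 h)
    | refl a => exact isBd_diag a
    | symm a b _ ih => exact isBd_symm ih
    | trans a b c _ _ ih1 ih2 => exact isBd_trans ih1 ih2
  · intro h
    exact Quot.sound (isBd_two_iff.2 (isBd_symm h))

section

variable [SSet.KanComplex X]

/-- The product of homotopy classes: `mk f * mk g = mk h` if there is an `(n+2)`-simplex with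
faces `d_{n+2} = f`, `d_{n+1} = h`, `d_n = g` and all other faces constant. -/
noncomputable instance : Mul (pi (n + 1) X x) where
  mul := Quot.lift₂ (fun f g => mk (exists_mul f g).choose)
    (fun f g g' h => mk_eq_mk.2 <| unique1
      (congr2 (exists_mul f g).choose_spec (isBd_symm (isBd_two_iff.1 h)))
      (exists_mul f g').choose_spec)
    (fun f f' g h => mk_eq_mk.2 <| unique1
      (congr0 (exists_mul f g).choose_spec (isBd_symm (isBd_two_iff.1 h)))
      (exists_mul f' g).choose_spec)

theorem mk_mul_mk {f g h : X.PtSimplex (n + 1) x} : mk f * mk g = mk h ↔ IsBd (seq [f, h, g]) := by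
  have e : mk f * mk g = mk (exists_mul f g).choose := rfl
  rw [e, mk_eq_mk]
  exact ⟨fun h' => congr1 (exists_mul f g).choose_spec h',
    fun h' => unique1 (exists_mul f g).choose_spec h'⟩

theorem mk_mul_mk_iff {f g h : X.PtSimplex (n + 1) x} :
    mk f * mk g = mk h ↔ Nonempty (SSet.PtSimplex.MulStruct f g h (Fin.last n)) :=
  mk_mul_mk.trans isBd_three_iff.symm

noncomputable instance : One (pi n X x) where
  one := mk .const

noncomputable instance : Inv (pi (n + 1) X x) where
  inv a := mk (exists_inv (Quot.out a)).choose

noncomputable instance : Group (pi (n + 1) X x) :=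
  Group.ofLeftAxioms
    (fun a b c => by
      obtain ⟨f, rfl⟩ := mk_surjective a
      obtain ⟨g, rfl⟩ := mk_surjective b
      obtain ⟨h, rfl⟩ := mk_surjective c
      obtain ⟨fg, h1⟩ := exists_mul f g
      obtain ⟨gh, h2⟩ := exists_mul g h
      obtain ⟨fgh, h3⟩ := exists_mul fg h
      rw [mk_mul_mk.2 h1, mk_mul_mk.2 h2, mk_mul_mk.2 h3]
      exact (mk_mul_mk.2 (isBd_assoc h1 h2 h3)).symm)
    (fun a => by
      obtain ⟨f, rfl⟩ := mk_surjective a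
      exact mk_mul_mk.2 (isBd_one_diag f))
    (fun a => by
      have h := (exists_inv (Quot.out a)).choose_spec
      have := mk_mul_mk.2 h
      have e : mk (Quot.out a) = a := Quot.out_eq a
      rw [e] at this
      exact this)

noncomputable instance : CommGroup (pi (n + 2) X x) where
  __ := (inferInstance : Group (pi (n + 1 + 1) X x))
  mul_comm a b := by
    obtain ⟨f, rfl⟩ := mk_surjective a
    obtain ⟨g, rfl⟩ := mk_surjective b
    obtain ⟨h, h1⟩ := exists_mul f g
    exact (mk_mul_mk.2 h1).trans (mk_mul_mk.2 (isBd_comm h1)).symm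

end

end pi

/-- The image of a simplex with trivial boundary under a pointed map. -/
@[simps]
def mapPt {n : ℕ} {X Y : SSet.{w}} {x : X _⦋0⦌} {y : Y _⦋0⦌} (φ : X ⟶ Y) (h : φ.app _ x = y)
    (f : X.PtSimplex n x) : Y.PtSimplex n y where
  map := f.map ≫ φ
  comm := by rw [f.comm_assoc]; simp [SSet.const_comp, h]

/-- The map induced on homotopy groups by a pointed map. -/
def piMap (n : ℕ) {X Y : SSet.{w}} {x : X _⦋0⦌} {y : Y _⦋0⦌} (φ : X ⟶ Y) (h : φ.app _ x = y) :
    pi n X x → pi n Y y :=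
  Quot.lift (fun f => pi.mk (mapPt φ h f)) (by
    rintro f g ⟨r⟩
    exact Quot.sound ⟨⟨r.map ≫ φ, by simp, by rw [r.δ_succ_map_assoc]; rfl,
      fun j hj => by rw [r.δ_map_of_lt_assoc j hj]; simp [h],
      fun j hj => by rw [r.δ_map_of_gt_assoc j hj]; simp [h]⟩⟩)

/-- The homomorphism induced on homotopy groups by a pointed map. -/
noncomputable def piHom (n : ℕ) {X Y : SSet.{w}} [SSet.KanComplex X] [SSet.KanComplex Y]
    {x : X _⦋0⦌} {y : Y _⦋0⦌} (φ : X ⟶ Y) (h : φ.app _ x = y) :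
    pi (n + 1) X x →* pi (n + 1) Y y :=
  MonoidHom.mk' (piMap (n + 1) φ h) (fun a b => by
    obtain ⟨f, rfl⟩ := pi.mk_surjective a
    obtain ⟨g, rfl⟩ := pi.mk_surjective b
    obtain ⟨k, h1⟩ := exists_mul f g
    rw [pi.mk_mul_mk.2 h1]
    obtain ⟨r⟩ := isBd_three_iff.2 h1
    exact (pi.mk_mul_mk_iff.2 ⟨⟨r.map ≫ φ, by simp, by simp, by rw [r.δ_succ_succ_map_assoc]; rfl,
      fun j hj => by rw [r.δ_map_of_lt_assoc j hj]; simp [h],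
      fun j hj => by rw [r.δ_map_of_gt_assoc j hj]; simp [h]⟩⟩).symm)


/-- A diagram of pointed simplicial sets. For `D = Cᵒᵖ` this is a pointed simplicial presheaf on
`C`, for `D = SimplexCategory` it is a pointed cosimplicial space. -/
structure PtDiagram (D : Type u) [Category.{v} D] where
  /-- The underlying diagram of simplicial sets. -/
  functor : D ⥤ SSet.{w}
  /-- The base points. -/
  pt (d : D) : functor.obj d _⦋0⦌
  map_pt {d e : D} (f : d ⟶ e) : (functor.map f).app _ (pt d) = pt e

/-- A morphism of diagrams of pointed simplicial sets. -/
structure PtDiagram.Hom {D : Type u} [Category.{v} D] (Y Z : PtDiagram.{w} D) where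
  /-- The underlying natural transformation. -/
  hom : Y.functor ⟶ Z.functor
  hom_pt (d : D) : (hom.app d).app _ (Y.pt d) = Z.pt d

section hypercover

variable {C : Type u} [Category.{v} C]

/-- A `1`-hypercover `V_A → U_I → S` of an object `S` of a site: a simplicial object `U` in formal
coproducts of objects of `C`, with an augmentation to `S`, such that the family `U_i → S` is
covering, the families `V_{ij}^α → U_i ×_S U_j` are covering, and `U` is `1`-coskeletal. The index
`α` together with `i` and `j` is an element `a` of the index type of `U _⦋1⦌`; the indices `i` and
`j` are the images of `a` under the faces `U.δ 1` and `U.δ 0`. -/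
structure OneHypercover (J : GrothendieckTopology C) (S : C) where
  /-- The underlying simplicial object. -/
  obj : SimplicialObject (FormalCoproduct.{w} C)
  /-- The augmentation. -/
  aug : obj _⦋0⦌ ⟶ (FormalCoproduct.incl C).obj S
  aug_comp : obj.δ (1 : Fin 2) ≫ aug = obj.δ (0 : Fin 2) ≫ aug
  /-- The `U_i` cover `S`. -/
  cover₀ : Sieve.ofArrows (obj _⦋0⦌).obj aug.φ ∈ J S
  /-- The `V_{ij}^α` cover `U_i ×_S U_j`: for all `p : T ⟶ U_i` and `q : T ⟶ U_j` which agree on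
  `S`, the map `(p, q)` lifts to some `V_{ij}^α` locally on `T`. -/
  cover₁ ⦃T : C⦄ (p q : (FormalCoproduct.incl C).obj T ⟶ obj _⦋0⦌) (h : p ≫ aug = q ≫ aug) :
    ∃ R ∈ J T, ∀ ⦃T' : C⦄ (f : T' ⟶ T), R f →
      ∃ g : (FormalCoproduct.incl C).obj T' ⟶ obj _⦋1⦌,
        g ≫ obj.δ (1 : Fin 2) = (FormalCoproduct.incl C).map f ≫ p ∧
        g ≫ obj.δ (0 : Fin 2) = (FormalCoproduct.incl C).map f ≫ q
  /-- As a simplicial presheaf, `U` is `1`-coskeletal. -/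
  coskeletal (T : C) : SimplicialObject.IsCoskeletal
    (obj ⋙ coyoneda.obj (op ((FormalCoproduct.incl C).obj T))) 1

/-- The value `∏_i X(K_i)` of a simplicial presheaf on a formal coproduct `∐_i K_i`. -/
@[simps]
def evalObj (X : Cᵒᵖ ⥤ SSet.{w}) (K : FormalCoproduct.{w} C) : SSet.{w} where
  obj n := ∀ i : K.I, (X.obj (op (K.obj i))).obj n
  map f := ↾fun x i => (X.obj (op (K.obj i))).map f (x i)

/-- The projection `∏_i X(K_i) ⟶ X(K_i)`. -/
@[simps]
def evalProj (X : Cᵒᵖ ⥤ SSet.{w}) (K : FormalCoproduct.{w} C) (i : K.I) :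
    evalObj X K ⟶ X.obj (op (K.obj i)) where
  app n := ↾fun x => x i

/-- The functoriality of `evalObj`. -/
@[simps]
def evalMap (X : Cᵒᵖ ⥤ SSet.{w}) {K L : FormalCoproduct.{w} C} (f : K ⟶ L) :
    evalObj X L ⟶ evalObj X K where
  app n := ↾fun x i => (X.map (f.φ i).op).app n (x (f.f i))
  naturality n n' g := by
    ext x
    funext i
    exact NatTrans.naturality_apply (X.map (f.φ i).op) g (x (f.f i))

theorem evalMap_id (X : Cᵒᵖ ⥤ SSet.{w}) (K : FormalCoproduct.{w} C) :
    evalMap X (𝟙 K) = 𝟙 (evalObj X K) := by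
  ext n x
  funext i
  exact congrArg (fun (F : X.obj (op (K.obj i)) ⟶ _) => F.app n (x i)) (X.map_id (op (K.obj i)))

theorem evalMap_comp (X : Cᵒᵖ ⥤ SSet.{w}) {K L M : FormalCoproduct.{w} C} (f : K ⟶ L)
    (g : L ⟶ M) : evalMap X (f ≫ g) = evalMap X g ≫ evalMap X f := by
  ext n x
  funext i
  exact congrArg (fun (F : X.obj (op (M.obj (g.f (f.f i)))) ⟶ X.obj (op (K.obj i))) =>
    F.app n (x (g.f (f.f i)))) (X.map_comp (g.φ (f.f i)).op (f.φ i).op)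

/-- The pointed cosimplicial space `X_U` obtained by evaluating a pointed simplicial presheaf on a
simplicial object of formal coproducts. -/
@[simps]
def PtDiagram.cosimplicial (X : PtDiagram.{w} Cᵒᵖ) (U : SimplicialObject (FormalCoproduct.{w} C)) :
    PtDiagram.{w} SimplexCategory where
  functor :=
    { obj p := evalObj X.functor (U.obj (op p))
      map f := evalMap X.functor (U.map f.op)
      map_id p := by rw [op_id, U.map_id, evalMap_id]
      map_comp f g := by rw [op_comp, U.map_comp, evalMap_comp] }
  pt p := fun i => X.pt _
  map_pt f := by
    funext i
    exact X.map_pt _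

end hypercover


section cech

variable {C : Type u} [Category.{v} C] (X : PtDiagram.{w} Cᵒᵖ)
  (U : SimplicialObject (FormalCoproduct.{w} C))

/-- The Čech cochains `Č^p(U, π_t X) = ∏_i π_t(X(U_{p,i}))`. -/
abbrev Cochain (t p : ℕ) : Type w :=
  ∀ i : (U _⦋p⦌).I, pi t (X.functor.obj (op ((U _⦋p⦌).obj i))) (X.pt _)

variable [∀ V, SSet.KanComplex (X.functor.obj V)]

/-- The `k`-th coface `Č^p(U, π_{t+1} X) ⟶ Č^{p+1}(U, π_{t+1} X)`. -/
noncomputable def coface (t p : ℕ) (k : Fin (p + 2)) :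
    Cochain X U (t + 1) p →* Cochain X U (t + 1) (p + 1) :=
  MonoidHom.mk' (fun c i => piHom t (X.functor.map ((U.δ k).φ i).op) (X.map_pt _) (c ((U.δ k).f i)))
    (fun c c' => by funext i; exact map_mul _ _ _)

/-- `Ȟ⁰(U, π_{t+1} X)`: the equalizer of the two cofaces from degree `0` to degree `1`. For `t > 0`
this is the kernel of the Čech coboundary. -/
noncomputable def cechH0 (t : ℕ) : Subgroup (Cochain X U (t + 1) 0) :=
  MonoidHom.eqLocus (coface X U t 0 1) (coface X U t 0 0)

/-- The Čech coboundary (in multiplicative notation): the alternating product of the cofaces. -/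
noncomputable def cobd (t p : ℕ) : Cochain X U (t + 2) p →* Cochain X U (t + 2) (p + 1) :=
  ∏ k : Fin (p + 2), coface X U (t + 1) p k ^ ((-1 : ℤ) ^ (k : ℕ))

/-- The Čech cocycles of degree `2` with values in `π_{t+2} X`. -/
noncomputable abbrev cechZ2 (t : ℕ) : Subgroup (Cochain X U (t + 2) 2) :=
  (cobd X U t 2).ker

/-- `Ȟ²(U, π_{t+2} X)` (in multiplicative notation). -/
abbrev CechH2 (t : ℕ) : Type w :=
  cechZ2 X U t ⧸ ((cobd X U t 1).range.subgroupOf (cechZ2 X U t))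

end cech

/-- A map of pointed Kan complexes is a weak equivalence when it induces bijections on all homotopy
groups for all base points. -/
def IsWeakEquiv {A B : SSet.{w}} (f : A ⟶ B) : Prop :=
  ∀ (n : ℕ) (a : A _⦋0⦌), Function.Bijective (piMap n f rfl : pi n A a → pi n B (f.app _ a))

section cosimplicial

/-- The matching object `M^n Z` of a cosimplicial space: compatible families of elements `x_φ ∈ Z^k`
for all surjections `φ : [n] ⟶ [k]` with `k < n`. It is the target of the matching map
`Z^n ⟶ M^n Z`. -/
@[simps]
def matching (Z : SimplexCategory ⥤ SSet.{w}) (n : ℕ) : SSet.{w} where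
  obj p := { x : ∀ (k : Fin n) (φ : ⦋n⦌ ⟶ ⦋(k : ℕ)⦌) (_ : Epi φ), (Z.obj ⦋(k : ℕ)⦌).obj p //
    ∀ (k l : Fin n) (φ : ⦋n⦌ ⟶ ⦋(k : ℕ)⦌) (hφ : Epi φ) (ψ : ⦋(k : ℕ)⦌ ⟶ ⦋(l : ℕ)⦌)
      (h : Epi (φ ≫ ψ)), (Z.map ψ).app p (x k φ hφ) = x l (φ ≫ ψ) h }
  map g := ↾fun x => ⟨fun k φ hφ => (Z.obj _).map g (x.1 k φ hφ), fun k l φ hφ ψ h => by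
    refine Eq.trans ?_ (congrArg ((Z.obj ⦋(l : ℕ)⦌).map g) (x.2 k l φ hφ ψ h))
    exact NatTrans.naturality_apply (Z.map ψ) g _⟩

/-- The matching map `Z^n ⟶ M^n Z`, given by the codegeneracies. -/
@[simps]
def matchingMap (Z : SimplexCategory ⥤ SSet.{w}) (n : ℕ) : Z.obj ⦋n⦌ ⟶ matching Z n where
  app p := ↾fun x => ⟨fun k φ _ => (Z.map φ).app p x, fun k l φ hφ ψ h => by simp⟩
  naturality p q g := by
    ext x
    apply Subtype.ext
    funext k φ hφ
    exact NatTrans.naturality_apply (Z.map φ) g x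

/-- A cosimplicial space is Reedy fibrant when its matching maps `Z^n ⟶ M^n Z` are Kan fibrations
for all `n`. (`M^0 Z` is a point.) -/
def ReedyFibrant (Z : SimplexCategory ⥤ SSet.{w}) : Prop :=
  ∀ n, SSet.modelCategoryQuillen.J.rlp (matchingMap Z n)

theorem skeleton_map {A B : SSet.{w}} (f : A ⟶ B) (n : ℕ) :
    A.skeleton n ≤ (B.skeleton n).preimage f :=
  iSup_le fun i => iSup_le fun x => by
    rw [SSet.Subcomplex.ofSimplex_le_iff]
    exact B.mem_skeleton (f.app _ x.1) i.2

theorem skeleton_stdSimplex (s : ℕ) : (Δ[s] : SSet.{w}).skeleton (s + 1) = ⊤ := by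
  rw [← top_le_iff, SSet.Subcomplex.le_iff_contains_nonDegenerate]
  intro n x _
  exact (Δ[s] : SSet.{w}).mem_skeleton x.1 (SSet.dim_lt_of_nonDegenerate _ x (s + 1))

/-- The map induced on skeleta by a map of simplicial sets. -/
def skeletonMap {A B : SSet.{w}} (f : A ⟶ B) (n : ℕ) :
    (A.skeleton n : SSet) ⟶ (B.skeleton n : SSet) :=
  SSet.Subcomplex.lift ((A.skeleton n).ι ≫ f) (by
    rintro p _ ⟨x, rfl⟩
    exact skeleton_map f n _ x.2)

/-- The cosimplicial space `Δ[s]`: the `s`-skeleton of the cosimplicial space `p ↦ Δ[p]`. -/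
@[simps]
def cosimplicialSk (s : ℕ) : SimplexCategory ⥤ SSet.{w} where
  obj p := ((SSet.stdSimplex.obj p : SSet.{w}).skeleton (s + 1) : SSet)
  map f := skeletonMap (SSet.stdSimplex.map f) (s + 1)
  map_id p := by
    exact (congrArg (fun f => skeletonMap f (s + 1)) (CategoryTheory.Functor.map_id _ p)).trans rfl
  map_comp f g := by
    exact (congrArg (fun f => skeletonMap f (s + 1)) (CategoryTheory.Functor.map_comp _ f g)).trans rfl

/-- The inclusion of the `s`-skeleton in the `(s+1)`-skeleton. -/
@[simps]
def cosimplicialSkι (s : ℕ) : cosimplicialSk.{w} s ⟶ cosimplicialSk.{w} (s + 1) where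
  app p := SSet.Subcomplex.homOfLE ((SSet.skeleton _).monotone (Nat.le_succ _))
  naturality p q f := by rfl

/-- The mapping complex of two cosimplicial spaces: an `n`-simplex is a natural family of maps
`Δ[n] ⊗ A^p ⟶ Z^p`. -/
@[simps]
def mapComplex (A Z : SimplexCategory ⥤ SSet.{w}) : SSet.{w} where
  obj n := A ⋙ tensorLeft (SSet.stdSimplex.obj n.unop) ⟶ Z
  map g := ↾fun f =>
    { app p := SSet.stdSimplex.map g.unop ▷ A.obj p ≫ f.app p
      naturality p q h := by
        have e := f.naturality h
        change _ ◁ A.map h ≫ f.app q = _ at e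
        change _ ◁ A.map h ≫ _ ▷ A.obj q ≫ f.app q = _
        rw [whisker_exchange_assoc, e, Category.assoc] }
  map_id n := by
    refine ConcreteCategory.hom_ext _ _ fun f => NatTrans.ext (funext fun p => ?_)
    have e : SSet.stdSimplex.{w}.map (𝟙 n.unop) = 𝟙 _ := CategoryTheory.Functor.map_id _ _
    change SSet.stdSimplex.map (𝟙 n.unop) ▷ A.obj p ≫ f.app p = f.app p
    rw [e, id_whiskerRight]
    rfl
  map_comp g h := by
    refine ConcreteCategory.hom_ext _ _ fun f => NatTrans.ext (funext fun p => ?_)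
    have e : SSet.stdSimplex.{w}.map (h.unop ≫ g.unop) = _ := CategoryTheory.Functor.map_comp _ _ _
    change SSet.stdSimplex.map (h.unop ≫ g.unop) ▷ A.obj p ≫ f.app p =
      SSet.stdSimplex.map h.unop ▷ A.obj p ≫ SSet.stdSimplex.map g.unop ▷ A.obj p ≫ f.app p
    rw [e, comp_whiskerRight, Category.assoc]

/-- The map of mapping complexes induced by a map of the sources. -/
@[simps]
def mapComplexMap {A B : SimplexCategory ⥤ SSet.{w}} (f : A ⟶ B) (Z : SimplexCategory ⥤ SSet.{w}) :
    mapComplex B Z ⟶ mapComplex A Z where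
  app n := ↾fun φ => Functor.whiskerRight f (tensorLeft (SSet.stdSimplex.obj n.unop)) ≫ φ
  naturality n n' g := by
    refine ConcreteCategory.hom_ext _ _ fun φ => NatTrans.ext (funext fun p => ?_)
    exact (whisker_exchange_assoc (SSet.stdSimplex.map g.unop) (f.app p) (φ.app p)).symm

/-- The `s`-th total space `Tot_s Z`, for `Z` pointed. (The mapping space of unpointed maps from
`Δ[s]` to `Z` is the mapping space of pointed maps from `Δ[s]_+` to `Z`.) -/
abbrev Tot (s : ℕ) (Z : PtDiagram.{w} SimplexCategory) : SSet.{w} :=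
  mapComplex (cosimplicialSk s) Z.functor

/-- The constant natural transformation to a pointed cosimplicial space. -/
def constPt (A : SimplexCategory ⥤ SSet.{w}) (Z : PtDiagram.{w} SimplexCategory) :
    A ⟶ Z.functor where
  app p := SSet.const (Z.pt p)
  naturality p q f := by simp [SSet.const_comp, Z.map_pt]

/-- The base point of the total space. -/
def Tot.pt (s : ℕ) (Z : PtDiagram.{w} SimplexCategory) : Tot s Z _⦋0⦌ := constPt _ Z

/-- The map `Tot_{s+1} Z ⟶ Tot_s Z` in the tower of total spaces. -/
def Tot.res (s : ℕ) (Z : PtDiagram.{w} SimplexCategory) : Tot (s + 1) Z ⟶ Tot s Z :=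
  mapComplexMap (cosimplicialSkι s) Z.functor

theorem Tot.res_pt (s : ℕ) (Z : PtDiagram.{w} SimplexCategory) :
    (Tot.res s Z).app _ (Tot.pt (s + 1) Z) = Tot.pt s Z := by
  apply NatTrans.ext
  funext p
  rfl

/-- The isomorphism of `Δ[s]` with its `s`-skeleton. -/
noncomputable def stdSimplexIso (s : ℕ) : (Δ[s] : SSet.{w}) ≅ (cosimplicialSk s).obj ⦋s⦌ :=
  (SSet.Subcomplex.topIso _).symm ≪≫ SSet.Subcomplex.eqToIso (skeleton_stdSimplex s).symm

/-- The map `Δ[m] ⊗ Δ[s] ⟶ Z^s` which is the component in cosimplicial degree `s` of an `m`-simplex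
of `Tot_s Z`. It determines the simplex when `s = 0`, and for every `s` when the image in
`Tot_{s-1} Z` is given. -/
noncomputable def component {m s : ℕ} {Z : PtDiagram.{w} SimplexCategory} (f : Δ[m] ⟶ Tot s Z) :
    (Δ[m] : SSet.{w}) ⊗ (Δ[s] : SSet.{w}) ⟶ Z.functor.obj ⦋s⦌ :=
  Δ[m] ◁ (stdSimplexIso s).hom ≫ NatTrans.app (SSet.yonedaEquiv f) ⦋s⦌

end cosimplicial

section spectral

/-- The vertices of the map `Δ[m] ⊗ Δ[s] ⟶ Δ[m + s]` of relative degree one. -/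
def collapseFun (m s : ℕ) : Fin (m + 1) × Fin (s + 1) →o Fin (m + s + 1) where
  toFun p := if p.2 = 0 then ⟨p.1, by omega⟩ else ⟨m + p.2, by omega⟩
  monotone' := by
    rintro ⟨a, b⟩ ⟨c, d⟩ ⟨h, k⟩
    have h1 : (a : ℕ) ≤ c := h
    have h2 : (b : ℕ) ≤ d := k
    have h3 := a.2
    have h4 : b = 0 ↔ (b : ℕ) = 0 := Fin.ext_iff
    have h5 : d = 0 ↔ (d : ℕ) = 0 := Fin.ext_iff
    dsimp only
    split_ifs <;> rw [Fin.mk_le_mk] <;> omega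

/-- The map `Δ[m] ⊗ Δ[s] ⟶ Δ[m + s]` given on vertices by `(b, 0) ↦ b` and `(b, a) ↦ m + a` for
`a > 0`. It sends the boundary to the boundary, and is injective on the interior of exactly one of
the nondegenerate `(m+s)`-simplices of `Δ[m] ⊗ Δ[s]` and collapses all the others. So it induces a
homotopy equivalence of the quotients by the boundaries. -/
def collapse (m s : ℕ) : (Δ[m] : SSet.{w}) ⊗ (Δ[s] : SSet.{w}) ⟶ Δ[m + s] where
  app p := ↾fun x => SSet.stdSimplex.objEquiv.symm (SimplexCategory.Hom.mk
    ((collapseFun m s).comp (OrderHom.prod (SSet.stdSimplex.asOrderHom x.1)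
      (SSet.stdSimplex.asOrderHom x.2))))

/-- The map `ρ : Δ[m] ⊗ Δ[s] ⟶ K`, which sends the boundary to the base point `k`, represents the
class `c ∈ π_{m+s}(K, k)`: up to homotopy relative to the boundary it factors through a
representative of `c`. -/
def Represents {m s : ℕ} {K : SSet.{w}} {k : K _⦋0⦌}
    (ρ : (Δ[m] : SSet.{w}) ⊗ (Δ[s] : SSet.{w}) ⟶ K) (c : pi (m + s) K k) : Prop :=
  ∃ g : K.PtSimplex (m + s) k, pi.mk g = c ∧
    ∃ σ τ : SSet.RelativeMorphism ((SSet.boundary.{w} m).unionProd (SSet.boundary.{w} s))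
      (SSet.Subcomplex.ofSimplex k) (SSet.const ⟨k, SSet.Subcomplex.mem_ofSimplex_obj k⟩),
      σ.map = collapse m s ≫ g.map ∧ τ.map = ρ ∧ Nonempty (SSet.RelativeMorphism.Homotopy σ τ)

/-- The relation defining the second differential on `π_{m+1} Tot_0 Z` in the spectral sequence of
the tower of fibrations `… ⟶ Tot_2 Z ⟶ Tot_1 Z ⟶ Tot_0 Z`: the class `α ∈ π_{m+1} Tot_0 Z` lifts to
the class of a simplex `x` in `π_{m+1} Tot_1 Z`, and the image of this class under the connecting map
`π_{m+1} Tot_1 Z ⟶ π_m F`, for `F` the fibre of `Tot_2 Z ⟶ Tot_1 Z`, is the class of the simplex `z`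
of `F`. The connecting map is given as usual by lifting `x` to a simplex `θ` of `Tot_2 Z` all of
whose faces except for the `0`-th one are trivial; the `0`-th face is `z`. -/
def TowerD2 (Z : PtDiagram.{w} SimplexCategory) {m : ℕ} (α : pi (m + 1) (Tot 0 Z) (Tot.pt 0 Z))
    (z : (Tot 2 Z).PtSimplex m (Tot.pt 2 Z)) : Prop :=
  ∃ x : (Tot 1 Z).PtSimplex (m + 1) (Tot.pt 1 Z),
    piMap (m + 1) (Tot.res 0 Z) (Tot.res_pt 0 Z) (pi.mk x) = α ∧
    ∃ θ : (Δ[m + 1] : SSet.{w}) ⟶ Tot 2 Z, θ ≫ Tot.res 1 Z = x.map ∧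
      (∀ i : Fin (m + 2), i ≠ 0 → SSet.stdSimplex.δ i ≫ θ = SSet.const (Tot.pt 2 Z)) ∧
      SSet.stdSimplex.δ 0 ≫ θ = z.map

variable {C : Type u} [Category.{v} C] {X : PtDiagram.{w} Cᵒᵖ}
  {U : SimplicialObject (FormalCoproduct.{w} C)}

/-- The class `e ∈ π_t(∏_i X(U_{p,i}))` has components `c i ∈ π_t(X(U_{p,i}))`. -/
def HasComponents {t p : ℕ}
    (e : pi t ((X.cosimplicial U).functor.obj ⦋p⦌) ((X.cosimplicial U).pt ⦋p⦌))
    (c : Cochain X U t p) : Prop :=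
  ∀ i, piMap t (evalProj X.functor (U _⦋p⦌) i) rfl e = c i

variable [∀ V, SSet.KanComplex (X.functor.obj V)]

/-- The graph of the differential `d₂ : Ȟ⁰(U, π_{m+1} X) ⟶ Ȟ²(U, π_{m+2} X)` of the Čech spectral
sequence, computed in the pointed Reedy fibrant resolution `r : X_U ⟶ Z`. The class
`a ∈ Ȟ⁰(U, π_{m+1} X) ⊆ π_{m+1} X_U^0` corresponds under `π_{m+1} X_U^0 ≅ π_{m+1} Z^0` to an element
of `π_{m+1} Tot_0 Z`, and `b ∈ Ȟ²(U, π_{m+2} X)` is the class of a cocycle in `π_{m+2} X_U^2`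
which under `π_{m+2} X_U^2 ≅ π_{m+2} Z^2` corresponds to the component of an `m`-simplex of the fibre
of `Tot_2 Z ⟶ Tot_1 Z`. -/
def IsSpectralD2 {Z : PtDiagram.{w} SimplexCategory} (r : (X.cosimplicial U).Hom Z) {m : ℕ}
    (a : cechH0 X U m) (b : CechH2 X U m) : Prop :=
  ∃ (e₀ : pi (m + 1) _ _) (x₀ : (Tot 0 Z).PtSimplex (m + 1) (Tot.pt 0 Z))
    (z : (Tot 2 Z).PtSimplex m (Tot.pt 2 Z)) (e₂ : pi (m + 2) _ _) (c : cechZ2 X U m),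
    HasComponents e₀ a.1 ∧
    Represents (component x₀.map) (piMap (m + 1) (r.hom.app ⦋0⦌) (r.hom_pt ⦋0⦌) e₀) ∧
    TowerD2 Z (pi.mk x₀) z ∧
    Represents (component z.map) (piMap (m + 2) (r.hom.app ⦋2⦌) (r.hom_pt ⦋2⦌) e₂) ∧
    HasComponents e₂ c.1 ∧
    (c : CechH2 X U m) = b

end spectral

section fill

variable {C : Type u} [Category.{v} C] (X : PtDiagram.{w} Cᵒᵖ)
  (U : SimplicialObject (FormalCoproduct.{w} C))

/-- A pointed map `δ : S^t ⟶ X_U^0 = ∏_i X(U_i)`, given by its components `δ_i`. -/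
abbrev Sphere (t : ℕ) : Type w :=
  ∀ i : (U _⦋0⦌).I, (X.functor.obj (op ((U _⦋0⦌).obj i))).PtSimplex t (X.pt _)

variable {X U} {t : ℕ}

/-- The restriction of `δ_i` (for `k = 1`) or of `δ_j` (for `k = 0`) to `V_{ij}^α`, where `a` is the
index `(i, j, α)`. -/
def Sphere.restrict (δ : Sphere X U t) (k : Fin 2) (a : (U _⦋1⦌).I) :
    (X.functor.obj (op ((U _⦋1⦌).obj a))).PtSimplex t (X.pt _) :=
  mapPt (X.functor.map ((U.δ k).φ a).op) (X.map_pt _) (δ ((U.δ k).f a))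

/-- A choice of based homotopies `y_{ij}^α : δ_i ⟶ δ_j` on the `V_{ij}^α`. -/
abbrev Sphere.Homotopies (δ : Sphere X U t) : Type w :=
  ∀ a : (U _⦋1⦌).I, SSet.RelativeMorphism.Homotopy (δ.restrict 1 a) (δ.restrict 0 a)

/-- The map `w : Δ[t] ⊗ ∂Δ[2] ⟶ X_U^2` restricts on the `k`-th face of `Δ[2]` to the `k`-th coface of
the homotopies `y`. So if `b` is the index of `V_{ijk}^{αβγ}` and `y_{ij}^α`, `y_{jk}^β`, `y_{ik}^γ`
are the homotopies indexed by the faces of `b`, then the component of `w` in `X(V_{ijk}^{αβγ})` is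
given by the restrictions of `y_{ij}^α`, `y_{ik}^γ`, `y_{jk}^β` on the edges `01`, `02`, `12`. -/
def IsBoundaryMap {δ : Sphere X U t} (y : δ.Homotopies)
    (w : (Δ[t] : SSet.{w}) ⊗ (∂Δ[2] : SSet.{w}) ⟶ (X.cosimplicial U).functor.obj ⦋2⦌) : Prop :=
  ∀ (k : Fin 3) (b : (U _⦋2⦌).I),
    Δ[t] ◁ SSet.boundary.ι k ≫ w ≫ evalProj X.functor (U _⦋2⦌) b =
      (y ((U.δ k).f b)).h ≫ X.functor.map ((U.δ k).φ b).op

/-- A fill `Φ : Δ[t] ⊗ Δ[2] ⟶ X_U^2` of `w : Δ[t] ⊗ ∂Δ[2] ⟶ X_U^2` relative to the horn `Λ[t, n]`: it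
extends `w`, and is trivial on `Λ[t, n] ⊗ Δ[2]`. -/
def IsFill (n : Fin (t + 1))
    (w : (Δ[t] : SSet.{w}) ⊗ (∂Δ[2] : SSet.{w}) ⟶ (X.cosimplicial U).functor.obj ⦋2⦌)
    (Φ : (Δ[t] : SSet.{w}) ⊗ (Δ[2] : SSet.{w}) ⟶ (X.cosimplicial U).functor.obj ⦋2⦌) : Prop :=
  Δ[t] ◁ (SSet.boundary.{w} 2).ι ≫ Φ = w ∧
    (SSet.horn.{w} t n).ι ▷ Δ[2] ≫ Φ = SSet.const ((X.cosimplicial U).pt ⦋2⦌)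

end fill

end CechDiff

/-!
The proof translates the homotopy data into simplices of function complexes, computes the
obstruction there in a form which makes sense for every pointed cosimplicial space, and compares
`X_U` with `Z`.

*Loops and paths.* For a pointed Kan complex `K` let `loops m K` be the complex of maps `Δ[m] ⟶ K`
which are trivial on `∂Δ[m]`, and `paths n K` the complex of maps `Δ[m + 1] ⟶ K` which are trivial
on `Λ[m + 1, n]`. Restriction to the `n`-th face is a fibration from the contractible complex of
paths to `loops m K`, with fibre `loops (m + 1) K`. A family of spheres with homotopies on the
`1`-simplices and a fill of the map `w` is the same as `Obs`: a vertex `a` of the loops on `Y^0`,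
an edge `y` of the loops on `Y^1` between the cofaces of `a`, and a triangle `Φ` of paths on `Y^2`
whose edges are the cofaces of `y`. Fills exist since the complex of paths is contractible. The
restriction `Obs.z` of `Φ` to the `n`-th face is a `2`-sphere in the loops on `Y^2`.

*The class of the obstruction.* The four cofaces of `Φ` are the faces of the boundary of a
tetrahedron of paths in `Y^3`. The tetrahedron can be filled, and its image in the loops is a
homotopy addition relation between the cofaces of `Obs.z`; this is the cocycle condition
`Obs.cocycle`. In the same way a prism over a triangle, cut into three tetrahedra, shows that the
class of `Obs.z` changes by a coboundary if `a` is replaced by a homotopic vertex and `y`, `Φ` by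
any other choices (`Obs.exists_coboundary`). Composition with the collapse map
`Δ[m] ⊗ Δ[s] ⟶ Δ[m + s]` gives a bijective homomorphism `kappa` from `π_{m+2} K` to
`π_2 (loops m K)` (`kappa_bijective`), under which the class of the sphere is the element of
`π_{m+2} K` represented by the corresponding map on `Δ[m] ⊗ Δ[2]` (`represents_two_iff`).

*Comparison with the tower.* A morphism of pointed cosimplicial spaces maps obstruction data to
obstruction data. If it is a levelwise weak equivalence, then the independence of the choices in
the target gives the independence up to a coboundary in the source
(`Obs.exists_coboundary_of_hom`). For `Z` the data defining the differential of the tower of total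
spaces are obstruction data for the horn of index `0` (`TowerD2.exists_obs`): a simplex of
`Tot_2 Z` consists of compatible maps in the cosimplicial degrees `0`, `1`, `2`. Conversely, if `Z`
is Reedy fibrant, then `y` and `Φ` can be chosen to be compatible with the codegeneracies, and
hence come from simplices of `Tot_1 Z` and `Tot_2 Z` (`exists_towerD2`). So the differential of the
tower is the class of the obstruction in `X_U` for the horn of index `0` (`isSpectralD2_iff`), and
this class depends only on the element of `Ȟ⁰` (`IsObsClass.unique`).

*The sign.* Gluing the paths relative to `Λ[m + 1, n + 1]` to a simplex of dimension `m + 2` turns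
them into paths relative to `Λ[m + 1, n]` with the same ends, and replaces the loops over the
vertices by their inverses (`Obs.exists_flip`). Repeating this `n` times leads to the horn of index
`0` and gives the exponent `(-1)^n` (`Obs.exists_obs_zero`).
-/

namespace CechDiff

open KanGroup

/-! ### Gluing maps on the boundary of a simplex -/

section boundary

variable {X : SSet.{w}}

theorem boundary_exists_of_mem {n : ℕ} {d : SimplexCategoryᵒᵖ} (x : (∂Δ[n + 1] : SSet.{w}).obj d) :
    ∃ (i : Fin (n + 2)) (y : (Δ[n] : SSet.{w}).obj d), (SSet.boundary.ι i).app d y = x := by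
  obtain ⟨x, hx⟩ := x
  simp only [SSet.boundary_eq_iSup, SSet.stdSimplex.face_singleton_compl, Subfunctor.iSup_obj,
    Set.mem_iUnion, SSet.Subcomplex.mem_ofSimplex_obj_iff, op_unop] at hx
  obtain ⟨i, ⟨y, rfl⟩⟩ := hx
  exact ⟨i, SSet.stdSimplex.objEquiv.symm y, rfl⟩

/-- Simplices of two faces of `∂Δ[n + 2]` which agree in `∂Δ[n + 2]` come from the intersection of
these faces. -/
theorem boundary_ι_app_eq {n : ℕ} {d : SimplexCategoryᵒᵖ} {i j : Fin (n + 3)} (hij : i < j)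
    {y y' : (Δ[n + 1] : SSet.{w}).obj d}
    (h : (SSet.stdSimplex.δ i).app d y = (SSet.stdSimplex.δ j).app d y') :
    ∃ z : (Δ[n] : SSet.{w}).obj d,
      (SSet.stdSimplex.δ (j.pred (Fin.ne_zero_of_lt hij))).app d z = y ∧
      (SSet.stdSimplex.δ (i.castPred (Fin.ne_last_of_lt hij))).app d z = y' := by
  obtain ⟨f, rfl⟩ := SSet.stdSimplex.objEquiv.symm.surjective y
  obtain ⟨g, rfl⟩ := SSet.stdSimplex.objEquiv.symm.surjective y'
  have h' : f ≫ SimplexCategory.δ i = g ≫ SimplexCategory.δ j :=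
    SSet.stdSimplex.objEquiv.symm.injective h
  obtain ⟨i, rfl⟩ := i.eq_castSucc_of_ne_last (Fin.ne_last_of_lt hij)
  obtain ⟨j, rfl⟩ := j.eq_succ_of_ne_zero (Fin.ne_zero_of_lt hij)
  have hf : ∀ x, f x ≠ j := by
    intro x hx
    have e := congrArg (fun q : d.unop ⟶ ⦋n + 2⦌ => q x) h'
    change (i.castSucc).succAbove (f x) = (j.succ).succAbove (g x) at e
    have e2 : (i.castSucc).succAbove j = j.succ := by
      rw [Fin.succAbove_of_le_castSucc i.castSucc j (by
      have := Fin.lt_def.1 hij; simp at this; rw [Fin.le_def]; simp; omega)]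
    rw [hx, e2] at e
    exact Fin.succAbove_ne _ _ e.symm
  obtain ⟨k, hk⟩ := SimplexCategory.eq_comp_δ_of_not_surjective' f j hf
  refine ⟨SSet.stdSimplex.objEquiv.symm k, ?_, ?_⟩
  · exact congrArg SSet.stdSimplex.objEquiv.symm hk.symm
  · refine congrArg SSet.stdSimplex.objEquiv.symm (?_ : k ≫ SimplexCategory.δ _ = g)
    rw [← cancel_mono (SimplexCategory.δ j.succ), ← h', hk]
    simp only [Category.assoc, Fin.castPred_castSucc]
    rw [SimplexCategory.δ_comp_δ (by
      have := Fin.lt_def.1 hij; simp at this; rw [Fin.le_def]; omega)]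

/-- Compatibility of a family of maps on the faces of `∂Δ[n + 1]`: the maps agree on the
intersections of any two faces. There is no condition for `n = 0`, where the two faces are
disjoint. -/
def BoundaryCompatible {n : ℕ} (f : Fin (n + 2) → (Δ[n] ⟶ X)) : Prop :=
  match n with
  | 0 => True
  | n + 1 => ∀ (i j : Fin (n + 2)), i ≤ j →
      SSet.stdSimplex.δ j ≫ f i.castSucc = SSet.stdSimplex.δ i ≫ f j.succ

/-- The maps of a compatible family take the same value at simplices which coincide in
`∂Δ[n + 1]`. -/
theorem BoundaryCompatible.app_eq {n : ℕ} {f : Fin (n + 2) → (Δ[n] ⟶ X)}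
    (hf : BoundaryCompatible f) {d : SimplexCategoryᵒᵖ} {i j : Fin (n + 2)}
    {y y' : (Δ[n] : SSet.{w}).obj d}
    (h : (SSet.stdSimplex.δ i).app d y = (SSet.stdSimplex.δ j).app d y') :
    (f i).app d y = (f j).app d y' := by
  wlog hij : i ≤ j generalizing i j y y'
  · exact (this h.symm (le_of_not_ge hij)).symm
  obtain rfl | hij := hij.eq_or_lt
  · congr 1
    have : Mono ((SSet.stdSimplex.{w}.δ i).app d) := inferInstance
    exact (mono_iff_injective _).1 this h
  · obtain _ | n := n
    · exfalso
      obtain ⟨f, rfl⟩ := SSet.stdSimplex.objEquiv.symm.surjective y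
      obtain ⟨g, rfl⟩ := SSet.stdSimplex.objEquiv.symm.surjective y'
      have h' : f ≫ SimplexCategory.δ i = g ≫ SimplexCategory.δ j :=
        SSet.stdSimplex.objEquiv.symm.injective h
      have e := congrArg (fun q : d.unop ⟶ ⦋1⦌ => q 0) h'
      change i.succAbove (f 0) = j.succAbove (g 0) at e
      have hi : i = 0 := by ext; have := Fin.lt_def.1 hij; simp; omega
      have hj : j = 1 := by ext; have := Fin.lt_def.1 hij; simp; omega
      subst hi hj
      have a : f 0 = 0 := Subsingleton.elim (α := Fin 1) _ _
      have b : g 0 = 0 := Subsingleton.elim (α := Fin 1) _ _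
      rw [a, b] at e
      exact absurd e (by decide)
    · obtain ⟨z, rfl, rfl⟩ := boundary_ι_app_eq hij h
      obtain ⟨i, rfl⟩ := i.eq_castSucc_of_ne_last (Fin.ne_last_of_lt hij)
      obtain ⟨j, rfl⟩ := j.eq_succ_of_ne_zero (Fin.ne_zero_of_lt hij)
      simp only [Fin.castPred_castSucc, Fin.pred_succ]
      exact congrArg (fun q : Δ[n] ⟶ X => q.app d z)
        (hf i j (by
      have := Fin.lt_def.1 hij; simp at this; rw [Fin.le_def]; omega))

/-- A compatible family of maps on the faces glues to a map on `∂Δ[n + 1]`. -/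
theorem BoundaryCompatible.exists_desc {n : ℕ} {f : Fin (n + 2) → (Δ[n] ⟶ X)}
    (hf : BoundaryCompatible f) :
    ∃ g : (∂Δ[n + 1] : SSet.{w}) ⟶ X, ∀ i, SSet.boundary.ι i ≫ g = f i := by
  choose i y hy using fun d => boundary_exists_of_mem (n := n) (d := d)
  have key : ∀ (d : SimplexCategoryᵒᵖ) (x : (∂Δ[n + 1] : SSet.{w}).obj d) (j : Fin (n + 2))
      (y' : (Δ[n] : SSet.{w}).obj d), (SSet.boundary.ι j).app d y' = x →
      (f (i d x)).app d (y d x) = (f j).app d y' := fun d x j y' h =>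
    hf.app_eq (congrArg Subtype.val ((hy d x).trans h.symm))
  refine ⟨{ app d := ↾fun x => (f (i d x)).app d (y d x), naturality d d' a := ?_ }, fun j => ?_⟩
  · ext x
    refine (key d' _ (i d x) ((Δ[n] : SSet.{w}).map a (y d x)) ?_).trans ?_
    · exact (NatTrans.naturality_apply (SSet.boundary.ι (i d x)) a (y d x)).trans
        (congrArg _ (hy d x))
    · exact NatTrans.naturality_apply (f (i d x)) a (y d x)
  · ext d x
    exact key d _ j x rfl

end boundary

/-! ### Gluing and extending maps on products -/

section gluing

variable {X T : SSet.{w}}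

/-- Maps out of `∂Δ[n + 1] ⊗ T` glued from compatible maps on the `Δ[n] ⊗ T`. -/
theorem exists_desc_tensor {n : ℕ} (f : Fin (n + 2) → ((Δ[n] : SSet.{w}) ⊗ T ⟶ X))
    (hf : BoundaryCompatible (fun i => MonoidalClosed.curry ((β_ T Δ[n]).hom ≫ f i))) :
    ∃ g : (∂Δ[n + 1] : SSet.{w}) ⊗ T ⟶ X, ∀ i, SSet.boundary.ι i ▷ T ≫ g = f i := by
  obtain ⟨g, hg⟩ := hf.exists_desc
  refine ⟨(β_ _ T).hom ≫ MonoidalClosed.uncurry g, fun i => ?_⟩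
  have : SSet.boundary.ι i ▷ T ≫ (β_ _ T).hom = (β_ _ T).hom ≫ T ◁ SSet.boundary.ι i :=
    BraidedCategory.braiding_naturality_left _ _
  rw [reassoc_of% this, ← MonoidalClosed.uncurry_natural_left, hg, MonoidalClosed.uncurry_curry,
    ← Category.assoc, SymmetricCategory.symmetry, Category.id_comp]

theorem boundary_tensor_hom_ext {n : ℕ} {f g : (∂Δ[n + 1] : SSet.{w}) ⊗ T ⟶ X}
    (h : ∀ i, SSet.boundary.ι i ▷ T ≫ f = SSet.boundary.ι i ▷ T ≫ g) : f = g := by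
  rw [← cancel_epi (β_ T _).hom]
  apply MonoidalClosed.curry_injective
  refine SSet.boundary.hom_ext fun i => ?_
  rw [← MonoidalClosed.curry_natural_left, ← MonoidalClosed.curry_natural_left]
  have : T ◁ SSet.boundary.ι i ≫ (β_ T _).hom = (β_ T _).hom ≫ SSet.boundary.ι i ▷ T :=
    BraidedCategory.braiding_naturality_right _ _
  rw [reassoc_of% this, reassoc_of% this, h]

theorem tensor_boundary_hom_ext {n : ℕ} {f g : T ⊗ (∂Δ[n + 1] : SSet.{w}) ⟶ X}
    (h : ∀ i, T ◁ SSet.boundary.ι i ≫ f = T ◁ SSet.boundary.ι i ≫ g) : f = g := by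
  apply MonoidalClosed.curry_injective
  refine SSet.boundary.hom_ext fun i => ?_
  rw [← MonoidalClosed.curry_natural_left, ← MonoidalClosed.curry_natural_left, h]

theorem tensor_horn_hom_ext {n : ℕ} {i : Fin (n + 2)} {f g : T ⊗ (Λ[n + 1, i] : SSet.{w}) ⟶ X}
    (h : ∀ j hj, T ◁ SSet.horn.ι i j hj ≫ f = T ◁ SSet.horn.ι i j hj ≫ g) : f = g := by
  apply MonoidalClosed.curry_injective
  refine SSet.horn.hom_ext' fun j hj => ?_
  rw [← MonoidalClosed.curry_natural_left, ← MonoidalClosed.curry_natural_left, h]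

theorem horn_tensor_hom_ext {n : ℕ} {i : Fin (n + 2)} {f g : (Λ[n + 1, i] : SSet.{w}) ⊗ T ⟶ X}
    (h : ∀ j hj, SSet.horn.ι i j hj ▷ T ≫ f = SSet.horn.ι i j hj ▷ T ≫ g) : f = g := by
  rw [← cancel_epi (β_ T _).hom]
  apply MonoidalClosed.curry_injective
  refine SSet.horn.hom_ext' fun j hj => ?_
  rw [← MonoidalClosed.curry_natural_left, ← MonoidalClosed.curry_natural_left]
  have : T ◁ SSet.horn.ι i j hj ≫ (β_ T _).hom = (β_ T _).hom ≫ SSet.horn.ι i j hj ▷ T :=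
    BraidedCategory.braiding_naturality_right _ _
  rw [reassoc_of% this, reassoc_of% this, h]

/-- Maps out of `T ⊗ ∂Δ[n + 1]` glued from maps on the `T ⊗ Δ[n]`. -/
theorem exists_tensor_desc {n : ℕ} (f : Fin (n + 2) → (T ⊗ (Δ[n] : SSet.{w}) ⟶ X))
    (hf : BoundaryCompatible (fun i => MonoidalClosed.curry (f i))) :
    ∃ g : T ⊗ (∂Δ[n + 1] : SSet.{w}) ⟶ X, ∀ i, T ◁ SSet.boundary.ι i ≫ g = f i := by
  obtain ⟨g, hg⟩ := hf.exists_desc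
  refine ⟨MonoidalClosed.uncurry g, fun i => ?_⟩
  rw [← MonoidalClosed.uncurry_natural_left, hg, MonoidalClosed.uncurry_curry]

/-- Maps out of `Λ[n + 1, i] ⊗ T` glued from maps on the `Δ[n] ⊗ T`. -/
theorem exists_horn_desc_tensor {n : ℕ} {i : Fin (n + 2)}
    (f : ∀ (j : Fin (n + 2)) (_ : j ≠ i), (Δ[n] : SSet.{w}) ⊗ T ⟶ X)
    (hf : SSet.horn.IsCompatible (i := i)
      (fun j hj => MonoidalClosed.curry ((β_ T Δ[n]).hom ≫ f j hj))) :
    ∃ g : (Λ[n + 1, i] : SSet.{w}) ⊗ T ⟶ X, ∀ j hj, SSet.horn.ι i j hj ▷ T ≫ g = f j hj := by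
  obtain ⟨g, hg⟩ := hf.exists_desc
  refine ⟨(β_ _ T).hom ≫ MonoidalClosed.uncurry g, fun j hj => ?_⟩
  have : SSet.horn.ι i j hj ▷ T ≫ (β_ _ T).hom = (β_ _ T).hom ≫ T ◁ SSet.horn.ι i j hj :=
    BraidedCategory.braiding_naturality_left _ _
  rw [reassoc_of% this, ← MonoidalClosed.uncurry_natural_left, hg, MonoidalClosed.uncurry_curry,
    ← Category.assoc, SymmetricCategory.symmetry, Category.id_comp]

theorem comp_curry_braiding {n : ℕ} {K : SSet.{w}} (a : K ⟶ Δ[n]) (f : (Δ[n] : SSet.{w}) ⊗ T ⟶ X) :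
    a ≫ MonoidalClosed.curry ((β_ T Δ[n]).hom ≫ f) =
      MonoidalClosed.curry ((β_ T K).hom ≫ a ▷ T ≫ f) := by
  rw [← MonoidalClosed.curry_natural_left]
  have : T ◁ a ≫ (β_ T _).hom = (β_ T _).hom ≫ a ▷ T :=
    BraidedCategory.braiding_naturality_right _ _
  rw [reassoc_of% this]

/-- Maps on `B ⊗ S` and `A ⊗ T` which agree on `A ⊗ S` extend to a lift on `B ⊗ T` along a Kan
fibration, when one of the inclusions `A ⊆ B` and `S ⊆ T` is anodyne. -/
theorem exists_lift_tensor {B T X Y : SSet.{w}} {A : B.Subcomplex} {S : T.Subcomplex}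
    (hAS : SSet.anodyneExtensions A.ι ∨ SSet.anodyneExtensions S.ι) (p : X ⟶ Y)
    (hp : SSet.modelCategoryQuillen.J.rlp p)
    (f : B ⊗ (S : SSet) ⟶ X) (g : (A : SSet) ⊗ T ⟶ X) (b : B ⊗ T ⟶ Y)
    (hfg : A.ι ▷ _ ≫ f = _ ◁ S.ι ≫ g) (hf : f ≫ p = B ◁ S.ι ≫ b) (hg : g ≫ p = A.ι ▷ T ≫ b) :
    ∃ h : B ⊗ T ⟶ X, B ◁ S.ι ≫ h = f ∧ A.ι ▷ T ≫ h = g ∧ h ≫ p = b := by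
  have hU : SSet.anodyneExtensions (A.unionProd S).ι := hAS.elim
    (SSet.anodyneExtensions_unionProd_ι' A S) (SSet.anodyneExtensions_unionProd_ι A S)
  have P := SSet.Subcomplex.unionProd.isPushout A S
  have : HasLiftingProperty (A.unionProd S).ι p := hU p hp
  have sq : CommSq (P.desc f g hfg) (A.unionProd S).ι p b := ⟨P.hom_ext
    (by rw [P.inl_desc_assoc, hf]; rfl) (by rw [P.inr_desc_assoc, hg]; rfl)⟩
  refine ⟨sq.lift, ?_, ?_, sq.fac_right⟩
  · rw [← SSet.Subcomplex.unionProd.ι₁_ι A S, Category.assoc, sq.fac_left, P.inl_desc]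
  · rw [← SSet.Subcomplex.unionProd.ι₂_ι A S, Category.assoc, sq.fac_left, P.inr_desc]

open SSet.modelCategoryQuillen in
/-- Maps on `B ⊗ S` and `A ⊗ T` to a Kan complex which agree on `A ⊗ S` extend to `B ⊗ T`, when one
of the inclusions `A ⊆ B` and `S ⊆ T` is anodyne. -/
theorem exists_extension_tensor {B T X : SSet.{w}} {A : B.Subcomplex} {S : T.Subcomplex}
    (hAS : SSet.anodyneExtensions A.ι ∨ SSet.anodyneExtensions S.ι) [SSet.KanComplex X]
    (f : B ⊗ (S : SSet) ⟶ X) (g : (A : SSet) ⊗ T ⟶ X) (hfg : A.ι ▷ _ ≫ f = _ ◁ S.ι ≫ g) :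
    ∃ h : B ⊗ T ⟶ X, B ◁ S.ι ≫ h = f ∧ A.ι ▷ T ≫ h = g := by
  obtain ⟨h, h1, h2, -⟩ := exists_lift_tensor hAS (terminal.from X)
    (by
      have := (HomotopicalAlgebra.isFibrant_iff X).1 inferInstance
      exact (SSet.modelCategoryQuillen.fibration_iff _).1 this)
    f g (terminal.from _) hfg (by subsingleton) (by subsingleton)
  exact ⟨h, h1, h2⟩

end gluing

/-! ### The complex of maps which are trivial on a subcomplex -/

section relHom

variable {B : SSet.{w}} (A : B.Subcomplex) (K : SSet.{w}) (k : K _⦋0⦌)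

/-- The complex of maps `B ⟶ K` which send the subcomplex `A` to the base point `k`: maps from `T`
to it are maps `B ⊗ T ⟶ K` which are constant on `A ⊗ T`. -/
noncomputable def relHomSub : ((ihom B).obj K).Subcomplex :=
  (SSet.Subcomplex.ofSimplex (X := (ihom (A : SSet)).obj K) (n := 0)
    (SSet.yonedaEquiv (MonoidalClosed.curry (SSet.const k)))).preimage ((MonoidalClosed.pre A.ι).app
      K)

/-- The simplicial set underlying `relHomSub`. -/
noncomputable abbrev relHom : SSet.{w} := relHomSub A K k

variable {T : SSet.{w}} {A K k}

theorem const_eq_const_comp {X : SSet.{w}} (x : X _⦋0⦌) : (SSet.const x : T ⟶ X) =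
    (SSet.const (SSet.stdSimplex.obj₀Equiv.symm 0) : T ⟶ Δ[0]) ≫ SSet.yonedaEquiv.symm x := by
  rw [SSet.const_comp]
  congr 1
  obtain ⟨g, rfl⟩ := SSet.yonedaEquiv.surjective x
  rw [Equiv.symm_apply_apply]
  exact congrArg (g.app _)
    (SSet.stdSimplex.obj₀Equiv.injective (Subsingleton.elim (α := Fin 1) _ _))

theorem const_yonedaEquiv_curry (x : (ihom (A : SSet)).obj K _⦋0⦌)
    (hx : x = SSet.yonedaEquiv (MonoidalClosed.curry (SSet.const k))) :
    (SSet.const x : T ⟶ _) = MonoidalClosed.curry (SSet.const k) := by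
  rw [const_eq_const_comp, hx, Equiv.symm_apply_apply, ← MonoidalClosed.curry_natural_left]
  simp

/-- The universal property of `relHomSub`. -/
theorem range_le_relHomSub_iff (g : T ⟶ (ihom B).obj K) :
    SSet.Subcomplex.range g ≤ relHomSub A K k ↔
      A.ι ▷ T ≫ MonoidalClosed.uncurry g = SSet.const k := by
  have e : g ≫ (MonoidalClosed.pre A.ι).app K =
      MonoidalClosed.curry (A.ι ▷ T ≫ MonoidalClosed.uncurry g) := by
    rw [MonoidalClosed.eq_curry_iff, MonoidalClosed.uncurry_natural_left,
      MonoidalClosed.uncurry_pre, MonoidalClosed.uncurry_eq, whisker_exchange_assoc]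
  rw [relHomSub]
  constructor
  · intro h
    have h' : SSet.Subcomplex.range (g ≫ (MonoidalClosed.pre A.ι).app K) ≤ SSet.Subcomplex.ofSimplex
        (X := (ihom (A : SSet)).obj K) (n := 0)
        (SSet.yonedaEquiv (MonoidalClosed.curry (SSet.const k))) := by
      rintro d _ ⟨x, rfl⟩
      exact h d ⟨x, rfl⟩
    have := SSet.Subcomplex.lift_ι (g ≫ (MonoidalClosed.pre A.ι).app K) h'
    rw [SSet.Subcomplex.ofSimplex_ι, SSet.comp_const, e, const_yonedaEquiv_curry _ rfl] at this
    exact (MonoidalClosed.curry_injective this).symm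
  · intro h
    rw [h, ← const_yonedaEquiv_curry _ rfl] at e
    rintro d _ ⟨x, rfl⟩
    have e' := congrArg (fun q : T ⟶ (ihom (A : SSet)).obj K => q.app d x) e
    have h' : (g ≫ (MonoidalClosed.pre A.ι).app K).app d x ∈ (SSet.Subcomplex.ofSimplex
        (X := (ihom (A : SSet)).obj K) (n := 0)
        (SSet.yonedaEquiv (MonoidalClosed.curry (SSet.const k)))).obj d := by
      refine Set.mem_of_eq_of_mem e' ?_
      exact (SSet.Subcomplex.ofSimplex (X := (ihom (A : SSet)).obj K) (n := 0) _).map _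
        (SSet.Subcomplex.mem_ofSimplex_obj _)
    exact h'

end relHom

namespace relHom

variable {B : SSet.{w}} {A : B.Subcomplex} {K : SSet.{w}} {k : K _⦋0⦌} {T T' : SSet.{w}}

/-- The map `T ⟶ relHom A K k` given by a map `B ⊗ T ⟶ K` which is constant on `A ⊗ T`. -/
noncomputable def mk (f : B ⊗ T ⟶ K) (hf : A.ι ▷ T ≫ f = SSet.const k) : T ⟶ relHom A K k :=
  SSet.Subcomplex.lift (MonoidalClosed.curry f)
    ((range_le_relHomSub_iff _).2 (by rwa [MonoidalClosed.uncurry_curry]))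

/-- The map `B ⊗ T ⟶ K` given by a map `T ⟶ relHom A K k`. -/
noncomputable def un (g : T ⟶ relHom A K k) : B ⊗ T ⟶ K :=
  MonoidalClosed.uncurry (g ≫ (relHomSub A K k).ι)

@[simp]
theorem un_mk (f : B ⊗ T ⟶ K) (hf : A.ι ▷ T ≫ f = SSet.const k) : un (mk f hf) = f :=
  MonoidalClosed.uncurry_curry f

theorem un_injective {g g' : T ⟶ relHom A K k} (h : un g = un g') : g = g' := by
  rw [← cancel_mono (relHomSub A K k).ι]
  exact MonoidalClosed.uncurry_injective h

theorem whiskerRight_un (g : T ⟶ relHom A K k) : A.ι ▷ T ≫ un g = SSet.const k := by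
  refine (range_le_relHomSub_iff _).1 ?_
  rintro d _ ⟨x, rfl⟩
  exact (g.app d x).2

theorem un_comp (u : T' ⟶ T) (g : T ⟶ relHom A K k) : un (u ≫ g) = B ◁ u ≫ un g := by
  rw [un, un, Category.assoc, MonoidalClosed.uncurry_natural_left]

variable (A K k) in
/-- The constant map, as base point of `relHom A K k`. -/
noncomputable def pt : relHom A K k _⦋0⦌ :=
  SSet.yonedaEquiv (mk (SSet.const k) (SSet.comp_const _ _))

@[simp]
theorem un_const : un (SSet.const (pt A K k) : T ⟶ relHom A K k) = SSet.const k := by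
  rw [const_eq_const_comp, pt, Equiv.symm_apply_apply, un_comp, un_mk, SSet.comp_const]

/-- The functoriality of `relHom A K k` in the pointed simplicial set `K`. -/
noncomputable def map (A : B.Subcomplex) {K' : SSet.{w}} {k' : K' _⦋0⦌} (φ : K ⟶ K')
    (h : φ.app _ k = k') : relHom A K k ⟶ relHom A K' k' :=
  mk (un (𝟙 _) ≫ φ) (by rw [← Category.assoc, whiskerRight_un, SSet.const_comp, h])

/-- The restriction of maps along a map of pairs `(B', A') ⟶ (B, A)`. -/
noncomputable def res {B' : SSet.{w}} (A' : B'.Subcomplex) (A : B.Subcomplex) (K : SSet.{w})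
    (k : K _⦋0⦌) (u : B' ⟶ B) (hu : A' ≤ A.preimage u) : relHom A K k ⟶ relHom A' K k :=
  mk (u ▷ _ ≫ un (𝟙 _)) (by
    have e : A'.ι ≫ u = SSet.Subcomplex.lift (A'.ι ≫ u) (by
        rintro d _ ⟨x, rfl⟩; exact hu _ x.2) ≫ A.ι := rfl
    rw [← comp_whiskerRight_assoc, e, comp_whiskerRight_assoc, whiskerRight_un, SSet.comp_const])

@[simp]
theorem un_comp_map {K' : SSet.{w}} {k' : K' _⦋0⦌} (φ : K ⟶ K')
    (h : φ.app _ k = k') (g : T ⟶ relHom A K k) : un (g ≫ map A φ h) = un g ≫ φ := by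
  rw [un_comp, map, un_mk, ← Category.assoc, ← un_comp, Category.comp_id]

@[simp]
theorem un_comp_res {B' : SSet.{w}} {A' : B'.Subcomplex} (u : B' ⟶ B) (hu : A' ≤ A.preimage u)
    (g : T ⟶ relHom A K k) : un (g ≫ res A' A K k u hu) = u ▷ T ≫ un g := by
  rw [un_comp, res, un_mk, whisker_exchange_assoc, ← un_comp, Category.comp_id]

theorem map_pt {K' : SSet.{w}} {k' : K' _⦋0⦌} (φ : K ⟶ K')
    (h : φ.app _ k = k') : (map A φ h).app _ (pt A K k) = pt A K' k' := by
  have : SSet.yonedaEquiv.symm (pt A K k) ≫ map A φ h = SSet.yonedaEquiv.symm (pt A K' k') := by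
    rw [pt, pt, Equiv.symm_apply_apply, Equiv.symm_apply_apply]
    exact un_injective (by simp [h])
  have e := congrArg SSet.yonedaEquiv this
  rwa [SSet.yonedaEquiv_comp, Equiv.apply_symm_apply, Equiv.apply_symm_apply] at e

/-- If `A ⊆ B` is anodyne then maps on a subcomplex of `T` extend to `T`; for arbitrary `A` this
holds for anodyne subcomplexes. -/
theorem exists_extension {S : T.Subcomplex} [SSet.KanComplex K]
    (hAS : SSet.anodyneExtensions A.ι ∨ SSet.anodyneExtensions S.ι)
    (f : (S : SSet) ⟶ relHom A K k) : ∃ g : T ⟶ relHom A K k, S.ι ≫ g = f := by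
  obtain ⟨h, h1, h2⟩ := exists_extension_tensor hAS (un f) (SSet.const k)
    (by rw [whiskerRight_un, SSet.comp_const])
  exact ⟨mk h h2, un_injective (by rw [un_comp, un_mk, h1])⟩

instance [SSet.KanComplex K] : SSet.KanComplex (relHom A K k) := by
  rw [SSet.KanComplex.iff]
  intro n i f hf
  obtain ⟨g, hg⟩ := exists_extension (.inr (SSet.anodyneExtensions.horn_ι i)) hf.desc
  refine ⟨g, fun j hj => ?_⟩
  rw [← hf.ι_desc j hj, ← hg]
  rfl

/-- Composition with a Kan fibration has the lifting property on complexes of relative maps. -/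
theorem hasLift {S : T.Subcomplex} {K' : SSet.{w}} {k' : K' _⦋0⦌} (φ : K ⟶ K')
    (h : φ.app _ k = k') (hφ : SSet.modelCategoryQuillen.J.rlp φ)
    (hAS : SSet.anodyneExtensions A.ι ∨ SSet.anodyneExtensions S.ι)
    (f : (S : SSet) ⟶ relHom A K k) (b : T ⟶ relHom A K' k') (hfb : f ≫ map A φ h = S.ι ≫ b) :
    ∃ g : T ⟶ relHom A K k, S.ι ≫ g = f ∧ g ≫ map A φ h = b := by
  obtain ⟨g, h1, h2, h3⟩ := exists_lift_tensor hAS φ hφ (un f) (SSet.const k) (un b)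
    (by rw [whiskerRight_un, SSet.comp_const]) (by rw [← un_comp, ← hfb, un_comp_map])
    (by rw [SSet.const_comp, h, whiskerRight_un])
  exact ⟨mk g h2, un_injective (by rw [un_comp, un_mk, h1]), un_injective (by simp [h3])⟩

end relHom

/-! ### Homotopies relative to the boundary -/

section ptSimplex

variable {X : SSet.{w}} {x : X _⦋0⦌} {n : ℕ}

/-- The base point of the subcomplex generated by `x` is `x`. This is the constant map in the
definition of `PtSimplex`. -/
theorem const_ofSimplex_ι {T : SSet.{w}} :
    (SSet.const (⟨x, SSet.Subcomplex.mem_ofSimplex_obj x⟩ :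
      (SSet.Subcomplex.ofSimplex x : SSet) _⦋0⦌) : T ⟶ _) ≫ (SSet.Subcomplex.ofSimplex x).ι =
      SSet.const x := rfl

/-- A simplex which is constant on the boundary, as a `PtSimplex`. -/
@[simps]
def ptMk (f : Δ[n] ⟶ X) (h : (∂Δ[n] : (Δ[n] : SSet.{w}).Subcomplex).ι ≫ f = SSet.const x) :
    X.PtSimplex n x where
  map := f
  comm := h.trans const_ofSimplex_ι.symm

theorem ptSimplex_comm (f : X.PtSimplex n x) :
    (∂Δ[n] : (Δ[n] : SSet.{w}).Subcomplex).ι ≫ f.map = SSet.const x :=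
  f.comm.trans const_ofSimplex_ι

/-- A simplex with constant faces, as a `PtSimplex`. -/
def ptMkδ (f : Δ[n + 1] ⟶ X) (h : ∀ i, SSet.stdSimplex.δ i ≫ f = SSet.const x) :
    X.PtSimplex (n + 1) x :=
  ptMk f (SSet.boundary.hom_ext fun i => by
    rw [SSet.boundary.ι_ι_assoc, h, SSet.comp_const])

theorem whiskerLeft_δ_one (T : SSet.{w}) :
    T ◁ SSet.stdSimplex.δ (1 : Fin 2) = CartesianMonoidalCategory.fst T Δ[0] ≫ SSet.ι₀ := by
  rw [SSet.stdSimplex.δ_one_eq_const]; rfl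

theorem whiskerLeft_δ_zero (T : SSet.{w}) :
    T ◁ SSet.stdSimplex.δ (0 : Fin 2) = CartesianMonoidalCategory.fst T Δ[0] ≫ SSet.ι₁ := by
  rw [SSet.stdSimplex.δ_zero_eq_const]; rfl

/-- A map `T ⟶ X` seen as a map on `T ⊗ Δ[0]`. -/
noncomputable abbrev tens0 {T : SSet.{w}} (f : T ⟶ X) : T ⊗ (Δ[0] : SSet.{w}) ⟶ X :=
  CartesianMonoidalCategory.fst T Δ[0] ≫ f

theorem tens0_injective {T : SSet.{w}} {f g : T ⟶ X} (h : tens0 f = tens0 g) : f = g := by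
  have := congrArg (CartesianMonoidalCategory.lift (𝟙 T) (SSet.const
    (SSet.stdSimplex.obj₀Equiv.symm 0) : T ⟶ Δ[0]) ≫ ·) h
  simpa using this

theorem exists_tens0 {T : SSet.{w}} (f : T ⊗ (Δ[0] : SSet.{w}) ⟶ X) : ∃ g : T ⟶ X, f = tens0 g := by
  refine ⟨CartesianMonoidalCategory.lift (𝟙 T) (SSet.const
    (SSet.stdSimplex.obj₀Equiv.symm 0) : T ⟶ Δ[0]) ≫ f, ?_⟩
  rw [tens0, ← Category.assoc]
  have : CartesianMonoidalCategory.fst T (Δ[0] : SSet.{w}) ≫ CartesianMonoidalCategory.lift (𝟙 T)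
      (SSet.const (SSet.stdSimplex.obj₀Equiv.symm 0) : T ⟶ Δ[0]) = 𝟙 _ := by
    apply CartesianMonoidalCategory.hom_ext
    · simp
    · exact SSet.stdSimplex.ext₀
  rw [this, Category.id_comp]

/-- A homotopy relative to the boundary, as a map which agrees with the two given simplices on the
two faces of `Δ[1]`. -/
@[simps]
noncomputable def homotopyMk {f g : X.PtSimplex n x} (h : (Δ[n] : SSet.{w}) ⊗ (Δ[1] : SSet.{w}) ⟶ X)
    (h1 : Δ[n] ◁ SSet.stdSimplex.δ (1 : Fin 2) ≫ h = tens0 f.map)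
    (h0 : Δ[n] ◁ SSet.stdSimplex.δ (0 : Fin 2) ≫ h = tens0 g.map)
    (hb : (∂Δ[n] : (Δ[n] : SSet.{w}).Subcomplex).ι ▷ Δ[1] ≫ h = SSet.const x) :
    SSet.RelativeMorphism.Homotopy f g where
  h := h
  h₀ := tens0_injective (by rw [← h1, whiskerLeft_δ_one, Category.assoc])
  h₁ := tens0_injective (by rw [← h0, whiskerLeft_δ_zero, Category.assoc])
  rel := hb.trans rfl

theorem homotopy_δ_one {f g : X.PtSimplex n x} (h : SSet.RelativeMorphism.Homotopy f g) :
    Δ[n] ◁ SSet.stdSimplex.δ (1 : Fin 2) ≫ h.h = tens0 f.map := by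
  rw [whiskerLeft_δ_one, Category.assoc, h.h₀]

theorem homotopy_δ_zero {f g : X.PtSimplex n x} (h : SSet.RelativeMorphism.Homotopy f g) :
    Δ[n] ◁ SSet.stdSimplex.δ (0 : Fin 2) ≫ h.h = tens0 g.map := by
  rw [whiskerLeft_δ_zero, Category.assoc, h.h₁]

theorem homotopy_rel {f g : X.PtSimplex n x} (h : SSet.RelativeMorphism.Homotopy f g) :
    (∂Δ[n] : (Δ[n] : SSet.{w}).Subcomplex).ι ▷ Δ[1] ≫ h.h = SSet.const x :=
  h.rel.trans rfl

/-- Maps which are trivial on the boundary are compatible. -/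
theorem boundaryCompatible_curry {n : ℕ} {T : SSet.{w}}
    {f : Fin (n + 2) → ((Δ[n] : SSet.{w}) ⊗ T ⟶ X)}
    (hf : ∀ i, (∂Δ[n] : (Δ[n] : SSet.{w}).Subcomplex).ι ▷ T ≫ f i = SSet.const x) :
    BoundaryCompatible (fun i => MonoidalClosed.curry ((β_ T Δ[n]).hom ≫ f i)) := by
  obtain _ | n := n
  · trivial
  · intro i j _
    simp only [comp_curry_braiding]
    have key (a) (b) : SSet.stdSimplex.δ a ▷ T ≫ f b = SSet.const x := by
      rw [← SSet.boundary.ι_ι, comp_whiskerRight_assoc, hf, SSet.comp_const]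
    rw [key, key]

/-- Simplices which are homotopic relative to the boundary define the same homotopy class. The
homotopy and the constant homotopy, on the last two faces of `Δ[n + 1]`, extend to a homotopy which
starts at a degenerate simplex; its end is the required simplex. -/
theorem relStruct_of_homotopy [SSet.KanComplex X] {f g : X.PtSimplex n x}
    (h : SSet.RelativeMorphism.Homotopy f g) :
    Nonempty (SSet.PtSimplex.RelStruct f g (Fin.last n)) := by
  let F : Fin (n + 2) → ((Δ[n] : SSet.{w}) ⊗ (Δ[1] : SSet.{w}) ⟶ X) := fun i =>
    if i = Fin.last (n + 1) then h.h
    else if i = (Fin.last n).castSucc then CartesianMonoidalCategory.fst _ _ ≫ f.map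
    else SSet.const x
  have hF : ∀ i, (∂Δ[n] : (Δ[n] : SSet.{w}).Subcomplex).ι ▷ Δ[1] ≫ F i = SSet.const x := by
    intro i
    dsimp only [F]
    split_ifs
    · exact homotopy_rel h
    · rw [CartesianMonoidalCategory.whiskerRight_fst_assoc, ptSimplex_comm, SSet.comp_const]
    · simp
  obtain ⟨G, hG⟩ := exists_desc_tensor F (boundaryCompatible_curry hF)
  have hne : (Fin.last n).castSucc ≠ Fin.last (n + 1) := (Fin.castSucc_lt_last _).ne
  let R := SSet.PtSimplex.RelStruct.refl f (Fin.last n)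
  have hR : ∀ i, SSet.stdSimplex.δ i ≫ R.map = if i = Fin.last (n + 1) then f.map
    else if i = (Fin.last n).castSucc then f.map else SSet.const x := by
    intro i
    split_ifs with h1 h2
    · subst h1; exact R.δ_succ_map
    · subst h2; exact R.δ_castSucc_map
    · refine R.δ_map_of_lt i ?_
      rw [Fin.lt_def]
      have h1' := Fin.val_ne_of_ne h1
      have h2' := Fin.val_ne_of_ne h2
      simp at h1' h2' ⊢
      omega
  obtain ⟨H, h1, h2⟩ := exists_extension_tensor (A := ∂Δ[n + 1]) (S := Λ[1, 0])
    (.inr (SSet.anodyneExtensions.horn_ι 0)) (CartesianMonoidalCategory.fst _ _ ≫ R.map) G (by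
      refine boundary_tensor_hom_ext fun i => tensor_horn_hom_ext fun j hj => ?_
      obtain rfl : j = 1 := by fin_cases j <;> simp_all
      rw [← whisker_exchange_assoc, hG, ← comp_whiskerRight_assoc, SSet.boundary.ι_ι,
        CartesianMonoidalCategory.whiskerRight_fst_assoc, hR,
        ← MonoidalCategory.whiskerLeft_comp_assoc, SSet.horn.ι_ι]
      dsimp only [F]
      split_ifs
      · rw [homotopy_δ_one]; simp
      · simp
      · simp)
  have hfin : ∀ i, SSet.stdSimplex.δ i ≫ SSet.ι₁ ≫ H = SSet.ι₁ ≫ F i := by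
    intro i
    rw [← SSet.ι₁_comp_assoc, ← SSet.boundary.ι_ι, comp_whiskerRight_assoc, h2, hG]
  refine ⟨⟨SSet.ι₁ ≫ H, ?_, ?_, fun j hj => ?_, fun j hj => ?_⟩⟩
  · rw [hfin]
    dsimp only [F]
    rw [if_neg hne, if_pos rfl]
    simp
  · rw [hfin]
    dsimp only [F]
    rw [Fin.succ_last, if_pos rfl]
    simp
  · rw [hfin]
    dsimp only [F]
    rw [if_neg (by intro h; subst h; exact absurd (Fin.lt_def.1 hj) (by simp)), if_neg hj.ne]
    simp
  · exact absurd (Fin.lt_def.1 hj) (by have := j.2; simp; omega)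

theorem pi.mk_eq_of_homotopy [SSet.KanComplex X] {f g : X.PtSimplex n x}
    (h : SSet.RelativeMorphism.Homotopy f g) : pi.mk f = pi.mk g :=
  Quot.sound (relStruct_of_homotopy h)

end ptSimplex

/-! ### Maps from prisms given on vertices -/

section order

/-- The map `Δ[m] ⊗ Δ[s] ⟶ Δ[N]` given by a monotone map on vertices. -/
def prodMap {m s N : ℕ} (f : Fin (m + 1) × Fin (s + 1) →o Fin (N + 1)) :
    (Δ[m] : SSet.{w}) ⊗ (Δ[s] : SSet.{w}) ⟶ Δ[N] where
  app p := ↾fun x => SSet.stdSimplex.objEquiv.symm (SimplexCategory.Hom.mk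
    (f.comp (OrderHom.prod (SSet.stdSimplex.asOrderHom x.1) (SSet.stdSimplex.asOrderHom x.2))))

theorem whiskerLeft_prodMap {m s s' N N' : ℕ} (f : Fin (m + 1) × Fin (s + 1) →o Fin (N + 1))
    (g : Fin (m + 1) × Fin (s' + 1) →o Fin (N' + 1)) (a : ⦋s'⦌ ⟶ ⦋s⦌) (b : ⦋N'⦌ ⟶ ⦋N⦌)
    (h : ∀ p q, f (p, a q) = b (g (p, q))) :
    Δ[m] ◁ SSet.stdSimplex.map a ≫ prodMap.{w} f = prodMap g ≫ SSet.stdSimplex.map b := by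
  ext d x
  refine congrArg SSet.stdSimplex.objEquiv.symm (SimplexCategory.Hom.ext _ _ (OrderHom.ext _ _ ?_))
  funext i
  exact h _ _

theorem whiskerRight_prodMap {m m' s N N' : ℕ} (f : Fin (m + 1) × Fin (s + 1) →o Fin (N + 1))
    (g : Fin (m' + 1) × Fin (s + 1) →o Fin (N' + 1)) (a : ⦋m'⦌ ⟶ ⦋m⦌) (b : ⦋N'⦌ ⟶ ⦋N⦌)
    (h : ∀ p q, f (a p, q) = b (g (p, q))) :
    SSet.stdSimplex.map a ▷ Δ[s] ≫ prodMap.{w} f = prodMap g ≫ SSet.stdSimplex.map b := by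
  ext d x
  refine congrArg SSet.stdSimplex.objEquiv.symm (SimplexCategory.Hom.ext _ _ (OrderHom.ext _ _ ?_))
  funext i
  exact h _ _

theorem whiskerLeft_prodMap_fst {m s s' N : ℕ} (f : Fin (m + 1) × Fin (s + 1) →o Fin (N + 1))
    (a : ⦋s'⦌ ⟶ ⦋s⦌) (b : ⦋m⦌ ⟶ ⦋N⦌) (h : ∀ p q, f (p, a q) = b p) :
    Δ[m] ◁ SSet.stdSimplex.map a ≫ prodMap.{w} f =
      CartesianMonoidalCategory.fst _ _ ≫ SSet.stdSimplex.map b := by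
  ext d x
  refine congrArg SSet.stdSimplex.objEquiv.symm (SimplexCategory.Hom.ext _ _ (OrderHom.ext _ _ ?_))
  funext i
  exact h _ _

theorem whiskerRight_prodMap_fst {m m' s N : ℕ} (f : Fin (m + 1) × Fin (s + 1) →o Fin (N + 1))
    (a : ⦋m'⦌ ⟶ ⦋m⦌) (b : ⦋m'⦌ ⟶ ⦋N⦌) (h : ∀ p q, f (a p, q) = b p) :
    SSet.stdSimplex.map a ▷ Δ[s] ≫ prodMap.{w} f =
      CartesianMonoidalCategory.fst _ _ ≫ SSet.stdSimplex.map b := by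
  ext d x
  refine congrArg SSet.stdSimplex.objEquiv.symm (SimplexCategory.Hom.ext _ _ (OrderHom.ext _ _ ?_))
  funext i
  exact h _ _

variable {X : SSet.{w}} {x : X _⦋0⦌} {n : ℕ}

/-- The map `Δ[n] ⊗ Δ[1] ⟶ Δ[n + 1]` which is the inclusion of the last face over `0` and the
inclusion of the last but one face over `1`. -/
def lastPrismFun (n : ℕ) : Fin (n + 1) × Fin (1 + 1) →o Fin (n + 1 + 1) where
  toFun p := if p.2 = 1 ∧ (p.1 : ℕ) = n then Fin.last _ else p.1.castSucc
  monotone' := by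
    rintro ⟨a, b⟩ ⟨c, d⟩ ⟨h, k⟩
    have h1 : (a : ℕ) ≤ c := h
    have h2 : (b : ℕ) ≤ d := k
    have h4 : b = 1 ↔ (b : ℕ) = 1 := Fin.ext_iff
    have h5 : d = 1 ↔ (d : ℕ) = 1 := Fin.ext_iff
    dsimp only
    split_ifs <;> rw [Fin.le_def] <;> simp <;> omega

theorem lastPrismFun_val (n : ℕ) (p : Fin (n + 1) × Fin (1 + 1)) :
    (lastPrismFun n p : ℕ) = if p.2 = 1 ∧ (p.1 : ℕ) = n then n + 1 else p.1 := by
  change ((if p.2 = 1 ∧ (p.1 : ℕ) = n then Fin.last _ else p.1.castSucc : Fin (n + 1 + 1)) : ℕ) = _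
  split_ifs <;> simp

theorem val_succAbove {n : ℕ} (i : Fin (n + 1)) (p : Fin n) :
    (i.succAbove p : ℕ) = if (p : ℕ) < i then (p : ℕ) else p + 1 := by
  simp only [Fin.succAbove, Fin.lt_def, Fin.val_castSucc]
  split_ifs <;> simp

/-- Simplices in the same homotopy class are homotopic relative to the boundary: a simplex of which
they are the last two faces is composed with a map from the prism. -/
theorem homotopy_of_isBd {f g : X.PtSimplex n x} (h : IsBd (seq [f, g])) :
    Nonempty (SSet.RelativeMorphism.Homotopy f g) := by
  obtain ⟨W, hW⟩ := h
  have hl : SSet.stdSimplex.δ (Fin.last (n + 1)) ≫ W = f.map := by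
    rw [hW]; simp [seq]
  have hl' : SSet.stdSimplex.δ (Fin.last n).castSucc ≫ W = g.map := by
    rw [hW]
    have : n + 1 - n = 1 := by omega
    simp [seq, this]
  have e1 : Δ[n] ◁ SSet.stdSimplex.δ (1 : Fin 2) ≫ prodMap (lastPrismFun n) =
      tens0 (SSet.stdSimplex.δ (Fin.last (n + 1))) := by
    refine whiskerLeft_prodMap_fst _ _ _ fun p q => ?_
    change lastPrismFun n (p, (1 : Fin 2).succAbove q) = (Fin.last (n + 1)).succAbove p
    rw [Fin.succAbove_last]
    have : (1 : Fin 2).succAbove q = 0 := by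
      rw [Subsingleton.elim (α := Fin 1) q 0]; rfl
    rw [this]
    simp [lastPrismFun]
  have e0 : Δ[n] ◁ SSet.stdSimplex.δ (0 : Fin 2) ≫ prodMap (lastPrismFun n) =
      tens0 (SSet.stdSimplex.δ (Fin.last n).castSucc) := by
    refine whiskerLeft_prodMap_fst _ _ _ fun p q => ?_
    change lastPrismFun n (p, (0 : Fin 2).succAbove q) = (Fin.last n).castSucc.succAbove p
    have : (0 : Fin 2).succAbove q = 1 := by
      rw [Subsingleton.elim (α := Fin 1) q 0]; rfl
    rw [this]
    have hy := p.2
    rcases Nat.lt_succ_iff_lt_or_eq.1 hy with h | h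
    · rw [Fin.succAbove_of_castSucc_lt _ _ (by rw [Fin.lt_def]; simpa using h)]
      have : ¬ (p : ℕ) = n := by omega
      simp [lastPrismFun, this]
    · rw [Fin.succAbove_of_le_castSucc _ _ (by rw [Fin.le_def]; simp [h])]
      ext
      simp [lastPrismFun, h]
  refine ⟨homotopyMk (prodMap (lastPrismFun n) ≫ W) ?_ ?_ ?_⟩
  · rw [reassoc_of% e1, hl]
  · rw [reassoc_of% e0, hl']
  · obtain _ | n := n
    · have : IsInitial ((∂Δ[0] : (Δ[0] : SSet.{w}).Subcomplex) : SSet) := by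
        rw [SSet.boundary_zero]; exact SSet.Subcomplex.isInitialBot
      rw [← cancel_epi (β_ _ _).hom]
      apply MonoidalClosed.curry_injective
      exact this.hom_ext _ _
    · refine boundary_tensor_hom_ext fun i => ?_
      rw [← comp_whiskerRight_assoc, SSet.boundary.ι_ι, SSet.comp_const]
      by_cases hi : i = Fin.last (n + 1)
      · subst hi
        have e : SSet.stdSimplex.δ (Fin.last (n + 1)) ▷ Δ[1] ≫ prodMap (lastPrismFun (n + 1)) =
            CartesianMonoidalCategory.fst _ _ ≫ SSet.stdSimplex.δ (Fin.last (n + 1)) ≫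
              SSet.stdSimplex.δ (Fin.last (n + 2)) := by
          refine (whiskerRight_prodMap_fst _ _ (SimplexCategory.δ (Fin.last (n + 1)) ≫
            SimplexCategory.δ (Fin.last (n + 2))) fun p q => by
          change lastPrismFun (n + 1) ((Fin.last (n + 1)).succAbove p, q) =
            (Fin.last (n + 2)).succAbove ((Fin.last (n + 1)).succAbove p)
          rw [Fin.succAbove_last, Fin.succAbove_last]
          have : (p : ℕ) < n + 1 := p.2
          have h : ¬ (p : ℕ) = n + 1 := by omega
          simp [lastPrismFun, h]).trans
            (congrArg _ (CategoryTheory.Functor.map_comp SSet.stdSimplex.{w} _ _))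
        rw [reassoc_of% e, hl, SSet.PtSimplex.δ_map, SSet.comp_const]
      · obtain ⟨j, rfl⟩ := i.eq_castSucc_of_ne_last hi
        have e : SSet.stdSimplex.δ j.castSucc ▷ Δ[1] ≫ prodMap (lastPrismFun (n + 1)) =
            prodMap (lastPrismFun n) ≫ SSet.stdSimplex.δ j.castSucc.castSucc := by
          refine whiskerRight_prodMap _ _ _ _ fun a b => ?_
          change lastPrismFun (n + 1) (j.castSucc.succAbove a, b) =
            j.castSucc.castSucc.succAbove (lastPrismFun n (a, b))
          ext
          have hj := j.2
          have ha := a.2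
          simp only [val_succAbove, lastPrismFun_val, Fin.val_castSucc]
          split_ifs <;> omega
        rw [reassoc_of% e, hW]
        have : ∃ q, n + 1 + 1 - (j : ℕ) = q + 2 := ⟨n - j, by have := j.2; omega⟩
        obtain ⟨q, hq⟩ := this
        simp [seq, hq]

end order

/-! ### Simplices with at most one nontrivial face -/

section single

variable {X : SSet.{w}} {x : X _⦋0⦌} {n : ℕ}

/-- The sequence of simplices with `f` in position `k` and constant simplices elsewhere. -/
def single (k : ℕ) (f : X.PtSimplex n x) : ℕ → X.PtSimplex n x := fun i => if i = k then f else cst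

/-- Whether a simplex bounds does not depend on the face at which it is placed. -/
theorem isBd_single_of_isBd_single [SSet.KanComplex X] {f : X.PtSimplex (n + 1) x} {p q : ℕ}
    (hp : p ≤ n + 2) (h : IsBd (single p f)) : IsBd (single q f) := by
  -- the only nontrivial entry of the table is the common face of the faces `i` and `j + 1`
  let F (i j : ℕ) (a b : ℕ) : X.PtSimplex (n + 1) x := if a = i ∧ b = j + 1 then f else cst
  have r1 (i j : ℕ) (hij : i ≤ j) : row (F i j) i = single j f := by
    funext l
    simp only [row, F, single]
    split_ifs <;> first | rfl | (simp_all; try omega)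
  have r2 (i j : ℕ) (hij : i ≤ j) : row (F i j) (j + 1) = single i f := by
    funext l
    simp only [row, F, single]
    split_ifs <;> first | rfl | (simp_all; try omega)
  have r3 (i j : ℕ) (l : ℕ) (h1 : l ≠ i) (h2 : l ≠ j + 1) : row (F i j) l = seq [] := by
    funext l
    simp only [row, F, seq]
    split_ifs <;> first | rfl | (simp_all; try omega)
  rcases le_total p q with hpq | hpq
  · rw [← r1 p q hpq]
    refine isBd_row _ _ (by omega) fun l hl => ?_
    by_cases hl' : l = q + 1
    · rw [hl', r2 p q hpq]; exact h
    · rw [r3 _ _ _ hl hl']; exact isBd_one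
  · rw [← r2 q p hpq]
    refine isBd_row _ _ (by omega) fun l hl => ?_
    by_cases hl' : l = q
    · rw [hl', r1 q p hpq]; exact h
    · rw [r3 _ _ _ hl' hl]; exact isBd_one

theorem isBd_single_zero {f : X.PtSimplex n x} : IsBd (single 0 f) ↔ IsBd (seq [f, cst]) := by
  have : single 0 f = seq [f, cst] := by
    funext i; rcases i with _ | _ | i <;> rfl
  rw [this]

end single

/-! ### Simplices with at most four nontrivial faces -/

section four

variable {X : SSet.{w}} [SSet.KanComplex X] {x : X _⦋0⦌} {n : ℕ}
  {a b c d u p q s t t' : X.PtSimplex (n + 2) x}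

/-- A relation `s * q = t`, moved up by one face. -/
theorem isBd_one_mul (h : IsBd (seq [s, t, q])) : IsBd (seq [cst, q, t, s]) :=
  comm_aux5 (comm_aux1 (pad3.2 h) (diag4'' t))

/-- The homotopy addition theorem for a simplex with four possibly nontrivial faces. -/
theorem mk_mul_of_isBd (h : IsBd (seq [a, b, c, d])) :
    pi.mk a * pi.mk c = pi.mk b * pi.mk d := by
  obtain ⟨t, ht⟩ := exists_mul b d
  have h1 := comm_aux2 h (isBd_one_mul (isBd_comm ht))
  rw [pi.mk_mul_mk.2 (pad3.1 h1), pi.mk_mul_mk.2 ht]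

end four

/-! ### Loops and paths -/

section loop

/-- The `m`-fold loop complex of a pointed simplicial set: the maps `Δ[m] ⟶ K` which are trivial on
the boundary. -/
noncomputable abbrev loops (m : ℕ) (K : SSet.{w}) (k : K _⦋0⦌) : SSet.{w} :=
  relHom (∂Δ[m] : (Δ[m] : SSet.{w}).Subcomplex) K k

/-- The complex of maps `Δ[m + 1] ⟶ K` which are trivial on the `n`-th horn, an analogue of the path
complex of `loops m K k`. -/
noncomputable abbrev paths {m : ℕ} (n : Fin (m + 2)) (K : SSet.{w}) (k : K _⦋0⦌) : SSet.{w} :=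
  relHom (Λ[m + 1, n] : (Δ[m + 1] : SSet.{w}).Subcomplex) K k

variable {m : ℕ} (n : Fin (m + 2)) (K : SSet.{w}) (k : K _⦋0⦌)

theorem boundary_le_preimage_horn :
    (∂Δ[m] : (Δ[m] : SSet.{w}).Subcomplex) ≤ Λ[m + 1, n].preimage (SSet.stdSimplex.δ n) := by
  intro d x hx
  obtain ⟨f, rfl⟩ := SSet.stdSimplex.objEquiv.symm.surjective x
  intro h
  apply hx
  intro v
  have h' := Set.eq_univ_iff_forall.1 h (n.succAbove v)
  rcases h' with ⟨i, hi⟩ | h'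
  · exact ⟨i, Fin.succAbove_right_injective hi⟩
  · exact absurd h' (Fin.succAbove_ne _ _)

theorem horn_le_boundary :
    (Λ[m + 1, n] : (Δ[m + 1] : SSet.{w}).Subcomplex) ≤ ∂Δ[m + 1] := by
  rw [SSet.horn_eq_iSup, iSup_le_iff]
  exact fun j => SSet.face_singleton_compl_le_boundary j.1

/-- The restriction to the `n`-th face. -/
noncomputable def face : paths n K k ⟶ loops m K k :=
  relHom.res _ _ K k (SSet.stdSimplex.δ n) (boundary_le_preimage_horn n)

/-- The inclusion of the maps which are trivial on the whole boundary. -/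
noncomputable def incl : loops (m + 1) K k ⟶ paths n K k :=
  relHom.res _ _ K k (𝟙 _) (horn_le_boundary n)

variable {n K k} {T : SSet.{w}}

@[simp]
theorem un_comp_face (g : T ⟶ paths n K k) :
    relHom.un (g ≫ face n K k) = SSet.stdSimplex.δ n ▷ T ≫ relHom.un g :=
  relHom.un_comp_res _ _ _

@[simp]
theorem un_comp_incl (g : T ⟶ loops (m + 1) K k) :
    relHom.un (g ≫ incl n K k) = relHom.un g :=
  (relHom.un_comp_res _ _ _).trans (by simp)

theorem const_face : (SSet.const (relHom.pt _ K k) : T ⟶ paths n K k) ≫ face n K k =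
    SSet.const (relHom.pt _ K k) :=
      relHom.un_injective (by rw [un_comp_face]; simp only [relHom.un_const, SSet.comp_const])

theorem const_incl : (SSet.const (relHom.pt _ K k) : T ⟶ loops (m + 1) K k) ≫ incl n K k =
    SSet.const (relHom.pt _ K k) :=
      relHom.un_injective (by rw [un_comp_incl]; simp only [relHom.un_const])

theorem incl_injective {g g' : T ⟶ loops (m + 1) K k} (h : g ≫ incl n K k = g' ≫ incl n K k) :
    g = g' := by
  have := congrArg relHom.un h
  rw [un_comp_incl, un_comp_incl] at this
  exact relHom.un_injective this

theorem δ_whiskerRight_un (g : T ⟶ loops (m + 1) K k) (i : Fin (m + 2)) :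
    SSet.stdSimplex.δ i ▷ T ≫ relHom.un g = SSet.const k := by
  rw [← SSet.boundary.ι_ι, comp_whiskerRight_assoc, relHom.whiskerRight_un, SSet.comp_const]

theorem δ_whiskerRight_un_horn (g : T ⟶ paths n K k) (i : Fin (m + 2)) (hi : i ≠ n) :
    SSet.stdSimplex.δ i ▷ T ≫ relHom.un g = SSet.const k := by
  rw [← SSet.horn.ι_ι n i hi, comp_whiskerRight_assoc, relHom.whiskerRight_un, SSet.comp_const]

theorem incl_face (g : T ⟶ loops (m + 1) K k) : g ≫ incl n K k ≫ face n K k =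
    SSet.const (relHom.pt _ K k) :=
  relHom.un_injective (by
    rw [← Category.assoc, un_comp_face, un_comp_incl, δ_whiskerRight_un, relHom.un_const])

/-- A path whose restriction to the `n`-th face is trivial is a loop. -/
theorem exists_comp_incl (g : T ⟶ paths n K k)
    (h : g ≫ face n K k = SSet.const (relHom.pt _ K k)) : ∃ g', g' ≫ incl n K k = g := by
  refine ⟨relHom.mk (relHom.un g) (boundary_tensor_hom_ext fun i => ?_), relHom.un_injective ?_⟩
  · rw [← comp_whiskerRight_assoc, SSet.boundary.ι_ι, SSet.comp_const]
    by_cases hi : i = n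
    · subst hi
      have := congrArg relHom.un h
      rwa [un_comp_face, relHom.un_const] at this
    · exact δ_whiskerRight_un_horn g i hi
  · rw [un_comp_incl, relHom.un_mk]

/-- The restriction to the `n`-th face is a Kan fibration. -/
theorem exists_lift_face [SSet.KanComplex K] {S : T.Subcomplex} (hS : SSet.anodyneExtensions S.ι)
    (f : (S : SSet) ⟶ paths n K k) (b : T ⟶ loops m K k) (h : f ≫ face n K k = S.ι ≫ b) :
    ∃ g : T ⟶ paths n K k, S.ι ≫ g = f ∧ g ≫ face n K k = b := by
  let F : Fin (m + 2) → ((Δ[m] : SSet.{w}) ⊗ T ⟶ K) := fun i =>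
    if i = n then relHom.un b else SSet.const k
  have hF : ∀ i, (∂Δ[m] : (Δ[m] : SSet.{w}).Subcomplex).ι ▷ T ≫ F i = SSet.const k := by
    intro i
    dsimp only [F]
    split_ifs
    · exact relHom.whiskerRight_un b
    · simp
  obtain ⟨G, hG⟩ := exists_desc_tensor F (boundaryCompatible_curry hF)
  have hun := congrArg relHom.un h
  rw [un_comp_face, relHom.un_comp] at hun
  obtain ⟨H, h1, h2⟩ := exists_extension_tensor (.inr hS) (relHom.un f) G (by
    refine boundary_tensor_hom_ext fun i => ?_
    rw [← comp_whiskerRight_assoc, SSet.boundary.ι_ι, ← whisker_exchange_assoc, hG]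
    dsimp only [F]
    split_ifs with hi
    · subst hi; exact hun
    · rw [δ_whiskerRight_un_horn f i hi, SSet.comp_const])
  have h3 : ∀ i, SSet.stdSimplex.δ i ▷ T ≫ H = F i := fun i => by
    rw [← hG, ← h2, ← comp_whiskerRight_assoc, SSet.boundary.ι_ι]
  refine ⟨relHom.mk H (horn_tensor_hom_ext fun j hj => ?_), relHom.un_injective ?_,
    relHom.un_injective ?_⟩
  · rw [← comp_whiskerRight_assoc, SSet.horn.ι_ι, SSet.comp_const, h3]
    exact if_neg hj
  · rw [relHom.un_comp, relHom.un_mk, h1]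
  · rw [un_comp_face, relHom.un_mk, h3]
    exact if_pos rfl

/-- The complex of paths is contractible. -/
theorem exists_paths [SSet.KanComplex K] {s : ℕ} (f : Fin (s + 2) → (Δ[s] ⟶ paths n K k))
    (hf : BoundaryCompatible f) : ∃ g : Δ[s + 1] ⟶ paths n K k, ∀ i, SSet.stdSimplex.δ i ≫ g =
      f i := by
  obtain ⟨h, hh⟩ := hf.exists_desc
  obtain ⟨g, hg⟩ := relHom.exists_extension (.inl (SSet.anodyneExtensions.horn_ι n)) h
  exact ⟨g, fun i => by rw [← hh, ← hg, SSet.boundary.ι_ι_assoc]⟩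

end loop

/-! ### The connecting map of the path fibration -/

section connecting

variable {m : ℕ} {n : Fin (m + 2)} {K : SSet.{w}} {k : K _⦋0⦌} [SSet.KanComplex K] {s : ℕ}

/-- Injectivity of the connecting map from the homotopy of `loops (m + 1) K k` to that of `loops m K
k`. The class of `ρ` is sent to that of `g` when some simplex `H` of paths has `ρ` as its only
nontrivial face and restricts to `g`. -/
theorem isBd_of_isBd_face {ρ : (loops (m + 1) K k).PtSimplex s (relHom.pt _ K k)}
    (H : Δ[s + 1] ⟶ paths n K k) (h1 : SSet.stdSimplex.δ 1 ≫ H = ρ.map ≫ incl n K k)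
    (h : ∀ j, j ≠ 1 → SSet.stdSimplex.δ j ≫ H = SSet.const (relHom.pt _ K k))
    {g : (loops m K k).PtSimplex (s + 1) (relHom.pt _ K k)} (hg : g.map = H ≫ face n K k)
    (hg0 : IsBd (single 0 g)) : IsBd (single (s + 1) ρ) := by
  -- `W` has `g` as its only nontrivial face; the face of index `2` of a lift of `W` to paths which
  -- has `H` as its face of index `0` is a simplex of loops with `ρ` as its only nontrivial face
  have v2 : ((2 : Fin (s + 3)) : ℕ) = 2 := Fin.val_two
  obtain ⟨W, hW⟩ := isBd_single_of_isBd_single (p := 0) (q := s + 2) (by omega) hg0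
  have hW0 : SSet.stdSimplex.δ 0 ≫ W = g.map := by rw [hW]; simp [single]
  have hWj : ∀ j : Fin (s + 3), j ≠ 0 → SSet.stdSimplex.δ j ≫ W = SSet.const (relHom.pt _ K k) := by
    intro j hj
    have : (j : ℕ) ≠ 0 := fun h => hj (Fin.ext h)
    rw [hW]
    simp only [single]
    rw [if_neg (by omega)]
    rfl
  have hc : SSet.horn.IsCompatible (i := (2 : Fin (s + 3))) (fun (j : Fin (s + 3)) _ =>
      if j = 0 then H else SSet.const (relHom.pt _ K k)) := by
    rw [SSet.horn.isCompatible_iff]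
    intro a b ha hb hab
    have hb0 : b ≠ 0 := Fin.ne_zero_of_lt hab
    rw [if_neg hb0, SSet.comp_const]
    split_ifs with ha0
    · refine h _ fun e => hb ?_
      have := congrArg Fin.succ e
      rw [Fin.succ_pred] at this
      exact this
    · simp
  obtain ⟨V, hV, hVq⟩ := exists_lift_face (SSet.anodyneExtensions.horn_ι (2 : Fin (s + 3))) hc.desc
    W (by
    refine SSet.horn.hom_ext' fun j hj => ?_
    rw [hc.ι_desc_assoc, SSet.horn.ι_ι_assoc]
    split_ifs with hj0
    · subst hj0; rw [hW0, hg]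
    · rw [hWj j hj0, const_face])
  have hVj : ∀ j : Fin (s + 3), j ≠ 2 → SSet.stdSimplex.δ j ≫ V =
      if j = 0 then H else SSet.const (relHom.pt _ K k) := by
    intro j hj
    rw [← SSet.horn.ι_ι_assoc _ j hj, hV, hc.ι_desc]
  obtain ⟨R, hR⟩ := exists_comp_incl (SSet.stdSimplex.δ 2 ≫ V) (by
    rw [Category.assoc, hVq, hWj _ (by rw [ne_eq, Fin.ext_iff, v2]; simp)])
  refine ⟨R, fun j => incl_injective (n := n) ?_⟩
  rw [Category.assoc, hR]
  by_cases hj : j = 0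
  · subst hj
    have e : SSet.stdSimplex.{w}.δ (0 : Fin (s + 2)) ≫ SSet.stdSimplex.δ (2 : Fin (s + 3)) =
        SSet.stdSimplex.δ (1 : Fin (s + 2)) ≫ SSet.stdSimplex.δ (0 : Fin (s + 3)) :=
      SSet.stdSimplex.δ_comp_δ (i := (0 : Fin (s + 2))) (j := 1) (Fin.zero_le _)
    rw [reassoc_of% e, hVj 0 (by rw [ne_eq, Fin.ext_iff, v2]; simp), if_pos rfl, h1]
    simp [single]
  · have : (j : ℕ) ≠ 0 := fun h => hj (Fin.ext h)
    have e : ∃ j' i' : _, i' ≠ 2 ∧ i' ≠ 0 ∧ SSet.stdSimplex.{w}.δ j ≫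
      SSet.stdSimplex.δ (2 : Fin (s + 3)) =
        SSet.stdSimplex.δ j' ≫ SSet.stdSimplex.δ i' := by
      by_cases hj1 : (j : ℕ) = 1
      · obtain rfl : j = 1 := Fin.ext hj1
        exact ⟨1, 1, by rw [ne_eq, Fin.ext_iff, v2]; simp, by rw [ne_eq, Fin.ext_iff]; simp,
          SSet.stdSimplex.δ_comp_δ (i := (1 : Fin (s + 2))) (j := 1) le_rfl⟩
      · have hjs := j.2
        obtain ⟨s, rfl⟩ : ∃ s', s = s' + 1 := ⟨s - 1, by omega⟩
        refine ⟨2, j.succ, ?_, Fin.succ_ne_zero _, ?_⟩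
        · intro e
          have := congrArg Fin.val e
          rw [v2, Fin.val_succ] at this
          omega
        · exact (SSet.stdSimplex.δ_comp_δ (i := (2 : Fin (s + 3))) (j := j) (by
            rw [Fin.le_def, Fin.val_two]; omega)).symm
    obtain ⟨j', i', hi', hi0, e⟩ := e
    rw [reassoc_of% e, hVj i' hi', if_neg hi0, SSet.comp_const]
    simp only [single]
    rw [if_neg (by omega)]
    exact const_incl.symm

/-- Surjectivity of the connecting map: every `g` is the restriction of a simplex of paths whose
only nontrivial face is a simplex of loops. -/
theorem exists_lift_ptSimplex (g : (loops m K k).PtSimplex (s + 1) (relHom.pt _ K k)) :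
    ∃ (H : Δ[s + 1] ⟶ paths n K k) (ρ : (loops (m + 1) K k).PtSimplex s (relHom.pt _ K k)),
      SSet.stdSimplex.δ 1 ≫ H = ρ.map ≫ incl n K k ∧
      (∀ j, j ≠ 1 → SSet.stdSimplex.δ j ≫ H = SSet.const (relHom.pt _ K k)) ∧
      g.map = H ≫ face n K k := by
  obtain ⟨H, hH, hg⟩ := exists_lift_face (n := n) (SSet.anodyneExtensions.horn_ι (1 : Fin (s + 2)))
    (SSet.const (relHom.pt _ K k)) g.map (by
      refine SSet.horn.hom_ext' fun j hj => ?_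
      rw [const_face, SSet.comp_const, SSet.horn.ι_ι_assoc, g.δ_map])
  have hj : ∀ j, j ≠ 1 → SSet.stdSimplex.δ j ≫ H = SSet.const (relHom.pt _ K k) := by
    intro j hj
    rw [← SSet.horn.ι_ι_assoc _ j hj, hH, SSet.comp_const]
  obtain ⟨ρ, hρ⟩ := exists_comp_incl (SSet.stdSimplex.δ 1 ≫ H) (by
    rw [Category.assoc, hg, g.δ_map])
  refine ⟨H, ptMk ρ ?_, hρ.symm, hj, hg.symm⟩
  obtain _ | s := s
  · exact SSet.boundary.hom_ext₀
  · refine SSet.boundary.hom_ext fun i => incl_injective (n := n) ?_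
    rw [SSet.boundary.ι_ι_assoc, SSet.comp_const, const_incl, Category.assoc, hρ]
    by_cases hi : i = 0
    · subst hi
      have e : SSet.stdSimplex.{w}.δ (0 : Fin (s + 2)) ≫ SSet.stdSimplex.δ (1 : Fin (s + 3)) =
          SSet.stdSimplex.δ (0 : Fin (s + 2)) ≫ SSet.stdSimplex.δ (0 : Fin (s + 3)) :=
        (SSet.stdSimplex.δ_comp_δ (i := (0 : Fin (s + 2))) (j := 0) le_rfl)
      rw [reassoc_of% e, hj 0 (by rw [ne_eq, Fin.ext_iff]; simp), SSet.comp_const]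
    · have e : SSet.stdSimplex.{w}.δ i ≫ SSet.stdSimplex.δ (1 : Fin (s + 3)) =
          SSet.stdSimplex.δ (1 : Fin (s + 2)) ≫ SSet.stdSimplex.δ i.succ :=
        (SSet.stdSimplex.δ_comp_δ (i := (1 : Fin (s + 2))) (j := i) (by
          have : (i : ℕ) ≠ 0 := fun h => hi (Fin.ext h)
          rw [Fin.le_def]; simp; omega)).symm
      rw [reassoc_of% e, hj _ (by
        rw [ne_eq, ← Fin.succ_zero_eq_one, Fin.succ_inj]; exact hi), SSet.comp_const]

end connecting

/-! ### Composition with the collapse map -/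

section collapse

variable {K : SSet.{w}} {k : K _⦋0⦌} {m s N : ℕ}

/-- The map `W : Δ[N] ⟶ K` is trivial on the face opposite to the vertex `j`. -/
def TrivialAt (k : K _⦋0⦌) (W : Δ[N] ⟶ K) (j : Fin (N + 1)) : Prop :=
  ∀ (d : SimplexCategoryᵒᵖ) (x : (Δ[N] : SSet.{w}).obj d),
    (∀ i, SSet.stdSimplex.asOrderHom x i ≠ j) → W.app d x = (SSet.const k : Δ[N] ⟶ K).app d x

theorem trivialAt_ptSimplex (g : K.PtSimplex N k) (j : Fin (N + 1)) : TrivialAt k g.map j := by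
  intro d x hx
  have h : x ∈ (∂Δ[N] : (Δ[N] : SSet.{w}).Subcomplex).obj d := by
    intro hs
    obtain ⟨i, hi⟩ := hs j
    exact hx i hi
  exact congrArg (fun q : (∂Δ[N] : SSet.{w}) ⟶ K => q.app d ⟨x, h⟩) (ptSimplex_comm g)

theorem trivialAt_of_δ {W : Δ[N + 1] ⟶ K} {j : Fin (N + 2)}
    (h : SSet.stdSimplex.δ j ≫ W = SSet.const k) : TrivialAt k W j := by
  intro d x hx
  obtain ⟨f, rfl⟩ := SSet.stdSimplex.objEquiv.symm.surjective x
  obtain ⟨g, hg⟩ := SimplexCategory.eq_comp_δ_of_not_surjective' f j hx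
  rw [hg]
  exact congrArg (fun q : (Δ[N] : SSet.{w}) ⟶ K => q.app d (SSet.stdSimplex.objEquiv.symm g)) h

theorem prodMap_comp_eq_const {f : Fin (m + 1) × Fin (s + 1) →o Fin (N + 1)} {W : Δ[N] ⟶ K}
    {j : Fin (N + 1)} (hj : TrivialAt k W j) (h : ∀ p q, f (p, q) ≠ j) :
    prodMap f ≫ W = SSet.const k := by
  ext d x
  exact hj d _ fun i => h _ _

/-- A map on `Δ[m] ⊗ Δ[s]` given on vertices is trivial on `∂Δ[m] ⊗ Δ[s]` if the image of each face
of `Δ[m]` misses a vertex whose opposite face is trivial. -/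
theorem boundary_whiskerRight_prodMap {f : Fin (m + 1) × Fin (s + 1) →o Fin (N + 1)} {W : Δ[N] ⟶ K}
    (h : ∀ v, ∃ j, TrivialAt k W j ∧ ∀ p q, p ≠ v → f (p, q) ≠ j) :
    (∂Δ[m] : (Δ[m] : SSet.{w}).Subcomplex).ι ▷ Δ[s] ≫ prodMap f ≫ W = SSet.const k := by
  ext d ⟨⟨x, hx⟩, y⟩
  obtain ⟨v, hv⟩ := not_forall.1 hx
  obtain ⟨j, hj, hf⟩ := h v
  exact hj d _ fun i => hf _ _ fun e => hv ⟨i, e⟩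

theorem boundary_whiskerLeft_prodMap {f : Fin (m + 1) × Fin (s + 1) →o Fin (N + 1)} {W : Δ[N] ⟶ K}
    (h : ∀ v, ∃ j, TrivialAt k W j ∧ ∀ p q, q ≠ v → f (p, q) ≠ j) :
    Δ[m] ◁ (∂Δ[s] : (Δ[s] : SSet.{w}).Subcomplex).ι ≫ prodMap f ≫ W = SSet.const k := by
  ext d ⟨y, ⟨x, hx⟩⟩
  obtain ⟨v, hv⟩ := not_forall.1 hx
  obtain ⟨j, hj, hf⟩ := h v
  exact hj d _ fun i => hf _ _ fun e => hv ⟨i, e⟩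

/-- The map on vertices of `collapse`, for `N = m + s`. -/
def colFun (m s : ℕ) {N : ℕ} (h : N = m + s) : Fin (m + 1) × Fin (s + 1) →o Fin (N + 1) where
  toFun p := ⟨if (p.2 : ℕ) = 0 then p.1 else m + p.2, by split_ifs <;> omega⟩
  monotone' := by
    rintro ⟨a, b⟩ ⟨c, d⟩ ⟨h, k⟩
    have h1 : (a : ℕ) ≤ c := h
    have h2 : (b : ℕ) ≤ d := k
    have h3 := a.2
    rw [Fin.mk_le_mk]
    dsimp only
    split_ifs <;> omega

theorem colFun_val (h : N = m + s) (p : Fin (m + 1)) (q : Fin (s + 1)) :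
    (colFun m s h (p, q) : ℕ) = if (q : ℕ) = 0 then (p : ℕ) else m + q := rfl

/-- A map `Δ[m] ⊗ Δ[s] ⟶ K` which is trivial on the boundary, as a simplex of `loops m K k`. -/
noncomputable def curryPt (ρ : (Δ[m] : SSet.{w}) ⊗ (Δ[s] : SSet.{w}) ⟶ K)
    (h : (∂Δ[m] : (Δ[m] : SSet.{w}).Subcomplex).ι ▷ Δ[s] ≫ ρ = SSet.const k)
    (h' : Δ[m] ◁ (∂Δ[s] : (Δ[s] : SSet.{w}).Subcomplex).ι ≫ ρ = SSet.const k) :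
    (loops m K k).PtSimplex s (relHom.pt _ K k) :=
  ptMk (relHom.mk ρ h) (relHom.un_injective
    (by rw [relHom.un_comp, relHom.un_mk, h', relHom.un_const]))

@[simp]
theorem un_curryPt (ρ : (Δ[m] : SSet.{w}) ⊗ (Δ[s] : SSet.{w}) ⟶ K)
    (h : (∂Δ[m] : (Δ[m] : SSet.{w}).Subcomplex).ι ▷ Δ[s] ≫ ρ = SSet.const k)
    (h' : Δ[m] ◁ (∂Δ[s] : (Δ[s] : SSet.{w}).Subcomplex).ι ≫ ρ = SSet.const k) :
    relHom.un (curryPt ρ h h').map = ρ := relHom.un_mk ρ h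

theorem ptSimplex_ext {n : ℕ} {X : SSet.{w}} {x : X _⦋0⦌} {f g : X.PtSimplex n x}
    (h : f.map = g.map) : f = g := SSet.RelativeMorphism.ext h

theorem curryPt_un (f : (loops m K k).PtSimplex s (relHom.pt _ K k)) :
    curryPt (relHom.un f.map) (relHom.whiskerRight_un f.map)
      (by rw [← relHom.un_comp, ptSimplex_comm, relHom.un_const]) = f :=
  ptSimplex_ext (relHom.un_injective (relHom.un_mk _ (relHom.whiskerRight_un f.map)))

/-- The simplex of `loops m K k` given by composition with `collapse`. -/
noncomputable def col (m s : ℕ) {N : ℕ} (h : N = m + s) (g : K.PtSimplex N k) :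
    (loops m K k).PtSimplex s (relHom.pt _ K k) :=
  curryPt (prodMap (colFun m s h) ≫ g.map)
    (boundary_whiskerRight_prodMap fun v =>
      ⟨⟨v, by omega⟩, trivialAt_ptSimplex g _, fun p q hp e => by
      have e' := congrArg Fin.val e
      rw [colFun_val] at e'
      have := Fin.val_ne_of_ne hp
      have := v.2
      simp only at e'
      split_ifs at e' <;> omega⟩)
    (boundary_whiskerLeft_prodMap fun v =>
      ⟨⟨if (v : ℕ) = 0 then 0 else m + v, by split_ifs <;> omega⟩,
      trivialAt_ptSimplex g _, fun p q hq e => by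
        have e' := congrArg Fin.val e
        rw [colFun_val] at e'
        have := Fin.val_ne_of_ne hq
        have := p.2
        simp only at e'
        split_ifs at e' <;> omega⟩)

theorem un_col (h : N = m + s) (g : K.PtSimplex N k) :
    relHom.un (col m s h g).map = prodMap (colFun m s h) ≫ g.map := un_curryPt _ _ _

theorem col_const (h : N = m + s) : col m s h (cst : K.PtSimplex N k) = cst :=
  ptSimplex_ext (relHom.un_injective (by
    rw [un_col]
    exact (SSet.comp_const _ _).trans relHom.un_const.symm))

/-- Composition with `collapse` is compatible with the relations defining the homotopy groups, as
long as these involve only the last `s + 1` faces. -/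
theorem isBd_col (h : N = m + s) {v : ℕ → K.PtSimplex N k} (hv : IsBd v)
    (hv' : ∀ i, s + 1 ≤ i → v i = cst) : IsBd (fun i => col m s h (v i)) := by
  obtain ⟨W, hW⟩ := hv
  have h' : N + 1 = m + (s + 1) := by omega
  have ht : ∀ j : Fin (N + 2), (j : ℕ) ≤ m → TrivialAt k W j := fun j hj => trivialAt_of_δ (by
    rw [hW, hv' _ (by omega)]; rfl)
  refine ⟨relHom.mk (prodMap (colFun m (s + 1) h') ≫ W) (boundary_whiskerRight_prodMap fun v =>
    ⟨⟨v, by omega⟩, ht _ (by have := v.2; simp only; omega), fun p q hp e => by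
      have e' := congrArg Fin.val e
      rw [colFun_val] at e'
      have := Fin.val_ne_of_ne hp
      have := v.2
      simp only at e'
      split_ifs at e' <;> omega⟩), fun j => relHom.un_injective ?_⟩
  rw [relHom.un_comp, relHom.un_mk, un_col]
  have hj := j.2
  by_cases hj0 : j = 0
  · subst hj0
    let f : Fin (m + 1) × Fin (s + 1) →o Fin (N + 2) :=
      ⟨fun p => ⟨m + p.2 + 1, by have := p.2.2; omega⟩, fun a b hab => by
        have : (a.2 : ℕ) ≤ b.2 := hab.2
        rw [Fin.mk_le_mk]
        omega⟩
    have e : Δ[m] ◁ SSet.stdSimplex.{w}.δ (0 : Fin (s + 2)) ≫ prodMap (colFun m (s + 1) h') =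
        prodMap f := by
      refine (whiskerLeft_prodMap _ f _ (𝟙 _) fun (p : Fin (m + 1)) (q : Fin (s + 1)) => ?_).trans
        ((congrArg _ (CategoryTheory.Functor.map_id SSet.stdSimplex.{w} _)).trans
          (Category.comp_id _))
      have v0 : ((0 : Fin (s + 2)) : ℕ) = 0 := rfl
      have key : ∀ z : Fin (s + 2), (z : ℕ) =
        (if (q : ℕ) < (0 : Fin (s + 2)) then (q : ℕ) else q + 1) →
          (if (z : ℕ) = 0 then (p : ℕ) else m + z) = m + q + 1 := by
        intro z hz
        split_ifs at hz ⊢ <;> omega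
      exact Fin.ext (key _ (val_succAbove _ q))
    rw [reassoc_of% e, prodMap_comp_eq_const (ht 0 (by simp)) (fun p q e => by
      have e' : m + (q : ℕ) + 1 = 0 := congrArg Fin.val e
      omega), hv' _ (by simp)]
    exact ((congrArg (fun g => relHom.un (SSet.RelativeMorphism.map g)) (col_const h)).trans
      relHom.un_const).symm
  · have hj0' : (j : ℕ) ≠ 0 := fun h => hj0 (Fin.ext h)
    have e : Δ[m] ◁ SSet.stdSimplex.{w}.δ j ≫ prodMap (colFun m (s + 1) h') =
        prodMap (colFun m s h) ≫ SSet.stdSimplex.δ (⟨m + j, by omega⟩ : Fin (N + 2)) := by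
      refine whiskerLeft_prodMap _ _ _ _ fun (p : Fin (m + 1)) (q : Fin (s + 1)) => ?_
      have key : ∀ (z : Fin (s + 2)) (c : Fin (N + 1)), (z : ℕ) =
        (if (q : ℕ) < j then (q : ℕ) else q + 1) →
          (c : ℕ) = (if (q : ℕ) = 0 then (p : ℕ) else m + q) →
          (if (z : ℕ) = 0 then (p : ℕ) else m + z) =
            ((⟨m + j, by omega⟩ : Fin (N + 2)).succAbove c : ℕ) := by
        intro z c hz hc
        have := p.2
        rw [val_succAbove]
        dsimp only
        split_ifs at hz hc ⊢ <;> omega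
      exact Fin.ext (key _ _ (val_succAbove _ _) rfl)
    rw [reassoc_of% e, hW]
    congr 3
    simp only
    omega

/-- The vertices of the path in `loops m K k` connecting its constant simplex to the simplex given
by `collapse`. -/
def pathFun (m s : ℕ) {N : ℕ} (h : N = m + 1 + s) :
    Fin (m + 1 + 1) × Fin (s + 1 + 1) →o Fin (N + 1) where
  toFun p := ⟨if (p.2 : ℕ) = 0 then p.1 else m + p.2, by split_ifs <;> omega⟩
  monotone' := by
    rintro ⟨a, b⟩ ⟨c, d⟩ ⟨h, k⟩
    have h1 : (a : ℕ) ≤ c := h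
    have h2 : (b : ℕ) ≤ d := k
    have h3 := a.2
    rw [Fin.mk_le_mk]
    dsimp only
    split_ifs <;> omega

theorem pathFun_val (h : N = m + 1 + s) (p : Fin (m + 1 + 1)) (q : Fin (s + 1 + 1)) :
    (pathFun m s h (p, q) : ℕ) = if (q : ℕ) = 0 then (p : ℕ) else m + q := rfl

theorem horn_whiskerRight_prodMap {n : Fin (m + 2)}
    {f : Fin (m + 1 + 1) × Fin (s + 1) →o Fin (N + 1)} {W : Δ[N] ⟶ K}
    (h : ∀ v ≠ n, ∃ j, TrivialAt k W j ∧ ∀ p q, p ≠ v → f (p, q) ≠ j) :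
    (Λ[m + 1, n] : (Δ[m + 1] : SSet.{w}).Subcomplex).ι ▷ Δ[s] ≫ prodMap f ≫ W = SSet.const k := by
  refine horn_tensor_hom_ext fun v hv => ?_
  rw [← comp_whiskerRight_assoc, SSet.horn.ι_ι, SSet.comp_const]
  obtain ⟨j, hj, hf⟩ := h v hv
  ext d x
  exact hj d _ fun i => hf _ _ (Fin.succAbove_ne v _)

/-- The path in `loops m K k` which exhibits `col (m + 1) s` as a preimage of `col m (s + 1)` under
the connecting map. -/
theorem exists_path_col (h : N = m + 1 + s) (h' : N = m + (s + 1)) (g : K.PtSimplex N k) :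
    ∃ H : Δ[s + 1] ⟶ paths (Fin.last (m + 1)) K k,
      SSet.stdSimplex.δ 1 ≫ H = (col (m + 1) s h g).map ≫ incl _ K k ∧
      (∀ j, j ≠ 1 → SSet.stdSimplex.δ j ≫ H = SSet.const (relHom.pt _ K k)) ∧
      (col m (s + 1) h' g).map = H ≫ face _ K k := by
  refine ⟨relHom.mk (prodMap (pathFun m s h) ≫ g.map) (horn_whiskerRight_prodMap fun v hv =>
    ⟨⟨v, by omega⟩, trivialAt_ptSimplex g _, fun p q hp e => by
      have e' := congrArg Fin.val e
      rw [pathFun_val] at e'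
      have := Fin.val_ne_of_ne hp
      have h1 := Fin.val_ne_of_ne hv
      have := v.2
      rw [Fin.val_last] at h1
      simp only at e'
      split_ifs at e' <;> omega⟩), relHom.un_injective ?_, fun j hj => relHom.un_injective ?_,
      relHom.un_injective ?_⟩
  · rw [relHom.un_comp, relHom.un_mk, un_comp_incl, un_col]
    have e : Δ[m + 1] ◁ SSet.stdSimplex.{w}.δ (1 : Fin (s + 2)) ≫ prodMap (pathFun m s h) =
        prodMap (colFun (m + 1) s h) := by
      refine (whiskerLeft_prodMap _ (colFun (m + 1) s h) _ (𝟙 _)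
        fun (p : Fin (m + 2)) (q : Fin (s + 1)) => ?_).trans
        ((congrArg _ (CategoryTheory.Functor.map_id SSet.stdSimplex.{w} _)).trans
          (Category.comp_id _))
      have key : ∀ z : Fin (s + 2), (z : ℕ) = (if (q : ℕ) < 1 then (q : ℕ) else q + 1) →
          (if (z : ℕ) = 0 then (p : ℕ) else m + z) = if (q : ℕ) = 0 then (p : ℕ) else m + 1 + q :=
            by
        intro z hz
        split_ifs at hz ⊢ <;> omega
      exact Fin.ext (key _ (val_succAbove _ q))
    rw [reassoc_of% e]
  · rw [relHom.un_comp, relHom.un_mk, relHom.un_const]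
    have hj' : (j : ℕ) ≠ 1 := fun h => hj (Fin.ext h)
    let f : Fin (m + 2) × Fin (s + 1) →o Fin (N + 1) :=
      ⟨fun p => pathFun m s h (p.1, j.succAbove p.2), fun a b hab => (pathFun m s h).monotone
        ⟨hab.1, (Fin.strictMono_succAbove j).monotone hab.2⟩⟩
    have e : Δ[m + 1] ◁ SSet.stdSimplex.{w}.δ j ≫ prodMap (pathFun m s h) = prodMap f := rfl
    rw [reassoc_of% e]
    have hjs := j.2
    refine prodMap_comp_eq_const (trivialAt_ptSimplex g (if hj0 : (j : ℕ) = 0 then 0 else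
      ⟨m + j, by omega⟩)) fun p q e => ?_
    have e' := congrArg Fin.val e
    change (if (j.succAbove q : ℕ) = 0 then (p : ℕ) else m + (j.succAbove q : ℕ)) = _ at e'
    have := p.2
    rw [val_succAbove] at e'
    split_ifs at e' <;> simp only [Fin.val_zero] at e' <;> omega
  · rw [un_comp_face, relHom.un_mk, un_col]
    have e : SSet.stdSimplex.{w}.δ (Fin.last (m + 1)) ▷ Δ[s + 1] ≫ prodMap (pathFun m s h) =
        prodMap (colFun m (s + 1) h') := by
      refine (whiskerRight_prodMap _ (colFun m (s + 1) h') _ (𝟙 _)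
        fun (p : Fin (m + 1)) (q : Fin (s + 2)) => ?_).trans
        ((congrArg _ (CategoryTheory.Functor.map_id SSet.stdSimplex.{w} _)).trans
          (Category.comp_id _))
      refine Fin.ext ?_
      change (if (q : ℕ) = 0 then ((Fin.last (m + 1)).succAbove p : ℕ) else m + q) =
        if (q : ℕ) = 0 then (p : ℕ) else m + q
      rw [Fin.succAbove_last, Fin.val_castSucc]
    rw [reassoc_of% e]

end collapse

/-! ### Homotopy groups of the loop complex -/

section kappa

variable {K : SSet.{w}} {k : K _⦋0⦌} {m s N : ℕ}

theorem un_col_zero (g : K.PtSimplex m k) : relHom.un (col m 0 rfl g).map = tens0 g.map := by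
  have e : prodMap (colFun m 0 rfl) = CartesianMonoidalCategory.fst (Δ[m] : SSet.{w}) Δ[0] := by
    ext d ⟨x, y⟩
    obtain ⟨f, rfl⟩ := SSet.stdSimplex.objEquiv.symm.surjective x
    refine congrArg SSet.stdSimplex.objEquiv.symm
      (SimplexCategory.Hom.ext _ _ (OrderHom.ext _ _ (funext fun i => Fin.ext ?_)))
    exact if_pos (congrArg Fin.val
      (Subsingleton.elim (α := Fin 1) (SSet.stdSimplex.asOrderHom y i) 0))
  rw [un_col, e]

variable [SSet.KanComplex K]

/-- Surjectivity of the map from `π_{m+1} K` to `π_1` of the loop complex: lift along the connecting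
map, to a vertex of `loops (m + 1) K k`. -/
theorem exists_isBd_col_one (f : (loops m K k).PtSimplex 1 (relHom.pt _ K k)) :
    ∃ g : K.PtSimplex (m + 1) k, IsBd (seq [f, col m 1 rfl g]) := by
  obtain ⟨H, ρ, h1, hj, hf⟩ := exists_lift_ptSimplex (n := Fin.last (m + 1)) f
  obtain ⟨g, hg⟩ := exists_tens0 (relHom.un ρ.map)
  have hg' : (∂Δ[m + 1] : (Δ[m + 1] : SSet.{w}).Subcomplex).ι ≫ g = SSet.const k := by
    refine tens0_injective ?_
    have := relHom.whiskerRight_un ρ.map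
    rw [hg, tens0, CartesianMonoidalCategory.whiskerRight_fst_assoc] at this
    exact this.trans (SSet.comp_const _ _).symm
  obtain ⟨H', h1', hj', hf'⟩ := exists_path_col (m := m) (s := 0) rfl rfl (ptMk g hg')
  have e : (col (m + 1) 0 rfl (ptMk g hg')).map = ρ.map :=
    relHom.un_injective ((un_col_zero _).trans hg.symm)
  -- two paths with the same nontrivial vertex are edges of a triangle of paths whose third edge is
  -- trivial
  have hc : BoundaryCompatible (![SSet.const (relHom.pt _ K k), H', H] :
      Fin 3 → (Δ[1] ⟶ paths (Fin.last (m + 1)) K k)) := by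
    intro i j hij
    fin_cases i <;> fin_cases j
    · exact (SSet.comp_const _ _).trans (hj' 0 (by decide)).symm
    · exact (SSet.comp_const _ _).trans (hj 0 (by decide)).symm
    · exact absurd hij (by decide)
    · exact h1'.trans ((congrArg (· ≫ incl _ K k) e).trans h1.symm)
  obtain ⟨V, hV⟩ := exists_paths _ hc
  refine ⟨ptMk g hg', V ≫ face _ K k, fun j => ?_⟩
  rw [← Category.assoc, hV]
  fin_cases j
  · exact const_face
  · exact hf'.symm
  · exact hf.symm

/-- Surjectivity of the map from `π_{m+2} K` to `π_2` of the loop complex: lift along the connecting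
map, to a simplex of dimension one. -/
theorem exists_isBd_col_two (f : (loops m K k).PtSimplex 2 (relHom.pt _ K k)) :
    ∃ g : K.PtSimplex (m + 2) k, IsBd (seq [f, col m 2 rfl g]) := by
  obtain ⟨H, ρ, h1, hj, hf⟩ := exists_lift_ptSimplex (n := Fin.last (m + 1)) f
  obtain ⟨g, W, hW⟩ := exists_isBd_col_one ρ
  obtain ⟨H', h1', hj', hf'⟩ := exists_path_col (m := m) (s := 1) rfl rfl g
  -- as before, with the homotopy `W` between the nontrivial edges
  have hc : BoundaryCompatible (![SSet.const (relHom.pt _ K k), W ≫ incl _ K k, H', H] :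
      Fin 4 → (Δ[2] ⟶ paths (Fin.last (m + 1)) K k)) := by
    intro i j hij
    fin_cases i <;> fin_cases j
    · refine (SSet.comp_const _ _).trans (Eq.symm ?_)
      exact (Category.assoc _ _ _).symm.trans ((congrArg (· ≫ incl _ K k) (hW 0)).trans const_incl)
    · exact (SSet.comp_const _ _).trans (hj' 0 (by decide)).symm
    · exact (SSet.comp_const _ _).trans (hj 0 (by decide)).symm
    · exact absurd hij (by decide)
    · exact ((Category.assoc _ _ _).symm.trans (congrArg (· ≫ incl _ K k) (hW 1))).trans h1'.symm
    · exact ((Category.assoc _ _ _).symm.trans (congrArg (· ≫ incl _ K k) (hW 2))).trans h1.symm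
    · exact absurd hij (by decide)
    · exact absurd hij (by decide)
    · exact (hj' 2 (by decide)).trans (hj 2 (by decide)).symm
  obtain ⟨V, hV⟩ := exists_paths _ hc
  refine ⟨g, V ≫ face _ K k, fun j => ?_⟩
  rw [← Category.assoc, hV]
  fin_cases j
  · exact const_face
  · exact (Category.assoc _ _ _).trans (incl_face W)
  · exact hf'.symm
  · exact hf.symm

/-- The isomorphism between the homotopy groups of `K` and of its loop complex, given by composition
with `collapse`. -/
noncomputable def kappa (m : ℕ) (K : SSet.{w}) (k : K _⦋0⦌) [SSet.KanComplex K] :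
    pi (m + 2) K k →* pi 2 (loops m K k) (relHom.pt _ K k) :=
  MonoidHom.mk' (Quot.lift (fun g => pi.mk (col m 2 rfl g)) (by
    rintro f g h
    have h1 := isBd_col (m := m) (s := 2) rfl (isBd_two_iff.1 h) (fun i hi => by
      obtain ⟨i, rfl⟩ := Nat.exists_eq_add_of_le' hi; rfl)
    refine (pi.mk_eq_mk.2 ?_).symm
    convert h1 using 1
    funext i
    rcases i with _ | _ | i
    · rfl
    · rfl
    · exact (col_const (N := m + 2) (s := 2) rfl).symm)) (fun a b => by
    obtain ⟨f, rfl⟩ := pi.mk_surjective a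
    obtain ⟨g, rfl⟩ := pi.mk_surjective b
    obtain ⟨l, hl⟩ := exists_mul (n := m + 1) f g
    have h1 := isBd_col (m := m) (s := 2) rfl hl (fun i hi => by
      obtain ⟨i, rfl⟩ := Nat.exists_eq_add_of_le' hi; rfl)
    rw [pi.mk_mul_mk.2 hl]
    refine (pi.mk_mul_mk.2 ?_).symm
    convert h1 using 1
    funext i
    rcases i with _ | _ | _ | i
    · rfl
    · rfl
    · rfl
    · exact (col_const (N := m + 2) (s := 2) rfl).symm)

theorem kappa_surjective : Function.Surjective (kappa m K k) := by
  intro c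
  obtain ⟨f, rfl⟩ := pi.mk_surjective c
  obtain ⟨g, hg⟩ := exists_isBd_col_two f
  exact ⟨pi.mk g, (pi.mk_eq_mk.2 hg).symm⟩

/-- Injectivity: the connecting maps reduce the claim to vertices of the `(m + 2)`-fold loop
complex, which are the simplices of `K` themselves. -/
theorem kappa_injective : Function.Injective (kappa m K k) := by
  rw [injective_iff_map_eq_one]
  intro c hc
  obtain ⟨g, rfl⟩ := pi.mk_surjective c
  have h2 : IsBd (single 0 (col m 2 rfl g)) := isBd_single_zero.2 (pi.mk_eq_mk.1 hc)
  obtain ⟨H, h1, hj, hf⟩ := exists_path_col (m := m) (s := 1) rfl rfl g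
  have h3 : IsBd (single 0 (col (m + 1) 1 rfl g)) :=
    isBd_single_of_isBd_single (by omega) (isBd_of_isBd_face H h1 hj hf h2)
  obtain ⟨H, h1, hj, hf⟩ := exists_path_col (m := m + 1) (s := 0) rfl rfl g
  obtain ⟨W, hW⟩ := isBd_of_isBd_face H h1 hj hf h3
  refine (pi.mk_eq_of_homotopy (f := cst) (g := g) (homotopyMk (relHom.un W) ?_ ?_
    (relHom.whiskerRight_un W))).symm
  · rw [← relHom.un_comp, hW]
    exact relHom.un_const
  · rw [← relHom.un_comp, hW]
    exact un_col_zero (m := m + 2) g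

theorem kappa_bijective : Function.Bijective (kappa m K k) := ⟨kappa_injective, kappa_surjective⟩

end kappa

/-! ### Maps on a product of simplices and the classes which they represent -/

section represents

variable {K : SSet.{w}} {k : K _⦋0⦌} {m s : ℕ}

theorem unionProd_hom_ext {B T X : SSet.{w}} {A : B.Subcomplex} {S : T.Subcomplex}
    {f g : (A.unionProd S : SSet) ⟶ X}
    (h1 : SSet.Subcomplex.unionProd.ι₁ A S ≫ f = SSet.Subcomplex.unionProd.ι₁ A S ≫ g)
    (h2 : SSet.Subcomplex.unionProd.ι₂ A S ≫ f = SSet.Subcomplex.unionProd.ι₂ A S ≫ g) : f = g :=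
  (SSet.Subcomplex.unionProd.isPushout A S).hom_ext h1 h2

theorem unionProd_tensor_hom_ext {B T X Y : SSet.{w}} {A : B.Subcomplex} {S : T.Subcomplex}
    {f g : (A.unionProd S : SSet) ⊗ Y ⟶ X}
    (h1 : SSet.Subcomplex.unionProd.ι₁ A S ▷ Y ≫ f = SSet.Subcomplex.unionProd.ι₁ A S ▷ Y ≫ g)
    (h2 : SSet.Subcomplex.unionProd.ι₂ A S ▷ Y ≫ f = SSet.Subcomplex.unionProd.ι₂ A S ▷ Y ≫ g) :
    f = g := by
  rw [← cancel_epi (β_ Y _).hom]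
  apply MonoidalClosed.curry_injective
  have e {Z : SSet.{w}} (u : Z ⟶ (A.unionProd S : SSet)) :
      Y ◁ u ≫ (β_ Y _).hom = (β_ Y _).hom ≫ u ▷ Y := BraidedCategory.braiding_naturality_right _ _
  refine unionProd_hom_ext ?_ ?_ <;>
    rw [← MonoidalClosed.curry_natural_left, ← MonoidalClosed.curry_natural_left, reassoc_of% e,
      reassoc_of% e]
  · rw [h1]
  · rw [h2]

/-- A map on `Δ[m] ⊗ Δ[s]` which is trivial on the boundary, as a relative morphism. -/
@[simps]
def relMk (ρ : (Δ[m] : SSet.{w}) ⊗ (Δ[s] : SSet.{w}) ⟶ K)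
    (h : (∂Δ[m] : (Δ[m] : SSet.{w}).Subcomplex).ι ▷ Δ[s] ≫ ρ = SSet.const k)
    (h' : Δ[m] ◁ (∂Δ[s] : (Δ[s] : SSet.{w}).Subcomplex).ι ≫ ρ = SSet.const k) :
    SSet.RelativeMorphism ((SSet.boundary.{w} m).unionProd (SSet.boundary.{w} s))
      (SSet.Subcomplex.ofSimplex k) (SSet.const ⟨k, SSet.Subcomplex.mem_ofSimplex_obj k⟩) where
  map := ρ
  comm := unionProd_hom_ext h' h

theorem rel_comm₂ (σ : SSet.RelativeMorphism ((SSet.boundary.{w} m).unionProd (SSet.boundary.{w} s))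
      (SSet.Subcomplex.ofSimplex k) (SSet.const ⟨k, SSet.Subcomplex.mem_ofSimplex_obj k⟩)) :
    (∂Δ[m] : (Δ[m] : SSet.{w}).Subcomplex).ι ▷ Δ[s] ≫ σ.map = SSet.const k :=
  congrArg (SSet.Subcomplex.unionProd.ι₂ (SSet.boundary.{w} m) (SSet.boundary.{w} s) ≫ ·) σ.comm

theorem rel_comm₁ (σ : SSet.RelativeMorphism ((SSet.boundary.{w} m).unionProd (SSet.boundary.{w} s))
      (SSet.Subcomplex.ofSimplex k) (SSet.const ⟨k, SSet.Subcomplex.mem_ofSimplex_obj k⟩)) :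
    Δ[m] ◁ (∂Δ[s] : (Δ[s] : SSet.{w}).Subcomplex).ι ≫ σ.map = SSet.const k :=
  congrArg (SSet.Subcomplex.unionProd.ι₁ (SSet.boundary.{w} m) (SSet.boundary.{w} s) ≫ ·) σ.comm

/-- Homotopies relative to the boundary of `Δ[m] ⊗ Δ[s]` are homotopies relative to the boundary of
the corresponding `s`-simplices of the loop complex. -/
theorem nonempty_homotopy_iff
    (σ τ : SSet.RelativeMorphism ((SSet.boundary.{w} m).unionProd (SSet.boundary.{w} s))
      (SSet.Subcomplex.ofSimplex k) (SSet.const ⟨k, SSet.Subcomplex.mem_ofSimplex_obj k⟩)) :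
    Nonempty (SSet.RelativeMorphism.Homotopy σ τ) ↔
      Nonempty (SSet.RelativeMorphism.Homotopy (curryPt σ.map (rel_comm₂ σ) (rel_comm₁ σ))
        (curryPt τ.map (rel_comm₂ τ) (rel_comm₁ τ))) := by
  constructor
  · rintro ⟨h⟩
    have h2 := congrArg (SSet.Subcomplex.unionProd.ι₂ (SSet.boundary.{w} m) (SSet.boundary.{w} s) ▷
      Δ[1] ≫ ·) h.rel
    have h1 := congrArg (SSet.Subcomplex.unionProd.ι₁ (SSet.boundary.{w} m) (SSet.boundary.{w} s) ▷
      Δ[1] ≫ ·) h.rel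
    let H : (Δ[s] : SSet.{w}) ⊗ (Δ[1] : SSet.{w}) ⟶ loops m K k :=
      relHom.mk ((α_ _ _ _).inv ≫ h.h) (congrArg ((α_ _ _ _).inv ≫ ·) h2)
    have hH : relHom.un H = (α_ _ _ _).inv ≫ h.h := relHom.un_mk _ _
    refine ⟨⟨H, relHom.un_injective ?_, relHom.un_injective ?_, relHom.un_injective ?_⟩⟩
    · exact (relHom.un_comp _ _).trans ((congrArg (_ ◁ SSet.ι₀ ≫ ·) hH).trans
        (h.h₀.trans (un_curryPt _ _ _).symm))
    · exact (relHom.un_comp _ _).trans ((congrArg (_ ◁ SSet.ι₁ ≫ ·) hH).trans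
        (h.h₁.trans (un_curryPt _ _ _).symm))
    · refine Eq.trans ?_ relHom.un_const.symm
      exact (relHom.un_comp _ _).trans ((congrArg (_ ◁ (∂Δ[s].ι ▷ _) ≫ ·) hH).trans
        (congrArg ((α_ _ _ _).inv ≫ ·) h1))
  · rintro ⟨h⟩
    have h0 := (relHom.un_comp _ _).symm.trans ((congrArg relHom.un h.h₀).trans (un_curryPt _ _ _))
    have h1 := (relHom.un_comp _ _).symm.trans ((congrArg relHom.un h.h₁).trans (un_curryPt _ _ _))
    have h2 := (relHom.un_comp _ _).symm.trans ((congrArg relHom.un h.rel).trans relHom.un_const)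
    refine ⟨⟨(α_ _ _ _).hom ≫ relHom.un h.h, h0, h1, ?_⟩⟩
    refine unionProd_tensor_hom_ext ?_ ?_
    · exact congrArg ((α_ _ _ _).hom ≫ ·) h2
    · exact congrArg ((α_ _ _ _).hom ≫ ·) (relHom.whiskerRight_un h.h)

end represents

section represents

variable {K : SSet.{w}} {k : K _⦋0⦌} {m s : ℕ}

theorem collapse_eq_prodMap (m s : ℕ) : collapse.{w} m s = prodMap (colFun m s rfl) := by
  have : collapseFun m s = colFun m s rfl := by
    refine OrderHom.ext _ _ (funext fun p => Fin.ext ?_)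
    have e : p.2 = 0 ↔ (p.2 : ℕ) = 0 := Fin.ext_iff
    change ((if p.2 = 0 then ⟨p.1, by omega⟩ else ⟨m + p.2, by omega⟩ : Fin (m + s + 1)) : ℕ) =
      if (p.2 : ℕ) = 0 then (p.1 : ℕ) else m + p.2
    split_ifs <;> first | rfl | omega
  rw [← this]
  rfl

theorem Represents.trivial {ρ : (Δ[m] : SSet.{w}) ⊗ (Δ[s] : SSet.{w}) ⟶ K} {c : pi (m + s) K k}
    (h : Represents ρ c) :
    (∂Δ[m] : (Δ[m] : SSet.{w}).Subcomplex).ι ▷ Δ[s] ≫ ρ = SSet.const k ∧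
      Δ[m] ◁ (∂Δ[s] : (Δ[s] : SSet.{w}).Subcomplex).ι ≫ ρ = SSet.const k := by
  obtain ⟨-, -, -, τ, -, rfl, -⟩ := h
  exact ⟨rel_comm₂ τ, rel_comm₁ τ⟩

theorem represents_iff {ρ : (Δ[m] : SSet.{w}) ⊗ (Δ[s] : SSet.{w}) ⟶ K} {c : pi (m + s) K k}
    (h : (∂Δ[m] : (Δ[m] : SSet.{w}).Subcomplex).ι ▷ Δ[s] ≫ ρ = SSet.const k)
    (h' : Δ[m] ◁ (∂Δ[s] : (Δ[s] : SSet.{w}).Subcomplex).ι ≫ ρ = SSet.const k) :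
    Represents ρ c ↔ ∃ g, pi.mk g = c ∧
      Nonempty (SSet.RelativeMorphism.Homotopy (col m s rfl g) (curryPt ρ h h')) := by
  constructor
  · rintro ⟨g, hg, σ, τ, hσ, rfl, hστ⟩
    refine ⟨g, hg, ?_⟩
    have := (nonempty_homotopy_iff σ τ).1 hστ
    have e : curryPt σ.map (rel_comm₂ σ) (rel_comm₁ σ) = col m s rfl g :=
      ptSimplex_ext (relHom.un_injective ((un_curryPt _ _ _).trans
        ((hσ.trans (congrArg (· ≫ g.map) (collapse_eq_prodMap m s))).trans (un_col rfl g).symm)))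
    rwa [e] at this
  · rintro ⟨g, hg, hh⟩
    refine ⟨g, hg, relMk _ (relHom.whiskerRight_un (col m s rfl g).map) ?_, relMk ρ h h', ?_, rfl,
      ?_⟩
    · rw [← relHom.un_comp, ptSimplex_comm, relHom.un_const]
    · exact (un_col rfl g).trans (congrArg (· ≫ g.map) (collapse_eq_prodMap m s)).symm
    · rw [nonempty_homotopy_iff]
      have e := curryPt_un (col m s rfl g)
      simp only [relMk_map]
      rwa [e]

variable [SSet.KanComplex K]

/-- The class represented by a map on `Δ[m] ⊗ Δ[2]` is the one whose image under `kappa` is the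
class of the adjoint `2`-simplex of the loop complex. -/
theorem represents_two_iff {ρ : (Δ[m] : SSet.{w}) ⊗ (Δ[2] : SSet.{w}) ⟶ K} {c : pi (m + 2) K k}
    (h : (∂Δ[m] : (Δ[m] : SSet.{w}).Subcomplex).ι ▷ Δ[2] ≫ ρ = SSet.const k)
    (h' : Δ[m] ◁ (∂Δ[2] : (Δ[2] : SSet.{w}).Subcomplex).ι ≫ ρ = SSet.const k) :
    Represents ρ c ↔ kappa m K k c = pi.mk (curryPt ρ h h') := by
  rw [represents_iff h h']
  constructor
  · rintro ⟨g, rfl, ⟨hh⟩⟩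
    exact pi.mk_eq_of_homotopy hh
  · intro hc
    obtain ⟨g, rfl⟩ := pi.mk_surjective c
    exact ⟨g, rfl, homotopy_of_isBd (pi.mk_eq_mk.1 hc)⟩

theorem mk_eq_of_loops {f g : K.PtSimplex m k} (W : Δ[1] ⟶ loops m K k)
    (h1 : relHom.un (SSet.stdSimplex.δ 1 ≫ W) = tens0 f.map)
    (h0 : relHom.un (SSet.stdSimplex.δ 0 ≫ W) = tens0 g.map) : pi.mk f = pi.mk g :=
  pi.mk_eq_of_homotopy (homotopyMk (relHom.un W) ((relHom.un_comp _ _).symm.trans h1)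
    ((relHom.un_comp _ _).symm.trans h0) (relHom.whiskerRight_un W))

/-- A map on `Δ[m] ⊗ Δ[0]` represents the class of the corresponding map on `Δ[m]`. -/
theorem represents_zero_iff {ρ : (Δ[m] : SSet.{w}) ⊗ (Δ[0] : SSet.{w}) ⟶ K} {c : pi m K k} :
    Represents (m := m) (s := 0) ρ c ↔ ∃ g : K.PtSimplex m k, ρ = tens0 g.map ∧ pi.mk g = c := by
  constructor
  · intro h
    obtain ⟨g', hg'⟩ := exists_tens0 ρ
    have hρ := h.trivial
    have hb : (∂Δ[m] : (Δ[m] : SSet.{w}).Subcomplex).ι ≫ g' = SSet.const k := by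
      refine tens0_injective ?_
      have := hρ.1
      rw [hg', tens0, CartesianMonoidalCategory.whiskerRight_fst_assoc] at this
      exact this.trans (SSet.comp_const _ _).symm
    refine ⟨ptMk g' hb, hg', ?_⟩
    obtain ⟨g, hg, ⟨hh⟩⟩ := (represents_iff hρ.1 hρ.2).1 h
    obtain ⟨r⟩ := relStruct_of_homotopy hh
    refine Eq.trans ?_ hg
    refine mk_eq_of_loops r.map ?_ ?_
    · exact (congrArg relHom.un (r.δ_succ_map)).trans ((un_curryPt _ _ _).trans hg')
    · exact (congrArg relHom.un (r.δ_castSucc_map)).trans (un_col_zero g)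
  · rintro ⟨g, rfl, rfl⟩
    have h' : Δ[m] ◁ (∂Δ[0] : (Δ[0] : SSet.{w}).Subcomplex).ι ≫ tens0 g.map = SSet.const k := by
      have : IsInitial ((∂Δ[0] : (Δ[0] : SSet.{w}).Subcomplex) : SSet) := by
        rw [SSet.boundary_zero]; exact SSet.Subcomplex.isInitialBot
      apply MonoidalClosed.curry_injective
      exact this.hom_ext _ _
    have h : (∂Δ[m] : (Δ[m] : SSet.{w}).Subcomplex).ι ▷ Δ[0] ≫ tens0 g.map = SSet.const k := by
      rw [tens0, CartesianMonoidalCategory.whiskerRight_fst_assoc, ptSimplex_comm, SSet.comp_const]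
    refine (represents_iff h h').2 ⟨g, rfl, ?_⟩
    have e : col m 0 rfl g = curryPt _ h h' :=
      ptSimplex_ext (relHom.un_injective ((un_col_zero g).trans (un_curryPt _ _ _).symm))
    exact ⟨.ofEq e⟩

/-- Naturality of `kappa`. -/
theorem kappa_piMap {K' : SSet.{w}} {k' : K' _⦋0⦌} [SSet.KanComplex K'] (φ : K ⟶ K')
    (h : φ.app _ k = k') (c : pi (m + 2) K k) :
    kappa m K' k' (piMap (m + 2) φ h c) =
      piMap 2 (relHom.map _ φ h) (relHom.map_pt φ h) (kappa m K k c) := by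
  obtain ⟨g, rfl⟩ := pi.mk_surjective c
  refine congrArg pi.mk (ptSimplex_ext (relHom.un_injective ?_))
  refine (un_col _ _).trans ?_
  refine Eq.trans ?_ (relHom.un_comp_map φ h _).symm
  rw [un_col]
  rfl

end represents

/-! ### Loops and paths in a pointed diagram -/

section obs

/-- The pointed diagram of the complexes of maps `B ⟶ Y d` which are trivial on `A`. -/
noncomputable abbrev PtDiagram.relHom {D : Type u} [Category.{v} D] {B : SSet.{w}}
    (A : B.Subcomplex)
    (Y : PtDiagram.{w} D) : PtDiagram.{w} D where
  functor :=
    { obj d := CechDiff.relHom A (Y.functor.obj d) (Y.pt d)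
      map f := relHom.map A (Y.functor.map f) (Y.map_pt f)
      map_id d := relHom.un_injective (by
        have := relHom.un_comp_map (A := A) (Y.functor.map (𝟙 d)) (Y.map_pt (𝟙 d)) (𝟙 _)
        rw [Category.id_comp] at this
        rw [this, Y.functor.map_id, Category.comp_id])
      map_comp f g := relHom.un_injective (by
        have := relHom.un_comp_map (A := A) (Y.functor.map (f ≫ g)) (Y.map_pt (f ≫ g)) (𝟙 _)
        rw [Category.id_comp] at this
        rw [this, Y.functor.map_comp]
        have := relHom.un_comp_map (A := A) (Y.functor.map f) (Y.map_pt f) (𝟙 _)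
        rw [Category.id_comp] at this
        rw [relHom.un_comp_map, this, Category.assoc]) }
  pt d := relHom.pt A _ _
  map_pt f := relHom.map_pt _ (Y.map_pt f)

variable {D : Type u} [Category.{v} D] (Y : PtDiagram.{w} D) {m : ℕ}

/-- The loop complexes of a pointed diagram. -/
noncomputable abbrev PtDiagram.loops (m : ℕ) : PtDiagram.{w} D :=
  Y.relHom (∂Δ[m] : (Δ[m] : SSet.{w}).Subcomplex)

/-- The path complexes of a pointed diagram. -/
noncomputable abbrev PtDiagram.paths (n : Fin (m + 2)) : PtDiagram.{w} D :=
  Y.relHom (Λ[m + 1, n] : (Δ[m + 1] : SSet.{w}).Subcomplex)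

variable {Y} {n : Fin (m + 2)} {d e : D} {T : SSet.{w}}

theorem un_comp_functor_map {B : SSet.{w}} {A : B.Subcomplex} (g : T ⟶ (Y.relHom A).functor.obj d)
    (f : d ⟶ e) : relHom.un (g ≫ (Y.relHom A).functor.map f) = relHom.un g ≫ Y.functor.map f :=
  relHom.un_comp_map _ (Y.map_pt f) _

/-- The inclusion of the loops in the paths. -/
noncomputable abbrev PtDiagram.incl (Y : PtDiagram.{w} D) (n : Fin (m + 2)) (d : D) :
    (Y.loops (m + 1)).functor.obj d ⟶ (Y.paths n).functor.obj d := CechDiff.incl n _ _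

/-- The restriction of paths to the `n`-th face. -/
noncomputable abbrev PtDiagram.face (Y : PtDiagram.{w} D) (n : Fin (m + 2)) (d : D) :
    (Y.paths n).functor.obj d ⟶ (Y.loops m).functor.obj d := CechDiff.face n _ _

theorem incl_naturality (f : d ⟶ e) :
    (Y.loops (m + 1)).functor.map f ≫ Y.incl n e = Y.incl n d ≫ (Y.paths n).functor.map f := by
  refine relHom.un_injective ?_
  rw [un_comp_functor_map, un_comp_incl]
  have h1 := un_comp_incl (n := n) (𝟙 ((Y.loops (m + 1)).functor.obj d))
  have h2 := un_comp_functor_map (𝟙 ((Y.loops (m + 1)).functor.obj d)) f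
  rw [Category.id_comp] at h1 h2
  rw [h1, h2]

theorem face_naturality (f : d ⟶ e) :
    (Y.paths n).functor.map f ≫ Y.face n e = Y.face n d ≫ (Y.loops m).functor.map f := by
  refine relHom.un_injective ?_
  rw [un_comp_functor_map, un_comp_face]
  have h1 := un_comp_face (n := n) (𝟙 ((Y.paths n).functor.obj d))
  have h2 := un_comp_functor_map (𝟙 ((Y.paths n).functor.obj d)) f
  rw [Category.id_comp] at h1 h2
  rw [h1, h2, Category.assoc]

end obs

/-! ### Tetrahedra of paths -/

section tetra

variable {m : ℕ} {n : Fin (m + 2)} {K : SSet.{w}} {k : K _⦋0⦌} [SSet.KanComplex K]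

/-- The face of a triangle of paths whose edges are loops. -/
noncomputable abbrev facePt (Φ : Δ[2] ⟶ paths n K k)
    (h : ∀ i, SSet.stdSimplex.δ i ≫ Φ ≫ face n K k = SSet.const (relHom.pt _ K k)) :
    (loops m K k).PtSimplex 2 (relHom.pt _ K k) := ptMkδ (Φ ≫ face n K k) h

/-- The faces of the four triangles of a tetrahedron satisfy the homotopy addition relation, since
the complex of paths is contractible. -/
theorem mk_face_mul {a b c d : Δ[2] ⟶ paths n K k}
    (ha : ∀ i, SSet.stdSimplex.δ i ≫ a ≫ face n K k = SSet.const (relHom.pt _ K k))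
    (hb : ∀ i, SSet.stdSimplex.δ i ≫ b ≫ face n K k = SSet.const (relHom.pt _ K k))
    (hc : ∀ i, SSet.stdSimplex.δ i ≫ c ≫ face n K k = SSet.const (relHom.pt _ K k))
    (hd : ∀ i, SSet.stdSimplex.δ i ≫ d ≫ face n K k = SSet.const (relHom.pt _ K k))
    (h : BoundaryCompatible ![d, c, b, a]) :
    pi.mk (facePt a ha) * pi.mk (facePt c hc) = pi.mk (facePt b hb) * pi.mk (facePt d hd) := by
  obtain ⟨V, hV⟩ := exists_paths _ h
  refine mk_mul_of_isBd ⟨V ≫ face _ K k, fun j => ?_⟩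
  rw [← Category.assoc, hV]
  fin_cases j <;> rfl

theorem boundaryCompatible_four {X : SSet.{w}} {a b c d : Δ[2] ⟶ X}
    (h00 : SSet.stdSimplex.δ 0 ≫ d = SSet.stdSimplex.δ 0 ≫ c)
    (h10 : SSet.stdSimplex.δ 1 ≫ d = SSet.stdSimplex.δ 0 ≫ b)
    (h20 : SSet.stdSimplex.δ 2 ≫ d = SSet.stdSimplex.δ 0 ≫ a)
    (h11 : SSet.stdSimplex.δ 1 ≫ c = SSet.stdSimplex.δ 1 ≫ b)
    (h21 : SSet.stdSimplex.δ 2 ≫ c = SSet.stdSimplex.δ 1 ≫ a)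
    (h22 : SSet.stdSimplex.δ 2 ≫ b = SSet.stdSimplex.δ 2 ≫ a) :
    BoundaryCompatible ![d, c, b, a] := by
  intro i j hij
  fin_cases i <;> fin_cases j
  · exact h00
  · exact h10
  · exact h20
  · exact absurd hij (by decide)
  · exact h11
  · exact h21
  · exact absurd hij (by decide)
  · exact absurd hij (by decide)
  · exact h22

theorem boundaryCompatible_three {X : SSet.{w}} {a b c : Δ[1] ⟶ X}
    (h00 : SSet.stdSimplex.δ 0 ≫ c = SSet.stdSimplex.δ 0 ≫ b)
    (h10 : SSet.stdSimplex.δ 1 ≫ c = SSet.stdSimplex.δ 0 ≫ a)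
    (h11 : SSet.stdSimplex.δ 1 ≫ b = SSet.stdSimplex.δ 1 ≫ a) :
    BoundaryCompatible ![c, b, a] := by
  intro i j hij
  fin_cases i <;> fin_cases j
  · exact h00
  · exact h10
  · exact absurd hij (by decide)
  · exact h11

theorem exists_triangle_of_horn {X : SSet.{w}} [SSet.KanComplex X] {a c : Δ[1] ⟶ X}
    (h : SSet.stdSimplex.δ 1 ≫ c = SSet.stdSimplex.δ 0 ≫ a) :
    ∃ σ : Δ[2] ⟶ X, SSet.stdSimplex.δ 2 ≫ σ = a ∧ SSet.stdSimplex.δ 0 ≫ σ = c := by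
  have hc : SSet.horn.IsCompatible (i := (1 : Fin 3))
    (fun (j : Fin 3) _ => if j = 0 then c else a) := by
    rw [SSet.horn.isCompatible_iff]
    intro i j hi hj hij
    fin_cases i <;> fin_cases j <;>
      first | (exact absurd hij (by decide)) | (exact absurd rfl hi) | (exact absurd rfl hj) |
        (exact h)
  obtain ⟨V, hV⟩ := hc.exists_lift_of_kanComplex
  exact ⟨V, hV 2 (by decide), hV 0 (by decide)⟩

end tetra

/-! ### Obstruction data -/

section obs

/-- The data from which the second differential is computed in a pointed cosimplicial space: a
vertex `a` of the loops in degree `0`, an edge `y` between its cofaces, and a triangle `Φ` of paths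
whose edges are the cofaces of `y`. -/
structure Obs (Y : PtDiagram.{w} SimplexCategory) {m : ℕ} (n : Fin (m + 2))
    (a : Δ[0] ⟶ (Y.loops (m + 1)).functor.obj ⦋0⦌) (y : Δ[1] ⟶ (Y.loops (m + 1)).functor.obj ⦋1⦌)
    (Φ : Δ[2] ⟶ (Y.paths n).functor.obj ⦋2⦌) : Prop where
  δ_y : ∀ k : Fin 2, SSet.stdSimplex.δ k ≫ y = a ≫
    (Y.loops (m + 1)).functor.map (SimplexCategory.δ k)
  δ_Φ : ∀ k : Fin 3, SSet.stdSimplex.δ k ≫ Φ =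
    y ≫ Y.incl n _ ≫ (Y.paths n).functor.map (SimplexCategory.δ k)

variable {Y : PtDiagram.{w} SimplexCategory} {m : ℕ} {n : Fin (m + 2)}

theorem map_δ_comp_δ (F : SimplexCategory ⥤ SSet.{w}) {p : ℕ} {i j : Fin (p + 2)} (h : i ≤ j) :
    F.map (SimplexCategory.δ i) ≫ F.map (SimplexCategory.δ j.succ) =
      F.map (SimplexCategory.δ j) ≫ F.map (SimplexCategory.δ i.castSucc) := by
  rw [← F.map_comp, ← F.map_comp, SimplexCategory.δ_comp_δ h]

section

variable {a : Δ[0] ⟶ (Y.loops (m + 1)).functor.obj ⦋0⦌}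
  {y : Δ[1] ⟶ (Y.loops (m + 1)).functor.obj ⦋1⦌} {Φ : Δ[2] ⟶ (Y.paths n).functor.obj ⦋2⦌}

theorem Obs.face_eq (o : Obs Y n a y Φ) (i : Fin 3) :
    SSet.stdSimplex.δ i ≫ Φ ≫ Y.face n _ = SSet.const ((Y.loops m).pt ⦋2⦌) := by
  rw [← Category.assoc, o.δ_Φ, Category.assoc, Category.assoc, face_naturality,
    ← Category.assoc (Y.incl n _), ← Category.assoc]
  refine (congrArg (· ≫ _) (incl_face y)).trans ?_
  exact (SSet.const_comp _ _).trans (congrArg _ ((Y.loops m).map_pt _))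

/-- The restriction of the triangle `Φ` of paths to the `n`-th face. It is a sphere of loops, since
the edges of `Φ` are loops. -/
noncomputable def Obs.z (o : Obs Y n a y Φ) :
    ((Y.loops m).functor.obj ⦋2⦌).PtSimplex 2 ((Y.loops m).pt ⦋2⦌) :=
  facePt Φ o.face_eq

/-- The map induced on the homotopy groups of the loop complexes. -/
noncomputable abbrev loopsMap (Y : PtDiagram.{w} SimplexCategory) (m : ℕ)
    {d e : SimplexCategory} (f : d ⟶ e) :
    pi 2 ((Y.loops m).functor.obj d) ((Y.loops m).pt d) →
      pi 2 ((Y.loops m).functor.obj e) ((Y.loops m).pt e) :=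
  piMap 2 ((Y.loops m).functor.map f) ((Y.loops m).map_pt f)

theorem face_map_const {d e : SimplexCategory} (f : d ⟶ e) {T : SSet.{w}}
    {g : T ⟶ (Y.paths n).functor.obj d} (h : g ≫ Y.face n _ = SSet.const ((Y.loops m).pt d)) :
    (g ≫ (Y.paths n).functor.map f) ≫ Y.face n _ = SSet.const ((Y.loops m).pt e) := by
  rw [Category.assoc, face_naturality, reassoc_of% h]
  exact (SSet.const_comp _ _).trans (congrArg _ ((Y.loops m).map_pt _))

theorem loopsMap_facePt {d e : SimplexCategory} (f : d ⟶ e) (g : Δ[2] ⟶ (Y.paths n).functor.obj d)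
    (h : ∀ i, SSet.stdSimplex.δ i ≫ g ≫ Y.face n _ = SSet.const ((Y.loops m).pt _))
    (h' : ∀ i, SSet.stdSimplex.δ i ≫ (g ≫ (Y.paths n).functor.map f) ≫ Y.face n _ =
      SSet.const ((Y.loops m).pt _)) :
    loopsMap Y m f (pi.mk (facePt g h)) = pi.mk (facePt (g ≫ (Y.paths n).functor.map f) h') := by
  refine congrArg pi.mk (ptSimplex_ext ?_)
  change (g ≫ Y.face n _) ≫ (Y.loops m).functor.map f = (g ≫ _) ≫ Y.face n _
  rw [Category.assoc, Category.assoc, face_naturality]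

theorem δ_comp_face_map {d e : SimplexCategory} (f : d ⟶ e) {g : Δ[2] ⟶ (Y.paths n).functor.obj d}
    (h : ∀ i, SSet.stdSimplex.δ i ≫ g ≫ Y.face n _ = SSet.const ((Y.loops m).pt d)) (i : Fin 3) :
    SSet.stdSimplex.δ i ≫ (g ≫ (Y.paths n).functor.map f) ≫ Y.face n _ =
      SSet.const ((Y.loops m).pt e) := by
  rw [← Category.assoc, ← Category.assoc]
  exact face_map_const f ((Category.assoc _ _ _).trans (h i))

/-- The class of the obstruction is a cocycle, since the four cofaces of the triangle of paths are
the faces of a tetrahedron. -/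
theorem Obs.cocycle (o : Obs Y n a y Φ) [SSet.KanComplex (Y.functor.obj ⦋3⦌)] :
    loopsMap Y m (SimplexCategory.δ (3 : Fin 4)) (pi.mk o.z) *
        loopsMap Y m (SimplexCategory.δ (1 : Fin 4)) (pi.mk o.z) =
      loopsMap Y m (SimplexCategory.δ (2 : Fin 4)) (pi.mk o.z) *
        loopsMap Y m (SimplexCategory.δ (0 : Fin 4)) (pi.mk o.z) := by
  rw [Obs.z, loopsMap_facePt _ _ _ (δ_comp_face_map _ o.face_eq),
    loopsMap_facePt _ _ _ (δ_comp_face_map _ o.face_eq),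
    loopsMap_facePt _ _ _ (δ_comp_face_map _ o.face_eq),
    loopsMap_facePt _ _ _ (δ_comp_face_map _ o.face_eq)]
  have key {i j : Fin 3} (h : i ≤ j) : SSet.stdSimplex.δ j ≫ Φ ≫
    (Y.paths n).functor.map (SimplexCategory.δ i.castSucc) =
      SSet.stdSimplex.δ i ≫ Φ ≫ (Y.paths n).functor.map (SimplexCategory.δ j.succ) := by
    have h1 := o.δ_Φ i
    have h2 := o.δ_Φ j
    rw [reassoc_of% h1, reassoc_of% h2]
    exact congrArg (fun q => y ≫ Y.incl n _ ≫ q) (map_δ_comp_δ (Y.paths n).functor h).symm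
  refine mk_face_mul _ _ _ _ (boundaryCompatible_four ?_ ?_ ?_ ?_ ?_ ?_)
  · exact key (i := 0) (j := 0) (by decide)
  · exact key (i := 0) (j := 1) (by decide)
  · exact key (i := 0) (j := 2) (by decide)
  · exact key (i := 1) (j := 1) (by decide)
  · exact key (i := 1) (j := 2) (by decide)
  · exact key (i := 2) (j := 2) (by decide)

variable {a' : Δ[0] ⟶ (Y.loops (m + 1)).functor.obj ⦋0⦌}
  {y' : Δ[1] ⟶ (Y.loops (m + 1)).functor.obj ⦋1⦌} {Φ' : Δ[2] ⟶ (Y.paths n).functor.obj ⦋2⦌}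

/-- The obstruction depends on the homotopy class of `a` only, up to a coboundary. -/
theorem Obs.exists_coboundary [SSet.KanComplex (Y.functor.obj ⦋1⦌)]
    [SSet.KanComplex (Y.functor.obj ⦋2⦌)] (o : Obs Y n a y Φ) (o' : Obs Y n a' y' Φ')
    (h : Δ[1] ⟶ (Y.loops (m + 1)).functor.obj ⦋0⦌) (h1 : SSet.stdSimplex.δ 1 ≫ h = a)
    (h0 : SSet.stdSimplex.δ 0 ≫ h = a') :
    ∃ η, pi.mk o'.z * loopsMap Y m (SimplexCategory.δ (1 : Fin 3)) η =
      pi.mk o.z * loopsMap Y m (SimplexCategory.δ (0 : Fin 3)) η *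
        loopsMap Y m (SimplexCategory.δ (2 : Fin 3)) η := by
  let F (k : Fin 2) := (Y.paths n).functor.map (SimplexCategory.δ k)
  let G (k : Fin 3) := (Y.paths n).functor.map (SimplexCategory.δ k)
  have FG00 : F 0 ≫ G 1 = F 0 ≫ G 0 :=
    map_δ_comp_δ (Y.paths n).functor (i := (0 : Fin 2)) (j := 0) (by decide)
  have FG01 : F 0 ≫ G 2 = F 1 ≫ G 0 :=
    map_δ_comp_δ (Y.paths n).functor (i := (0 : Fin 2)) (j := 1) (by decide)
  have FG11 : F 1 ≫ G 2 = F 1 ≫ G 1 :=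
    map_δ_comp_δ (Y.paths n).functor (i := (1 : Fin 2)) (j := 1) (by decide)
  -- `σ` is a triangle of loops which composes `y` with a coface of `h`; its third edge `e` goes from
  -- a coface of `a` to a coface of `a'`. The edges `x`, `x'` and `hP` are `y`, `y'` and `h` in the paths.
  obtain ⟨σ', hσ2', hσ0'⟩ := exists_triangle_of_horn (a := y)
    (c := h ≫ (Y.loops (m + 1)).functor.map (SimplexCategory.δ (0 : Fin 2)))
    (by rw [reassoc_of% h1, o.δ_y])
  obtain ⟨σ, hσ⟩ : ∃ σ, σ = σ' ≫ Y.incl n ⦋1⦌ := ⟨_, rfl⟩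
  obtain ⟨hP, hhP⟩ : ∃ hP, hP = h ≫ Y.incl n ⦋0⦌ := ⟨_, rfl⟩
  obtain ⟨b, hb⟩ : ∃ b, b = a ≫ Y.incl n ⦋0⦌ := ⟨_, rfl⟩
  obtain ⟨b', hb'⟩ : ∃ b', b' = a' ≫ Y.incl n ⦋0⦌ := ⟨_, rfl⟩
  obtain ⟨x, hx⟩ : ∃ x, x = y ≫ Y.incl n ⦋1⦌ := ⟨_, rfl⟩
  obtain ⟨x', hx'⟩ : ∃ x', x' = y' ≫ Y.incl n ⦋1⦌ := ⟨_, rfl⟩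
  have hP1 : SSet.stdSimplex.δ 1 ≫ hP = b := by rw [hhP, reassoc_of% h1, hb]
  have hP0 : SSet.stdSimplex.δ 0 ≫ hP = b' := by rw [hhP, reassoc_of% h0, hb']
  have hx1 (k : Fin 2) : SSet.stdSimplex.δ k ≫ x = b ≫ F k := by
    have := o.δ_y k
    rw [hx, reassoc_of% this, incl_naturality, hb, Category.assoc]
  have hx1' (k : Fin 2) : SSet.stdSimplex.δ k ≫ x' = b' ≫ F k := by
    have := o'.δ_y k
    rw [hx', reassoc_of% this, incl_naturality, hb', Category.assoc]
  have hΦ (k : Fin 3) : SSet.stdSimplex.δ k ≫ Φ = x ≫ G k := by rw [o.δ_Φ, hx, Category.assoc]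
  have hΦ' (k : Fin 3) : SSet.stdSimplex.δ k ≫ Φ' = x' ≫ G k := by rw [o'.δ_Φ, hx', Category.assoc]
  have hσ2 : SSet.stdSimplex.δ 2 ≫ σ = x := by rw [hσ, reassoc_of% hσ2', hx]
  have hσ0 : SSet.stdSimplex.δ 0 ≫ σ = hP ≫ F 0 := by
    rw [hσ, reassoc_of% hσ0', incl_naturality, hhP, Category.assoc]
  obtain ⟨e, he⟩ : ∃ e, SSet.stdSimplex.δ 1 ≫ σ = e := ⟨_, rfl⟩
  have he0 : SSet.stdSimplex.δ 0 ≫ e = b' ≫ F 0 := by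
    have e0 : SSet.stdSimplex.{w}.δ (0 : Fin 2) ≫ SSet.stdSimplex.δ (1 : Fin 3) =
        SSet.stdSimplex.δ (0 : Fin 2) ≫ SSet.stdSimplex.δ (0 : Fin 3) :=
      SSet.stdSimplex.δ_comp_δ (i := (0 : Fin 2)) (j := 0) le_rfl
    rw [← he, reassoc_of% e0, hσ0, reassoc_of% hP0]
  have he1 : SSet.stdSimplex.δ 1 ≫ e = b ≫ F 1 := by
    have e0 : SSet.stdSimplex.{w}.δ (1 : Fin 2) ≫ SSet.stdSimplex.δ (2 : Fin 3) =
        SSet.stdSimplex.δ (1 : Fin 2) ≫ SSet.stdSimplex.δ (1 : Fin 3) :=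
      SSet.stdSimplex.δ_comp_δ (i := (1 : Fin 2)) (j := 1) le_rfl
    rw [← he, ← reassoc_of% e0, hσ2, hx1]
  -- the triangle `τ` of paths gives the coboundary `η`; `X₁` and `X₂` interpolate between `Φ` and `Φ'`
  obtain ⟨τ, hτ⟩ := exists_paths (n := n) ![x', e, hP ≫ F 1] (boundaryCompatible_three
    (by rw [hx1', he0]) (by rw [hx1', reassoc_of% hP0]) (by rw [he1, reassoc_of% hP1]))
  obtain ⟨X₁, hX₁⟩ := exists_paths (n := n) ![e ≫ G 0, e ≫ G 1, x ≫ G 2] (boundaryCompatible_three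
    (by simp only [reassoc_of% he0, FG00])
      (by simp only [reassoc_of% he1, reassoc_of% (hx1 0), FG01])
    (by simp only [reassoc_of% he1, reassoc_of% (hx1 1), FG11]))
  obtain ⟨X₂, hX₂⟩ := exists_paths (n := n) ![x' ≫ G 0, e ≫ G 1, e ≫ G 2] (boundaryCompatible_three
    (by simp only [reassoc_of% he0, reassoc_of% (hx1' 0), FG00])
    (by simp only [reassoc_of% he0, reassoc_of% (hx1' 1), FG01])
    (by simp only [reassoc_of% he1, FG11]))
  have hτ2 : SSet.stdSimplex.δ 2 ≫ τ = hP ≫ F 1 := hτ 2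
  have hτ1 : SSet.stdSimplex.δ 1 ≫ τ = e := hτ 1
  have hτ0 : SSet.stdSimplex.δ 0 ≫ τ = x' := hτ 0
  have X12 : SSet.stdSimplex.δ 2 ≫ X₁ = x ≫ G 2 := hX₁ 2
  have X11 : SSet.stdSimplex.δ 1 ≫ X₁ = e ≫ G 1 := hX₁ 1
  have X10 : SSet.stdSimplex.δ 0 ≫ X₁ = e ≫ G 0 := hX₁ 0
  have X22 : SSet.stdSimplex.δ 2 ≫ X₂ = e ≫ G 2 := hX₂ 2
  have X21 : SSet.stdSimplex.δ 1 ≫ X₂ = e ≫ G 1 := hX₂ 1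
  have X20 : SSet.stdSimplex.δ 0 ≫ X₂ = x' ≫ G 0 := hX₂ 0
  have fσ : σ ≫ Y.face n _ = SSet.const ((Y.loops m).pt ⦋1⦌) := by
    rw [hσ, Category.assoc]; exact incl_face σ'
  have fe : e ≫ Y.face n _ = SSet.const ((Y.loops m).pt ⦋1⦌) := by
    rw [← he, Category.assoc, fσ, SSet.comp_const]
  have fx : x ≫ Y.face n _ = SSet.const ((Y.loops m).pt ⦋1⦌) := by
    rw [hx, Category.assoc]; exact incl_face y
  have fx' : x' ≫ Y.face n _ = SSet.const ((Y.loops m).pt ⦋1⦌) := by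
    rw [hx', Category.assoc]; exact incl_face y'
  have fh : hP ≫ Y.face n _ = SSet.const ((Y.loops m).pt ⦋0⦌) := by
    rw [hhP, Category.assoc]; exact incl_face h
  have fτ (i : Fin 3) : SSet.stdSimplex.δ i ≫ τ ≫ Y.face n _ = SSet.const ((Y.loops m).pt ⦋1⦌) := by
    rw [← Category.assoc, hτ]
    fin_cases i
    · exact fx'
    · exact fe
    · exact face_map_const _ fh
  have fX₁ (i : Fin 3) : SSet.stdSimplex.δ i ≫ X₁ ≫ Y.face n _ = SSet.const ((Y.loops m).pt ⦋2⦌) := by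
    rw [← Category.assoc, hX₁]
    fin_cases i
    · exact face_map_const _ fe
    · exact face_map_const _ fe
    · exact face_map_const _ fx
  have fX₂ (i : Fin 3) : SSet.stdSimplex.δ i ≫ X₂ ≫ Y.face n _ = SSet.const ((Y.loops m).pt ⦋2⦌) := by
    rw [← Category.assoc, hX₂]
    fin_cases i
    · exact face_map_const _ fx'
    · exact face_map_const _ fe
    · exact face_map_const _ fe
  have fσ' (i : Fin 3) : SSet.stdSimplex.δ i ≫ σ ≫ Y.face n _ = SSet.const ((Y.loops m).pt ⦋1⦌) := by
    rw [fσ, SSet.comp_const]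
  -- `σ` consists of loops, so that its cofaces do not contribute
  have fG (k : Fin 3) : pi.mk (facePt (σ ≫ G k) (δ_comp_face_map _ fσ')) = 1 :=
    congrArg pi.mk (ptSimplex_ext (face_map_const _ fσ))
  -- the tetrahedra which relate `Φ` to `X₁`, then `X₁` to `X₂`, then `X₂` to `Φ'`
  have t1 := mk_face_mul (a := Φ) (b := X₁) (c := σ ≫ G 1) (d := σ ≫ G 0) o.face_eq fX₁
    (δ_comp_face_map _ fσ') (δ_comp_face_map _ fσ') (boundaryCompatible_four
      (by simp only [reassoc_of% hσ0, FG00]) (by rw [reassoc_of% he, X10])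
      (by rw [reassoc_of% hσ2, hΦ]) (by rw [reassoc_of% he, X11])
      (by rw [reassoc_of% hσ2, hΦ]) (by rw [X12, hΦ]))
  have t2 := mk_face_mul (a := σ ≫ G 2) (b := X₁) (c := X₂) (d := τ ≫ G 0) (δ_comp_face_map _ fσ')
    fX₁
    fX₂ (δ_comp_face_map _ fτ) (boundaryCompatible_four
      (by rw [reassoc_of% hτ0, X20]) (by rw [reassoc_of% hτ1, X10])
      (by simp only [reassoc_of% hσ0, reassoc_of% hτ2, FG01]) (by rw [X21, X11])
      (by rw [reassoc_of% he, X22]) (by rw [reassoc_of% hσ2, X12]))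
  have t3 := mk_face_mul (a := τ ≫ G 2) (b := τ ≫ G 1) (c := X₂) (d := Φ') (δ_comp_face_map _ fτ)
    (δ_comp_face_map _ fτ) fX₂ o'.face_eq (boundaryCompatible_four
      (by rw [X20, hΦ']) (by rw [reassoc_of% hτ0, hΦ'])
      (by rw [reassoc_of% hτ0, hΦ']) (by rw [reassoc_of% hτ1, X21])
      (by rw [reassoc_of% hτ1, X22]) (by simp only [reassoc_of% hτ2, FG11]))
  rw [fG, fG, mul_one, mul_one] at t1
  rw [fG, one_mul] at t2
  refine ⟨pi.mk (facePt τ fτ), ?_⟩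
  rw [loopsMap_facePt _ _ _ (δ_comp_face_map _ fτ), loopsMap_facePt _ _ _ (δ_comp_face_map _ fτ),
    loopsMap_facePt _ _ _ (δ_comp_face_map _ fτ)]
  have t4 : pi.mk (facePt Φ' o'.face_eq) * pi.mk (facePt (τ ≫ G 1) (δ_comp_face_map _ fτ)) =
      pi.mk (facePt Φ o.face_eq) * pi.mk (facePt (τ ≫ G 0) (δ_comp_face_map _ fτ)) *
        pi.mk (facePt (τ ≫ G 2) (δ_comp_face_map _ fτ)) := by
    rw [mul_comm, ← t3, t2, t1, mul_comm]
  exact t4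

end

end obs

/-! ### Simplices with three consecutive nontrivial faces -/

section shift

variable {X : SSet.{w}} {x : X _⦋0⦌} {n : ℕ}

/-- The sequence of simplices shifted by `r`, preceded by constant simplices. -/
def shift (r : ℕ) (v : ℕ → X.PtSimplex n x) : ℕ → X.PtSimplex n x :=
  fun i => if r ≤ i then v (i - r) else cst

theorem shift_zero (v : ℕ → X.PtSimplex n x) : shift 0 v = v := rfl

theorem shift_seq_cons (r : ℕ) (l : List (X.PtSimplex n x)) :
    shift r (seq (cst :: l)) = shift (r + 1) (seq l) := by
  funext i
  simp only [shift]
  rcases lt_trichotomy i r with h | rfl | h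
  · rw [if_neg (by omega), if_neg (by omega)]
  · rw [if_pos le_rfl, if_neg (by omega), Nat.sub_self]
    rfl
  · rw [if_pos h.le, if_pos (by omega)]
    obtain ⟨j, rfl⟩ : ∃ j, i = j + r + 1 := ⟨i - r - 1, by omega⟩
    rw [show j + r + 1 - r = j + 1 by omega, show j + r + 1 - (r + 1) = j by omega]
    rfl

theorem isBd_shift_diag (r j : ℕ) (hr : r + j ≤ n) (f : X.PtSimplex n x) :
    IsBd (shift r (seq (List.replicate j cst ++ [f, f]))) := by
  convert isBd_deg f (r + j) hr using 1
  induction r generalizing j with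
  | zero => rw [shift_zero, Nat.zero_add]
  | succ r ih =>
    rw [← shift_seq_cons, ← List.cons_append, ← List.replicate_succ, ih _ (by omega)]
    rw [show r + (j + 1) = r + 1 + j by omega]

theorem shift_diag4'' (hr : r ≤ n) (a : X.PtSimplex (n + 2) x) :
    IsBd (shift r (seq [cst, cst, a, a])) :=
  isBd_shift_diag r 2 (by omega) a

variable [SSet.KanComplex X]

theorem isBd_shift_row (r : ℕ) (F : ℕ → ℕ → X.PtSimplex n x) (k : ℕ) (hk : r + k ≤ n + 2)
    (h : ∀ l, l ≠ k → IsBd (shift r (row F l))) : IsBd (shift r (row F k)) := by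
  let F' : ℕ → ℕ → X.PtSimplex n x := fun i j => if r ≤ i ∧ r ≤ j then F (i - r) (j - r) else cst
  have h1 (l : ℕ) : row F' (r + l) = shift r (row F l) := by
    funext i
    simp only [row, F', shift]
    by_cases hi : r ≤ i
    · rw [if_pos hi]
      by_cases hil : i < r + l
      · rw [if_pos hil, if_pos ⟨hi, by omega⟩, if_pos (by omega), Nat.add_sub_cancel_left]
      · rw [if_neg hil, if_pos ⟨by omega, by omega⟩, if_neg (by omega), Nat.add_sub_cancel_left]
        congr 1
        omega
    · rw [if_pos (by omega), if_neg (by omega), if_neg hi]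
  have h2 (l : ℕ) (hl : l < r) : row F' l = seq [] := by
    funext i
    simp only [row, F']
    split_ifs <;> first | rfl | omega
  rw [← h1]
  refine isBd_row F' _ hk fun l hl => ?_
  by_cases hlr : l < r
  · rw [h2 l hlr]
    exact isBd_one
  · obtain ⟨l, rfl⟩ := Nat.exists_eq_add_of_le (not_lt.1 hlr)
    rw [h1]
    exact h l fun e => hl (by rw [e])

theorem isBd_shift_five (r : ℕ)
    (x01 x02 x03 x04 x12 x13 x14 x23 x24 x34 : X.PtSimplex (n + 2) x) (k : ℕ) (hk : k < 5)
    (hr : r ≤ n)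
    (h0 : k ≠ 0 → IsBd (shift r (seq [x01, x02, x03, x04])))
    (h1 : k ≠ 1 → IsBd (shift r (seq [x01, x12, x13, x14])))
    (h2 : k ≠ 2 → IsBd (shift r (seq [x02, x12, x23, x24])))
    (h3 : k ≠ 3 → IsBd (shift r (seq [x03, x13, x23, x34])))
    (h4 : k ≠ 4 → IsBd (shift r (seq [x04, x14, x24, x34]))) :
    IsBd (shift r (row (table5 x01 x02 x03 x04 x12 x13 x14 x23 x24 x34) k)) := by
  refine isBd_shift_row r _ k (by omega) fun l hl => ?_
  rcases l with _ | _ | _ | _ | _ | l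
  · convert h0 hl.symm using 2
    funext i; rcases i with _ | _ | _ | _ | i <;> rfl
  · convert h1 hl.symm using 2
    funext i; rcases i with _ | _ | _ | _ | i <;> rfl
  · convert h2 hl.symm using 2
    funext i; rcases i with _ | _ | _ | _ | i <;> rfl
  · convert h3 hl.symm using 2
    funext i; rcases i with _ | _ | _ | _ | i <;> simp [row, table5, seq]
  · convert h4 hl.symm using 2
    funext i; rcases i with _ | _ | _ | _ | i <;> simp [row, table5, seq]
  · convert isBd_one (X := X) (x := x) using 1
    funext i
    simp only [shift]
    split_ifs
    · generalize i - r = i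
      rcases i with _ | _ | _ | _ | i <;> simp [row, table5, seq]
    · rfl

variable {a b c s t u p q : X.PtSimplex (n + 2) x} {r : ℕ}

theorem shift_seq_append (r : ℕ) (l : List (X.PtSimplex n x)) :
    shift r (seq (l ++ [cst])) = shift r (seq l) := by rw [seq_snoc_one]

theorem shift_diag4 (hr : r ≤ n) (a : X.PtSimplex (n + 2) x) :
    IsBd (shift r (seq [a, a, cst, cst])) := by
  have := isBd_shift_diag r 0 (by omega) a
  rwa [← shift_seq_append, ← shift_seq_append] at this

theorem shift_diag4' (hr : r ≤ n) (a : X.PtSimplex (n + 2) x) :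
    IsBd (shift r (seq [cst, a, a, cst])) := by
  have := isBd_shift_diag r 1 (by omega) a
  rwa [← shift_seq_append] at this

theorem isBd_shift_glue (hr : r ≤ n) (h : IsBd (shift r (seq [u, t, p, cst])))
    (h' : IsBd (shift r (seq [cst, q, t, s]))) : IsBd (shift r (seq [u, q, p, s])) := by
  have := isBd_shift_five r cst u u cst q t s p s cst 2 (by omega) hr (fun _ => shift_diag4' hr u)
    (fun _ => h') (by simp) (fun _ => h) (fun _ => shift_diag4' hr s)
  convert this using 2
  funext i; rcases i with _ | _ | _ | _ | i <;> rfl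

theorem isBd_shift_unglue (hr : r ≤ n) (h : IsBd (shift r (seq [u, q, p, s])))
    (h' : IsBd (shift r (seq [cst, q, t, s]))) : IsBd (shift r (seq [u, t, p, cst])) := by
  have := isBd_shift_five r cst u u cst q t s p s cst 3 (by omega) hr (fun _ => shift_diag4' hr u)
    (fun _ => h') (fun _ => h) (by simp) (fun _ => shift_diag4' hr s)
  convert this using 2
  funext i; rcases i with _ | _ | _ | _ | i <;> simp [row, table5, seq]

theorem shift_diag_outer (hr : r ≤ n) (f : X.PtSimplex (n + 2) x) :
    IsBd (shift r (seq [f, cst, cst, f])) :=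
  isBd_shift_glue hr (shift_diag4 hr f) (shift_diag4'' hr f)

theorem isBd_shift_rotate {s : X.PtSimplex (n + 2) x} (hr : r ≤ n)
    (h : IsBd (shift r (seq [s, q, cst, p]))) :
    IsBd (shift r (seq [q, cst, p, s])) := by
  have := isBd_shift_five r q cst p s cst cst q cst cst p 0 (by omega) hr (by simp)
    (fun _ => shift_diag_outer hr q) (fun _ => shift_diag4 hr cst) (fun _ => shift_diag_outer hr p)
      (fun _ => h)
  convert this using 2
  funext i; rcases i with _ | _ | _ | _ | i <;> rfl

/-- Three consecutive nontrivial faces can be moved by one position. -/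
theorem isBd_shift_of_succ (hr : r ≤ n) (h : IsBd (shift (r + 1) (seq [q, t, s]))) :
    IsBd (shift r (seq [q, t, s])) := by
  rw [← shift_seq_cons] at h
  have h3 : IsBd (shift r (seq [t, q, cst, s])) := isBd_shift_glue hr (shift_diag4 hr t) h
  have h4 : IsBd (shift r (seq [q, cst, s, t])) := isBd_shift_rotate hr h3
  have := isBd_shift_unglue hr h4 (shift_diag4'' hr t)
  rwa [← shift_seq_append]

/-- The relation between the faces of a simplex with three consecutive nontrivial faces does not
depend on their position. -/
theorem mk_mul_of_isBd_shift {n : ℕ} {q t s : X.PtSimplex (n + 1) x} (hr : r ≤ n)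
    (h : IsBd (shift r (seq [q, t, s]))) : pi.mk q * pi.mk s = pi.mk t := by
  rw [pi.mk_mul_mk]
  induction r with
  | zero => exact h
  | succ r ih =>
    obtain ⟨n, rfl⟩ : ∃ n', n = n' + 1 := ⟨n - 1, by omega⟩
    exact ih (by omega) (isBd_shift_of_succ (by omega) h)

end shift

/-! ### Turning paths around -/

section flip

variable {m : ℕ} {K : SSet.{w}} {k : K _⦋0⦌} {T : SSet.{w}}

/-- A map on `Δ[m] ⊗ T` which is trivial on `∂Δ[m] ⊗ T` is trivial on each simplex of `Δ[m]` which
misses a vertex. -/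
theorem map_whiskerRight_un_of_ne {p : ℕ} (u : ⦋p⦌ ⟶ ⦋m⦌) (v : Fin (m + 1)) (hv : ∀ x, u x ≠ v)
    (z : T ⟶ loops m K k) : SSet.stdSimplex.map u ▷ T ≫ relHom.un z = SSet.const k := by
  have : SSet.Subcomplex.range (SSet.stdSimplex.{w}.map u) ≤
    (∂Δ[m] : (Δ[m] : SSet.{w}).Subcomplex) := by
    rintro d _ ⟨y, rfl⟩ hs
    obtain ⟨i, hi⟩ := hs v
    exact hv _ hi
  have e : SSet.stdSimplex.{w}.map u = SSet.Subcomplex.lift _ this ≫ SSet.Subcomplex.ι _ := rfl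
  rw [e, comp_whiskerRight_assoc, relHom.whiskerRight_un, SSet.comp_const]

variable {n : Fin (m + 1)}

/-- The faces, other than the one of index `n`, of the `(m + 2)`-simplex which turns the path `θ`
around. -/
noncomputable def flipFace (θ : T ⟶ paths n.succ K k) (j : Fin (m + 3)) :
    (Δ[m + 1] : SSet.{w}) ⊗ T ⟶ K :=
  if (j : ℕ) = n + 2 then relHom.un θ
  else if (j : ℕ) = n + 1 then SSet.stdSimplex.σ n ▷ T ≫ relHom.un (θ ≫ face _ K k)
  else SSet.const k

theorem comp_flipFace {S : SSet.{w}} (f : S ⟶ T) (θ : T ⟶ paths n.succ K k) (j : Fin (m + 3)) :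
    flipFace (f ≫ θ) j = _ ◁ f ≫ flipFace θ j := by
  dsimp only [flipFace]
  split_ifs
  · rw [relHom.un_comp]
  · rw [Category.assoc, relHom.un_comp, whisker_exchange_assoc]
  · rw [SSet.comp_const]

theorem δ_flipFace_two (θ : T ⟶ paths n.succ K k) (j : Fin (m + 3)) (hj : (j : ℕ) = n + 2)
    (i : Fin (m + 2)) : SSet.stdSimplex.δ i ▷ T ≫ flipFace θ j =
      if (i : ℕ) = n + 1 then relHom.un (θ ≫ face _ K k) else SSet.const k := by
  rw [flipFace, if_pos hj]
  split_ifs with hi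
  · obtain rfl : i = n.succ := Fin.ext hi
    rw [un_comp_face]
  · exact δ_whiskerRight_un_horn θ i fun e => hi (congrArg Fin.val e)

theorem δ_flipFace_one (θ : T ⟶ paths n.succ K k) (j : Fin (m + 3)) (hj : (j : ℕ) = n + 1)
    (i : Fin (m + 2)) : SSet.stdSimplex.δ i ▷ T ≫ flipFace θ j =
      if (i : ℕ) = n ∨ (i : ℕ) = n + 1 then relHom.un (θ ≫ face _ K k) else SSet.const k := by
  rw [flipFace, if_neg (by omega), if_pos hj, ← comp_whiskerRight_assoc]
  split_ifs with hi
  · have : SSet.stdSimplex.{w}.δ i ≫ SSet.stdSimplex.σ n = 𝟙 _ := by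
      obtain hi | hi := hi
      · obtain rfl : i = n.castSucc := Fin.ext hi
        exact SSet.stdSimplex.δ_comp_σ_self
      · obtain rfl : i = n.succ := Fin.ext hi
        exact SSet.stdSimplex.δ_comp_σ_succ
    rw [this, id_whiskerRight, Category.id_comp]
  · rw [not_or] at hi
    have e : SSet.stdSimplex.{w}.δ i ≫ SSet.stdSimplex.σ n =
      SSet.stdSimplex.map (SimplexCategory.δ i ≫ SimplexCategory.σ n) :=
      (CategoryTheory.Functor.map_comp _ _ _).symm
    rw [e]
    have hil := i.2
    refine map_whiskerRight_un_of_ne _ ⟨if (i : ℕ) < n then i else i - 1, by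
      have := n.2; split_ifs <;> omega⟩ (fun (x : Fin (m + 1)) h => ?_) _
    have h' : ((n.predAbove (i.succAbove x) : Fin (m + 1)) : ℕ) =
      if (i : ℕ) < n then (i : ℕ) else i - 1 :=
      congrArg Fin.val h
    have key : ∀ y : Fin (m + 2), ((n.predAbove y : Fin (m + 1)) : ℕ) =
      if (n : ℕ) < y then (y : ℕ) - 1 else y := by
      intro y
      simp only [Fin.predAbove, Fin.lt_def, Fin.val_castSucc]
      split_ifs <;> simp
    rw [key, val_succAbove] at h'
    split_ifs at h' <;> omega

theorem δ_flipFace_const (θ : T ⟶ paths n.succ K k) (j : Fin (m + 3)) (hj : (j : ℕ) ≠ n + 2)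
    (hj' : (j : ℕ) ≠ n + 1) (i : Fin (m + 2)) :
    SSet.stdSimplex.δ i ▷ T ≫ flipFace θ j = SSet.const k := by
  rw [flipFace, if_neg hj, if_neg hj', SSet.comp_const]

/-- The `(m + 2)`-simplices `V` (parametrized by `T`) which turn around the paths `θ` relative to
`Λ[m + 1, n + 1]`: the face of index `n + 2` is `θ`, the face of index `n + 1` is a degeneracy of
the end of `θ`, and all the others, except the one of index `n`, are trivial. The face of index `n`
is then a path relative to `Λ[m + 1, n]` with the same end as `θ`. -/
def IsFlip (θ : T ⟶ paths n.succ K k) (V : (Δ[m + 2] : SSet.{w}) ⊗ T ⟶ K) : Prop :=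
  ∀ j : Fin (m + 3), (j : ℕ) ≠ n → SSet.stdSimplex.δ j ▷ T ≫ V = flipFace θ j

theorem IsFlip.map {θ : T ⟶ paths n.succ K k} {V : (Δ[m + 2] : SSet.{w}) ⊗ T ⟶ K} (hV : IsFlip θ V)
    {L : SSet.{w}} {l : L _⦋0⦌} (f : K ⟶ L) (hf : f.app _ k = l) :
    IsFlip (θ ≫ relHom.map _ f hf) (V ≫ f) := fun j hj => by
  rw [← Category.assoc, hV j hj]
  dsimp only [flipFace]
  split_ifs
  · rw [relHom.un_comp_map]
  · rw [Category.assoc, un_comp_face, un_comp_face, relHom.un_comp_map]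
    simp only [Category.assoc]
  · rw [SSet.const_comp, hf]

/-- A partially defined turning simplex extends, by filling the horn of index `n`. -/
theorem exists_isFlip [SSet.KanComplex K] {S : T.Subcomplex} (θ : T ⟶ paths n.succ K k)
    (V₀ : (Δ[m + 2] : SSet.{w}) ⊗ (S : SSet) ⟶ K) (h : IsFlip (S.ι ≫ θ) V₀) :
    ∃ V, IsFlip θ V ∧ _ ◁ S.ι ≫ V = V₀ := by
  let q : Fin (m + 3) := n.castSucc.castSucc
  have hq (j : Fin (m + 3)) (hj : j ≠ q) : (j : ℕ) ≠ n := fun e => hj (Fin.ext e)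
  obtain ⟨G, hG⟩ := exists_horn_desc_tensor (i := q) (fun j _ => flipFace θ j) (by
    rw [SSet.horn.isCompatible_iff]
    intro a b ha hb hab
    have hab' : (a : ℕ) < b := hab
    have ha' := hq a ha
    have hb' := hq b hb
    simp only [comp_curry_braiding]
    congr 2
    by_cases a1 : (a : ℕ) = n + 1
    · rw [δ_flipFace_one θ a a1]
      by_cases b2 : (b : ℕ) = n + 2
      · rw [δ_flipFace_two θ b b2, if_pos (by simp only [Fin.val_pred]; omega),
          if_pos (by simp only [Fin.coe_castPred]; omega)]
      · rw [δ_flipFace_const θ b b2 (by omega), if_neg (by simp only [Fin.val_pred]; omega)]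
    · by_cases a2 : (a : ℕ) = n + 2
      · rw [δ_flipFace_two θ a a2, δ_flipFace_const θ b (by omega) (by omega),
          if_neg (by simp only [Fin.val_pred]; omega)]
      · rw [δ_flipFace_const θ a a2 a1]
        by_cases b2 : (b : ℕ) = n + 2
        · rw [δ_flipFace_two θ b b2, if_neg (by simp only [Fin.coe_castPred]; omega)]
        · by_cases b1 : (b : ℕ) = n + 1
          · rw [δ_flipFace_one θ b b1, if_neg (by simp only [Fin.coe_castPred]; omega)]
          · rw [δ_flipFace_const θ b b2 b1])
  obtain ⟨V, h1, h2⟩ := exists_extension_tensor (.inl (SSet.anodyneExtensions.horn_ι q)) V₀ G (by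
    refine horn_tensor_hom_ext fun j hj => ?_
    rw [← comp_whiskerRight_assoc, SSet.horn.ι_ι, ← whisker_exchange_assoc, hG, h j (hq j hj),
      comp_flipFace])
  refine ⟨V, fun j hj => ?_, h1⟩
  have hj' : j ≠ q := fun e => hj (congrArg Fin.val e)
  rw [← hG j hj', ← h2, ← comp_whiskerRight_assoc, SSet.horn.ι_ι]

/-- The face of index `n` of a turning simplex is a path with the same end. -/
theorem exists_flip {θ : T ⟶ paths n.succ K k} {V : (Δ[m + 2] : SSet.{w}) ⊗ T ⟶ K}
    (hV : IsFlip θ V) :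
    ∃ θ' : T ⟶ paths n.castSucc K k,
      relHom.un θ' = SSet.stdSimplex.δ n.castSucc.castSucc ▷ T ≫ V ∧
      θ' ≫ face _ K k = θ ≫ face _ K k := by
  have hl (i : Fin (m + 2)) (j' : Fin (m + 3)) (i' : Fin (m + 2)) (hj' : (j' : ℕ) ≠ n)
      (e : SSet.stdSimplex.{w}.δ i ≫ SSet.stdSimplex.δ n.castSucc.castSucc =
        SSet.stdSimplex.δ i' ≫ SSet.stdSimplex.δ j') :
      SSet.stdSimplex.δ i ▷ T ≫ SSet.stdSimplex.δ n.castSucc.castSucc ▷ T ≫ V =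
        SSet.stdSimplex.δ i' ▷ T ≫ flipFace θ j' := by
    rw [← comp_whiskerRight_assoc, e, comp_whiskerRight_assoc, hV j' hj']
  refine ⟨relHom.mk (SSet.stdSimplex.δ n.castSucc.castSucc ▷ T ≫ V)
    (horn_tensor_hom_ext fun i hi => ?_), relHom.un_mk _ _, relHom.un_injective ?_⟩
  · have hi' : (i : ℕ) ≠ n := fun e => hi (Fin.ext e)
    rw [← comp_whiskerRight_assoc, SSet.horn.ι_ι, SSet.comp_const]
    by_cases hin : (i : ℕ) < n
    · obtain ⟨r, hr⟩ : ∃ r : Fin (m + 1), n.castSucc = r.succ :=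
        Fin.eq_succ_of_ne_zero (Fin.ne_zero_of_lt (a := i) hin)
      have hr' : (n : ℕ) = r + 1 := by simpa using congrArg Fin.val hr
      rw [hl i i.castSucc r.castSucc hi' (by
        rw [hr]
        exact SSet.stdSimplex.δ_comp_δ (i := i) (j := r.castSucc)
          (by rw [Fin.le_def]; simp; omega))]
      exact δ_flipFace_const _ _ (by simp; omega) (by simp; omega) _
    · rw [hl i i.succ n.castSucc
        (by simp; omega) (SSet.stdSimplex.δ_comp_δ (i := n.castSucc) (j := i)
        (by rw [Fin.le_def]; simp; omega)).symm]
      by_cases h1 : (i : ℕ) = n + 1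
      · rw [δ_flipFace_two _ _ (by simp; omega), if_neg (by simp)]
      · exact δ_flipFace_const _ _ (by simp; omega) (by simp; omega) _
  · rw [un_comp_face, relHom.un_mk, hl n.castSucc n.castSucc.succ n.castSucc (by simp)
      (SSet.stdSimplex.δ_comp_δ (i := n.castSucc) (j := n.castSucc) le_rfl).symm,
      δ_flipFace_one _ _ (by simp), if_pos (by simp)]

end flip

/-! ### Vertices of the loop complex -/

section vertex

variable {m : ℕ} {K : SSet.{w}} {k : K _⦋0⦌}

/-- The vertex of the loop complex given by a simplex with trivial boundary. -/
noncomputable def vertex (g : K.PtSimplex m k) : Δ[0] ⟶ loops m K k :=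
  relHom.mk (tens0 g.map) (by
    rw [tens0, CartesianMonoidalCategory.whiskerRight_fst_assoc, ptSimplex_comm, SSet.comp_const])

theorem un_vertex (g : K.PtSimplex m k) : relHom.un (vertex g) = tens0 g.map := relHom.un_mk _ _

theorem exists_vertex (a : Δ[0] ⟶ loops m K k) : ∃ g, a = vertex g := by
  obtain ⟨g, hg⟩ := exists_tens0 (relHom.un a)
  have hb : (∂Δ[m] : (Δ[m] : SSet.{w}).Subcomplex).ι ≫ g = SSet.const k := by
    refine tens0_injective ?_
    have := relHom.whiskerRight_un a
    rw [hg, tens0, CartesianMonoidalCategory.whiskerRight_fst_assoc] at this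
    exact this.trans (SSet.comp_const _ _).symm
  exact ⟨ptMk g hb, relHom.un_injective (hg.trans (un_vertex (ptMk g hb)).symm)⟩

end vertex

/-! ### Existence of turning simplices -/

section flip

variable {m : ℕ} {K : SSet.{w}} {k : K _⦋0⦌} [SSet.KanComplex K] {n : Fin (m + 1)}

/-- Compatible turning simplices for the faces of `θ` extend to one for `θ`. -/
theorem exists_isFlip_of_boundary {s : ℕ} (θ : Δ[s + 1] ⟶ paths n.succ K k)
    (F : Fin (s + 2) → ((Δ[m + 2] : SSet.{w}) ⊗ (Δ[s] : SSet.{w}) ⟶ K))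
    (hF : BoundaryCompatible fun i => MonoidalClosed.curry (F i))
    (h : ∀ i, IsFlip (SSet.stdSimplex.δ i ≫ θ) (F i)) :
    ∃ V, IsFlip θ V ∧ ∀ i, Δ[m + 2] ◁ SSet.stdSimplex.δ i ≫ V = F i := by
  obtain ⟨V₀, hV₀⟩ := exists_tensor_desc F hF
  obtain ⟨V, hV, e⟩ := exists_isFlip θ V₀ (fun j hj => tensor_boundary_hom_ext fun i => by
    have h1 := h i j hj
    rw [← hV₀] at h1
    rw [whisker_exchange_assoc, h1, ← comp_flipFace, SSet.boundary.ι_ι_assoc])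
  refine ⟨V, hV, fun i => ?_⟩
  rw [← hV₀, ← e, ← whiskerLeft_comp_assoc, SSet.boundary.ι_ι]

theorem exists_isFlip_vertex (θ : Δ[0] ⟶ paths n.succ K k) : ∃ V, IsFlip θ V := by
  have hi : IsInitial ((∂Δ[0] : (Δ[0] : SSet.{w}).Subcomplex) : SSet) := by
    rw [SSet.boundary_zero]; exact SSet.Subcomplex.isInitialBot
  obtain ⟨V, hV, -⟩ := exists_isFlip (S := (∂Δ[0] : (Δ[0] : SSet.{w}).Subcomplex)) θ (SSet.const k)
    (fun j hj => MonoidalClosed.curry_injective (hi.hom_ext _ _))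
  exact ⟨V, hV⟩

/-- Turning a loop around inverts its class. -/
theorem IsFlip.mk_mul_mk {g g' : K.PtSimplex (m + 1) k}
    {V : (Δ[m + 2] : SSet.{w}) ⊗ (Δ[0] : SSet.{w}) ⟶ K}
    (hV : IsFlip (vertex g ≫ incl n.succ K k) V)
    (hg' : SSet.stdSimplex.δ n.castSucc.castSucc ▷ Δ[0] ≫ V = tens0 g'.map) :
    pi.mk g * pi.mk g' = 1 := by
  obtain ⟨W, rfl⟩ := exists_tens0 V
  have hn := n.2
  refine mk_mul_of_isBd_shift (r := m - n) (t := cst) (Nat.sub_le _ _) ⟨W, fun j => ?_⟩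
  have hjl := j.2
  have hW (i : Fin (m + 3)) (f : Δ[m + 1] ⟶ K) (h : SSet.stdSimplex.δ i ▷ Δ[0] ≫ tens0 W =
    tens0 f) :
      SSet.stdSimplex.δ i ≫ W = f := tens0_injective (by
    rw [← h, tens0, tens0, CartesianMonoidalCategory.whiskerRight_fst_assoc])
  refine hW _ _ ?_
  simp only [shift]
  by_cases h0 : (j : ℕ) = n
  · obtain rfl : j = n.castSucc.castSucc := Fin.ext h0
    rw [hg', if_pos (by simp; omega)]
    have : m + 1 + 1 - (n : ℕ) - (m - n) = 2 := by omega
    simp [seq, this]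
  · rw [hV j h0, flipFace]
    by_cases h2 : (j : ℕ) = n + 2
    · rw [if_pos h2, un_comp_incl, un_vertex, if_pos (by omega)]
      have : m + 1 + 1 - (j : ℕ) - (m - n) = 0 := by omega
      simp [seq, this]
    · rw [if_neg h2]
      have e : SSet.const k = tens0 (T := Δ[m + 1]) (cst : K.PtSimplex (m + 1) k).map :=
        (SSet.comp_const _ _).symm
      have e1 : relHom.un ((vertex g ≫ incl n.succ K k) ≫ face n.succ K k) = SSet.const k := by
        rw [Category.assoc, incl_face, relHom.un_const]
      rw [e1, SSet.comp_const, ite_self, e]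
      congr 2
      by_cases hj : (j : ℕ) < n + 2
      · rw [if_pos (by omega)]
        rcases (show m + 1 + 1 - (j : ℕ) - (m - n) = 1 ∨ 3 ≤ m + 1 + 1 - (j : ℕ) - (m - n) by omega)
          with h | h
        · simp [seq, h]
        · obtain ⟨q, hq⟩ := Nat.exists_eq_add_of_le' h
          simp [seq, hq]
      · rw [if_neg (by omega)]

end flip

/-! ### The dependence of the obstruction on the horn -/

section obs

variable {Y : PtDiagram.{w} SimplexCategory} {m : ℕ}

theorem exists_obs [SSet.KanComplex (Y.functor.obj ⦋2⦌)] (n : Fin (m + 2))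
    {a : Δ[0] ⟶ (Y.loops (m + 1)).functor.obj ⦋0⦌} {y : Δ[1] ⟶ (Y.loops (m + 1)).functor.obj ⦋1⦌}
    (hy : ∀ k : Fin 2, SSet.stdSimplex.δ k ≫ y =
      a ≫ (Y.loops (m + 1)).functor.map (SimplexCategory.δ k)) : ∃ Φ, Obs Y n a y Φ := by
  let f (k : Fin 3) := y ≫ Y.incl n _ ≫ (Y.paths n).functor.map (SimplexCategory.δ k)
  have key {i j : Fin 2} (h : i ≤ j) : SSet.stdSimplex.δ i ≫ f j.succ =
      SSet.stdSimplex.δ j ≫ f i.castSucc := by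
    have h1 := hy i
    have h2 := hy j
    dsimp only [f]
    rw [reassoc_of% h1, reassoc_of% h2, reassoc_of% (incl_naturality (Y := Y) (n := n)),
      reassoc_of% (incl_naturality (Y := Y) (n := n))]
    exact congrArg (fun q => a ≫ Y.incl n _ ≫ q) (map_δ_comp_δ (Y.paths n).functor h)
  obtain ⟨Φ, hΦ⟩ := exists_paths (n := n) ![f 0, f 1, f 2] (boundaryCompatible_three
    (key (i := 0) (j := 0) (by decide)).symm (key (i := 0) (j := 1) (by decide)).symm
    (key (i := 1) (j := 1) (by decide)).symm)
  refine ⟨Φ, hy, fun k => ?_⟩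
  rw [hΦ]
  fin_cases k <;> rfl

variable [SSet.KanComplex (Y.functor.obj ⦋0⦌)] [SSet.KanComplex (Y.functor.obj ⦋1⦌)]
  [SSet.KanComplex (Y.functor.obj ⦋2⦌)]

/-- The obstruction for a path relative to the horn of index `n + 1` is an obstruction of the
inverse class for a path relative to the horn of index `n`. -/
theorem Obs.exists_flip {n : Fin (m + 1)} {g : (Y.functor.obj ⦋0⦌).PtSimplex (m + 1) (Y.pt ⦋0⦌)}
    {y : Δ[1] ⟶ (Y.loops (m + 1)).functor.obj ⦋1⦌} {Φ : Δ[2] ⟶ (Y.paths n.succ).functor.obj ⦋2⦌}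
    (o : Obs Y n.succ (vertex g) y Φ) :
    ∃ (g' : _) (y' : _) (Φ' : _) (o' : Obs Y n.castSucc (vertex g') y' Φ'),
      o'.z = o.z ∧ pi.mk g' = (pi.mk g)⁻¹ := by
  -- turning simplices for `g`, `y` and `Φ`, which extend the cofaces of the preceding ones
  obtain ⟨V₀, hV₀⟩ := exists_isFlip_vertex (vertex g ≫ Y.incl n.succ _)
  obtain ⟨V₁, hV₁, e₁⟩ := exists_isFlip_of_boundary (y ≫ Y.incl n.succ _)
    (fun i => V₀ ≫ Y.functor.map (SimplexCategory.δ i)) trivial (fun i => by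
      have h1 := o.δ_y i
      rw [reassoc_of% h1, incl_naturality, ← Category.assoc]
      exact hV₀.map _ (Y.map_pt _))
  have key {i j : Fin 2} (h : i ≤ j) :
      SSet.stdSimplex.δ j ≫
        MonoidalClosed.curry (V₁ ≫ Y.functor.map (SimplexCategory.δ i.castSucc)) =
      SSet.stdSimplex.δ i ≫ MonoidalClosed.curry (V₁ ≫ Y.functor.map (SimplexCategory.δ j.succ)) :=
        by
    rw [← MonoidalClosed.curry_natural_left, ← MonoidalClosed.curry_natural_left]
    have h1 := e₁ i
    have h2 := e₁ j
    rw [reassoc_of% h1, reassoc_of% h2, map_δ_comp_δ _ h]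
  have hc : BoundaryCompatible fun i : Fin 3 =>
      MonoidalClosed.curry (V₁ ≫ Y.functor.map (SimplexCategory.δ i)) := by
    intro i j hij
    fin_cases i <;> fin_cases j
    · exact key (i := 0) (j := 0) (by decide)
    · exact key (i := 0) (j := 1) (by decide)
    · exact absurd hij (by decide)
    · exact key (i := 1) (j := 1) (by decide)
  obtain ⟨V₂, hV₂, e₂⟩ := exists_isFlip_of_boundary Φ
    (fun i => V₁ ≫ Y.functor.map (SimplexCategory.δ i)) hc (fun i => by
      rw [o.δ_Φ, ← Category.assoc]
      exact hV₁.map _ (Y.map_pt _))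
  obtain ⟨θ₀, h₀, f₀⟩ := CechDiff.exists_flip hV₀
  obtain ⟨θ₁, h₁, f₁⟩ := CechDiff.exists_flip hV₁
  obtain ⟨Φ', h₂, f₂⟩ := CechDiff.exists_flip hV₂
  obtain ⟨a', ha'⟩ := exists_comp_incl θ₀ (by rw [f₀, Category.assoc]; exact incl_face _)
  obtain ⟨y', hy'⟩ := exists_comp_incl θ₁ (by rw [f₁, Category.assoc]; exact incl_face _)
  obtain ⟨g', rfl⟩ := exists_vertex a'
  have o' : Obs Y n.castSucc (vertex g') y' Φ' := by
    refine ⟨fun k => incl_injective (n := n.castSucc) (relHom.un_injective ?_),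
      fun k => relHom.un_injective ?_⟩
    · refine (congrArg relHom.un ((Category.assoc _ _ _).trans (congrArg _ hy'))).trans ?_
      refine Eq.trans ?_ (congrArg relHom.un ((Category.assoc _ _ _).trans
        ((congrArg (vertex g' ≫ ·) (incl_naturality (Y := Y) (n := n.castSucc) _)).trans
        ((Category.assoc _ _ _).symm.trans (congrArg (· ≫ _) ha'))))).symm
      rw [relHom.un_comp, h₁, un_comp_functor_map, h₀, whisker_exchange_assoc, e₁, Category.assoc]
    · refine Eq.trans ?_ (congrArg relHom.un ((Category.assoc _ _ _).symm.trans
        (congrArg (· ≫ _) hy'))).symm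
      rw [relHom.un_comp, h₂, un_comp_functor_map, h₁, whisker_exchange_assoc, e₂, Category.assoc]
  refine ⟨g', y', Φ', o', ptSimplex_ext f₂, ?_⟩
  -- `V₀` has `g` and `g'` as its only nontrivial faces
  rw [eq_inv_iff_mul_eq_one, mul_eq_one_iff_eq_inv', ← mul_eq_one_iff_eq_inv]
  refine hV₀.mk_mul_mk ?_
  rw [← h₀, ← ha', un_comp_incl, un_vertex]

/-- For the horn of index `n` the obstruction is that of the `(-1)^n`-th power of the class. -/
theorem Obs.exists_obs_zero {n : Fin (m + 2)}
    {g : (Y.functor.obj ⦋0⦌).PtSimplex (m + 1) (Y.pt ⦋0⦌)}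
    {y : Δ[1] ⟶ (Y.loops (m + 1)).functor.obj ⦋1⦌} {Φ : Δ[2] ⟶ (Y.paths n).functor.obj ⦋2⦌}
    (o : Obs Y n (vertex g) y Φ) :
    ∃ (g' : _) (y' : _) (Φ' : _) (o' : Obs Y 0 (vertex g') y' Φ'),
      o'.z = o.z ∧ pi.mk g' = pi.mk g ^ ((-1 : ℤ) ^ (n : ℕ)) := by
  induction n using Fin.induction generalizing g y with
  | zero => exact ⟨g, y, Φ, o, rfl, by simp⟩
  | succ n ih =>
    obtain ⟨g', y', Φ', o', hz, hg⟩ := o.exists_flip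
    obtain ⟨g'', y'', Φ'', o'', hz', hg'⟩ := ih o'
    refine ⟨g'', y'', Φ'', o'', hz'.trans hz, ?_⟩
    rw [hg', hg, inv_zpow', Fin.val_castSucc, Fin.val_succ, pow_succ, mul_neg_one]

end obs

/-! ### Čech cochains as homotopy groups of products -/

section eval

variable {C : Type u} [Category.{v} C]

section

variable {X : Cᵒᵖ ⥤ SSet.{w}} {K : FormalCoproduct.{w} C} {T : SSet.{w}}

/-- The map to a product given by its components. -/
def evalLift (f : ∀ i : K.I, T ⟶ X.obj (op (K.obj i))) : T ⟶ evalObj X K where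
  app n := ↾fun x i => (f i).app n x
  naturality n n' g := by
    ext x
    funext i
    exact NatTrans.naturality_apply (f i) g x

theorem eval_hom_ext {f g : T ⟶ evalObj X K} (h : ∀ i, f ≫ evalProj X K i = g ≫ evalProj X K i) :
    f = g := by
  ext n x
  funext i
  exact congrArg (fun q : T ⟶ X.obj (op (K.obj i)) => q.app n x) (h i)

instance [∀ V, SSet.KanComplex (X.obj V)] : SSet.KanComplex (evalObj X K) := by
  rw [SSet.KanComplex.iff]
  intro n i f hf
  have h (j) : ∃ g : Δ[n + 1] ⟶ X.obj (op (K.obj j)), ∀ l hl,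
      SSet.stdSimplex.δ l ≫ g = f l hl ≫ evalProj X K j := by
    obtain ⟨g, hg⟩ := (SSet.horn.IsCompatible.of_hom
      (hf.desc ≫ evalProj X K j)).exists_lift_of_kanComplex
    refine ⟨g, fun l hl => ?_⟩
    rw [hg, hf.ι_desc_assoc]
  choose g hg using h
  exact ⟨evalLift g, fun l hl => eval_hom_ext fun j => hg j l hl⟩

/-- A simplex of a product with trivial boundary given by its components. -/
def evalPt {t : ℕ} {x : evalObj X K _⦋0⦌}
    (f : ∀ i : K.I, (X.obj (op (K.obj i))).PtSimplex t (x i)) : (evalObj X K).PtSimplex t x :=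
  ptMk (evalLift fun i => (f i).map) (eval_hom_ext fun i => ptSimplex_comm (f i))

end

variable {X : PtDiagram.{w} Cᵒᵖ} {U : SimplicialObject (FormalCoproduct.{w} C)} {t p : ℕ}

theorem hasComponents_mk
    (f : ∀ i : (U _⦋p⦌).I, (X.functor.obj (op ((U _⦋p⦌).obj i))).PtSimplex t (X.pt _)) :
    HasComponents (X := X) (U := U) (pi.mk (evalPt f)) (fun i => pi.mk (f i)) := fun _ => rfl

theorem exists_hasComponents (c : Cochain X U t p) : ∃ e, HasComponents e c := by
  choose f hf using fun i => pi.mk_surjective (c i)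
  exact ⟨_, fun i => (hasComponents_mk f i).trans (hf i)⟩

instance [∀ V, SSet.KanComplex (X.functor.obj V)] (p : SimplexCategory) :
    SSet.KanComplex ((X.cosimplicial U).functor.obj p) :=
  inferInstanceAs (SSet.KanComplex (evalObj X.functor (U.obj (op p))))

variable [∀ V, SSet.KanComplex (X.functor.obj V)]

variable (X U t p) in
/-- The isomorphism of the homotopy groups of the product with the Čech cochains. -/
noncomputable def components :
    pi (t + 1) ((X.cosimplicial U).functor.obj ⦋p⦌) ((X.cosimplicial U).pt ⦋p⦌) →*
      Cochain X U (t + 1) p :=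
  MonoidHom.pi fun i => piHom t (evalProj X.functor (U _⦋p⦌) i) rfl

theorem hasComponents_iff
    {e : pi (t + 1) ((X.cosimplicial U).functor.obj ⦋p⦌) ((X.cosimplicial U).pt ⦋p⦌)}
    {c : Cochain X U (t + 1) p} : HasComponents e c ↔ components X U t p e = c :=
  funext_iff.symm

theorem components_injective : Function.Injective (components X U t p) := by
  intro a b h
  obtain ⟨f, rfl⟩ := pi.mk_surjective a
  obtain ⟨g, rfl⟩ := pi.mk_surjective b
  have h' (i) := isBd_two_iff.2 (pi.mk_eq_mk.1 (congrFun h i))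
  have r := fun i => (h' i).some
  refine pi.mk_eq_mk.2 (isBd_two_iff.1 ⟨?_⟩)
  exact
    { map := evalLift fun i => (r i).map
      δ_castSucc_map := eval_hom_ext fun i => (r i).δ_castSucc_map
      δ_succ_map := eval_hom_ext fun i => (r i).δ_succ_map
      δ_map_of_lt := fun j hj => eval_hom_ext fun i => (r i).δ_map_of_lt j hj
      δ_map_of_gt := fun j hj => eval_hom_ext fun i => (r i).δ_map_of_gt j hj }

theorem components_surjective : Function.Surjective (components X U t p) := fun c => by
  obtain ⟨e, he⟩ := exists_hasComponents c
  exact ⟨e, hasComponents_iff.1 he⟩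

variable (X U t p) in
/-- The homomorphism induced by a coface on the homotopy groups of the cosimplicial space `X_U`. -/
noncomputable abbrev cofaceHom (k : Fin (p + 2)) :
    pi (t + 1) ((X.cosimplicial U).functor.obj ⦋p⦌) ((X.cosimplicial U).pt ⦋p⦌) →*
      pi (t + 1) ((X.cosimplicial U).functor.obj ⦋p + 1⦌) ((X.cosimplicial U).pt ⦋p + 1⦌) :=
  piHom t ((X.cosimplicial U).functor.map (SimplexCategory.δ k)) ((X.cosimplicial U).map_pt _)

theorem coface_components (k : Fin (p + 2))
    (e : pi (t + 1) ((X.cosimplicial U).functor.obj ⦋p⦌) ((X.cosimplicial U).pt ⦋p⦌)) :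
    coface X U t p k (components X U t p e) = components X U t (p + 1) (cofaceHom X U t p k e) := by
  obtain ⟨f, rfl⟩ := pi.mk_surjective e
  rfl

theorem cobd_two (c : Cochain X U (t + 2) 2) : cobd X U t 2 c =
    coface X U (t + 1) 2 0 c * (coface X U (t + 1) 2 1 c)⁻¹ * coface X U (t + 1) 2 2 c *
      (coface X U (t + 1) 2 3 c)⁻¹ := by
  rw [cobd, MonoidHom.finsetProd_apply, Fin.prod_univ_four]
  have h3 : ((3 : Fin 4) : ℕ) = 3 := rfl
  simp only [Fin.val_zero, Fin.val_one, Fin.val_two, h3, pow_zero, pow_one, zpow_one, zpow_neg,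
    MonoidHom.inv_apply]
  norm_num

theorem cobd_one (c : Cochain X U (t + 2) 1) : cobd X U t 1 c =
    coface X U (t + 1) 1 0 c * (coface X U (t + 1) 1 1 c)⁻¹ * coface X U (t + 1) 1 2 c := by
  rw [cobd, MonoidHom.finsetProd_apply, Fin.prod_univ_three]
  simp only [Fin.val_zero, Fin.val_one, Fin.val_two, pow_zero, pow_one, zpow_one, zpow_neg,
    MonoidHom.inv_apply]
  norm_num

theorem coface_comp_coface {i j : Fin (p + 2)} (h : i ≤ j) (c : Cochain X U (t + 1) p) :
    coface X U t (p + 1) j.succ (coface X U t p i c) =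
      coface X U t (p + 1) i.castSucc (coface X U t p j c) := by
  obtain ⟨e, rfl⟩ := components_surjective c
  simp only [coface_components]
  obtain ⟨f, rfl⟩ := pi.mk_surjective e
  refine congrArg (components X U t (p + 2)) (congrArg pi.mk (ptSimplex_ext ?_))
  change (f.map ≫ _) ≫ _ = (f.map ≫ _) ≫ _
  rw [Category.assoc, Category.assoc]
  exact congrArg _ (map_δ_comp_δ _ h)

/-- The Čech coboundary squares to zero. -/
theorem cobd_cobd (c : Cochain X U (t + 2) 1) : cobd X U t 2 (cobd X U t 1 c) = 1 := by
  rw [cobd_one, cobd_two]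
  simp only [map_mul, map_inv]
  have h00 := coface_comp_coface (i := (0 : Fin 3)) (j := 0) (by decide) c
  have h01 := coface_comp_coface (i := (0 : Fin 3)) (j := 1) (by decide) c
  have h02 := coface_comp_coface (i := (0 : Fin 3)) (j := 2) (by decide) c
  have h11 := coface_comp_coface (i := (1 : Fin 3)) (j := 1) (by decide) c
  have h12 := coface_comp_coface (i := (1 : Fin 3)) (j := 2) (by decide) c
  have h22 := coface_comp_coface (i := (2 : Fin 3)) (j := 2) (by decide) c
  change coface X U (t + 1) 2 1 _ = coface X U (t + 1) 2 0 _ at h00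
  change coface X U (t + 1) 2 2 _ = coface X U (t + 1) 2 0 _ at h01
  change coface X U (t + 1) 2 3 _ = coface X U (t + 1) 2 0 _ at h02
  change coface X U (t + 1) 2 2 _ = coface X U (t + 1) 2 1 _ at h11
  change coface X U (t + 1) 2 3 _ = coface X U (t + 1) 2 1 _ at h12
  change coface X U (t + 1) 2 3 _ = coface X U (t + 1) 2 2 _ at h22
  rw [h00, h01, h02, h11, h12, h22]
  refine Additive.ofMul.injective ?_
  simp only [ofMul_mul, ofMul_inv, ofMul_one]
  abel

end eval

/-! ### Matching objects in low degrees -/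

section matching

variable {Z : SimplexCategory ⥤ SSet.{w}} {T : SSet.{w}} {n : ℕ}

theorem exists_lift_of_rlp {E B : SSet.{w}} {S : T.Subcomplex} (hS : SSet.anodyneExtensions S.ι)
    (p : E ⟶ B) (hp : SSet.modelCategoryQuillen.J.rlp p) (f : (S : SSet) ⟶ E) (b : T ⟶ B)
    (h : f ≫ p = S.ι ≫ b) : ∃ g, S.ι ≫ g = f ∧ g ≫ p = b := by
  have : HasLiftingProperty S.ι p := hS p hp
  have sq : CommSq f S.ι p b := ⟨h⟩
  exact ⟨sq.lift, sq.fac_left, sq.fac_right⟩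

/-- The total space of a fibration over a Kan complex is a Kan complex. -/
theorem kanComplex_of_rlp {E B : SSet.{w}} (p : E ⟶ B) (hp : SSet.modelCategoryQuillen.J.rlp p)
    (hB : ∀ {s : ℕ} {i : Fin (s + 2)} (b : (Λ[s + 1, i] : SSet.{w}) ⟶ B),
      ∃ b' : Δ[s + 1] ⟶ B, Λ[s + 1, i].ι ≫ b' = b) : SSet.KanComplex E := by
  rw [SSet.KanComplex.iff]
  intro s i f hf
  obtain ⟨b, hb⟩ := hB (hf.desc ≫ p)
  obtain ⟨g, hg, -⟩ := exists_lift_of_rlp (SSet.anodyneExtensions.horn_ι i) p hp hf.desc b hb.symm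
  refine ⟨g, fun j hj => ?_⟩
  rw [← hf.ι_desc j hj, ← hg]
  rfl

theorem exists_horn_extension {E : SSet.{w}} [SSet.KanComplex E] {s : ℕ} {i : Fin (s + 2)}
    (b : (Λ[s + 1, i] : SSet.{w}) ⟶ E) : ∃ b' : Δ[s + 1] ⟶ E, Λ[s + 1, i].ι ≫ b' = b := by
  obtain ⟨g, hg⟩ := (SSet.horn.IsCompatible.of_hom b).exists_lift_of_kanComplex
  refine ⟨g, SSet.horn.hom_ext' fun j hj => ?_⟩
  rw [SSet.horn.ι_ι_assoc, hg]

variable (Z n) in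
/-- The projection of the matching object which belongs to the `i`-th codegeneracy. -/
def matchingProj (i : Fin (n + 1)) : matching Z (n + 1) ⟶ Z.obj ⦋n⦌ where
  app p := ↾fun x => x.1 (Fin.last n) (SimplexCategory.σ i) inferInstance

theorem matchingMap_proj (i : Fin (n + 1)) :
    matchingMap Z (n + 1) ≫ matchingProj Z n i = Z.map (SimplexCategory.σ i) := rfl

theorem exists_eq_σ_comp {k : ℕ} (hk : k < n + 1) (φ : ⦋n + 1⦌ ⟶ ⦋k⦌) :
    ∃ (i : Fin (n + 1)) (ψ : ⦋n⦌ ⟶ ⦋k⦌), φ = SimplexCategory.σ i ≫ ψ := by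
  refine SimplexCategory.eq_σ_comp_of_not_injective φ fun h => ?_
  have := Fintype.card_le_of_injective _ h
  simp at this
  omega

theorem matching_hom_ext {f g : T ⟶ matching Z (n + 1)}
    (h : ∀ i, f ≫ matchingProj Z n i = g ≫ matchingProj Z n i) : f = g := by
  ext p x
  apply Subtype.ext
  funext k φ hφ
  obtain ⟨i, ψ, rfl⟩ := exists_eq_σ_comp k.2 φ
  refine ((f.app p x).2 (Fin.last n) k (SimplexCategory.σ i) inferInstance ψ hφ).symm.trans
    (Eq.trans ?_ ((g.app p x).2 (Fin.last n) k (SimplexCategory.σ i) inferInstance ψ hφ))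
  exact congrArg (fun q : T ⟶ Z.obj ⦋n⦌ => (Z.map ψ).app p (q.app p x)) (h i)

/-- Maps to the matching object are given by compatible components for the codegeneracies. -/
theorem exists_matching_lift (f : Fin (n + 1) → (T ⟶ Z.obj ⦋n⦌))
    (hf : ∀ (i j : Fin (n + 1)) (k : ℕ) (ψ ψ' : ⦋n⦌ ⟶ ⦋k⦌),
      SimplexCategory.σ i ≫ ψ = SimplexCategory.σ j ≫ ψ' → f i ≫ Z.map ψ = f j ≫ Z.map ψ') :
    ∃ g : T ⟶ matching Z (n + 1), ∀ i, g ≫ matchingProj Z n i = f i := by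
  choose i ψ hψ using fun (k : Fin (n + 1)) (φ : ⦋n + 1⦌ ⟶ ⦋(k : ℕ)⦌) => exists_eq_σ_comp k.2 φ
  let F (k : Fin (n + 1)) (φ : ⦋n + 1⦌ ⟶ ⦋(k : ℕ)⦌) : T ⟶ Z.obj ⦋(k : ℕ)⦌ :=
    f (i k φ) ≫ Z.map (ψ k φ)
  have hF (k l : Fin (n + 1)) (φ : ⦋n + 1⦌ ⟶ ⦋(k : ℕ)⦌) (χ : ⦋(k : ℕ)⦌ ⟶ ⦋(l : ℕ)⦌) :
      F k φ ≫ Z.map χ = F l (φ ≫ χ) := by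
    refine (Category.assoc _ _ _).trans ((congrArg _ (Z.map_comp _ _).symm).trans (hf _ _ _ _ _ ?_))
    rw [← hψ, ← Category.assoc, ← hψ]
  refine ⟨{ app p := ↾fun x => ⟨fun k φ _ => (F k φ).app p x, fun k l φ _ χ _ =>
      congrArg (fun q : T ⟶ Z.obj ⦋(l : ℕ)⦌ => q.app p x) (hF k l φ χ)⟩
            naturality := fun p q g => ?_ }, fun j => ?_⟩
  · ext x
    apply Subtype.ext
    funext k φ _
    exact NatTrans.naturality_apply (F k φ) g x
  · have e : F (Fin.last n) (SimplexCategory.σ j) = f j := by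
      refine (hf _ j n _ (𝟙 _) ?_).trans ((congrArg _ (Z.map_id _)).trans (Category.comp_id _))
      exact (hψ (Fin.last n) (SimplexCategory.σ j)).symm.trans (Category.comp_id _).symm
    exact e

/-- The matching object `M^1 Z` is `Z^0`. -/
theorem exists_matching_one (f : T ⟶ Z.obj ⦋0⦌) :
    ∃ g : T ⟶ matching Z 1, g ≫ matchingProj Z 0 0 = f := by
  obtain ⟨g, hg⟩ := exists_matching_lift (n := 0) (Z := Z) (fun _ => f) (fun i j k ψ ψ' h => by
    obtain rfl : i = j := Subsingleton.elim (α := Fin 1) _ _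
    rw [(cancel_epi _).1 h])
  exact ⟨g, hg 0⟩

/-- The matching object `M^2 Z` is the fibre product of two copies of `Z^1` over `Z^0`. -/
theorem exists_matching_two (f g : T ⟶ Z.obj ⦋1⦌) (h : f ≫ Z.map (SimplexCategory.σ 0) =
    g ≫ Z.map (SimplexCategory.σ 0)) :
    ∃ q : T ⟶ matching Z 2, q ≫ matchingProj Z 1 0 = f ∧ q ≫ matchingProj Z 1 1 = g := by
  have key {k : ℕ} (ψ ψ' : ⦋1⦌ ⟶ ⦋k⦌) (e : SimplexCategory.σ (0 : Fin 2) ≫ ψ =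
      SimplexCategory.σ (1 : Fin 2) ≫ ψ') : f ≫ Z.map ψ = g ≫ Z.map ψ' := by
    have e0 : ψ 0 = ψ' 0 := congrArg (fun q : ⦋2⦌ ⟶ ⦋k⦌ => q 0) e
    have e1 : ψ 0 = ψ' 1 := congrArg (fun q : ⦋2⦌ ⟶ ⦋k⦌ => q 1) e
    have e2 : ψ 1 = ψ' 1 := congrArg (fun q : ⦋2⦌ ⟶ ⦋k⦌ => q 2) e
    obtain rfl : ψ = ψ' := by
      ext x : 3
      fin_cases x
      · exact e0
      · exact e2
    have e3 : ψ = SimplexCategory.σ (0 : Fin 1) ≫ SimplexCategory.δ (1 : Fin 2) ≫ ψ := by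
      ext x : 3
      fin_cases x
      · rfl
      · exact e1.symm
    rw [e3, Z.map_comp, reassoc_of% h]
  obtain ⟨q, hq⟩ := exists_matching_lift (n := 1) (Z := Z) ![f, g] (fun i j k ψ ψ' e => by
    fin_cases i <;> fin_cases j
    · rw [(cancel_epi _).1 e]
    · exact key ψ ψ' e
    · exact (key ψ' ψ e.symm).symm
    · rw [(cancel_epi _).1 e])
  exact ⟨q, hq 0, hq 1⟩

theorem matchingProj_comp_σ : matchingProj Z 1 0 ≫ Z.map (SimplexCategory.σ (0 : Fin 1)) =
    matchingProj Z 1 1 ≫ Z.map (SimplexCategory.σ (0 : Fin 1)) := by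
  ext p x
  have key {φ φ' : ⦋2⦌ ⟶ ⦋((0 : Fin 2) : ℕ)⦌} (h : φ = φ') (hφ : Epi φ) (hφ' : Epi φ') :
      x.1 0 φ hφ = x.1 0 φ' hφ' := by subst h; rfl
  have h0 : Epi (SimplexCategory.σ (0 : Fin 2) ≫ SimplexCategory.σ (0 : Fin 1)) := inferInstance
  have h1 : Epi (SimplexCategory.σ (1 : Fin 2) ≫ SimplexCategory.σ (0 : Fin 1)) := inferInstance
  refine (x.2 1 0 (SimplexCategory.σ 0) inferInstance (SimplexCategory.σ 0) h0).trans
    (Eq.trans (key ?_ h0 h1)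
      (x.2 1 0 (SimplexCategory.σ 1) inferInstance (SimplexCategory.σ 0) h1).symm)
  exact SimplexCategory.Hom.ext _ _ (OrderHom.ext _ _ (funext fun x =>
    Subsingleton.elim (α := Fin 1) _ _))

theorem ReedyFibrant.kanComplex_zero (hZ : ReedyFibrant Z) : SSet.KanComplex (Z.obj ⦋0⦌) := by
  have : ∀ {T : SSet.{w}} (f g : T ⟶ matching Z 0), f = g := fun f g => by
    ext p x
    exact Subtype.ext (funext fun k => k.elim0)
  refine kanComplex_of_rlp _ (hZ 0) fun b =>
    ⟨{  app p := ↾fun _ => ⟨fun k => k.elim0, fun k => k.elim0⟩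
        naturality := fun p q g => ?_ }, this _ _⟩
  ext x
  exact Subtype.ext (funext fun k => k.elim0)

theorem ReedyFibrant.kanComplex_one (hZ : ReedyFibrant Z) : SSet.KanComplex (Z.obj ⦋1⦌) := by
  have := hZ.kanComplex_zero
  refine kanComplex_of_rlp _ (hZ 1) fun b => ?_
  obtain ⟨b', hb'⟩ := exists_horn_extension (b ≫ matchingProj Z 0 0)
  obtain ⟨g, hg⟩ := exists_matching_one b'
  refine ⟨g, matching_hom_ext fun i => ?_⟩
  obtain rfl : i = 0 := Subsingleton.elim (α := Fin 1) _ _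
  rw [Category.assoc, hg, hb']

/-- The codegeneracy `Z^1 ⟶ Z^0` is a fibration. -/
theorem ReedyFibrant.rlp_σ (hZ : ReedyFibrant Z) :
    SSet.modelCategoryQuillen.J.rlp (Z.map (SimplexCategory.σ (0 : Fin 1))) := by
  intro A B i hi
  refine ⟨fun {f b} sq => ?_⟩
  obtain ⟨g, hg⟩ := exists_matching_one b
  have sq' : CommSq f i (matchingMap Z 1) g := ⟨matching_hom_ext fun j => by
    obtain rfl : j = 0 := Subsingleton.elim (α := Fin 1) _ _
    rw [Category.assoc, Category.assoc, matchingMap_proj, hg, sq.w]⟩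
  have := hZ 1 i hi
  refine ⟨⟨sq'.lift, sq'.fac_left, ?_⟩⟩
  rw [← matchingMap_proj, ← Category.assoc, sq'.fac_right, hg]

/-- `Z^2` is a Kan complex, since `M^2 Z` is a fibre product of Kan complexes along the fibration
`Z^1 ⟶ Z^0`. -/
theorem ReedyFibrant.kanComplex_two (hZ : ReedyFibrant Z) : SSet.KanComplex (Z.obj ⦋2⦌) := by
  have := hZ.kanComplex_one
  refine kanComplex_of_rlp _ (hZ 2) fun {s i} b => ?_
  obtain ⟨f, hf⟩ := exists_horn_extension (b ≫ matchingProj Z 1 0)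
  have e : b ≫ matchingProj Z 1 1 ≫ Z.map (SimplexCategory.σ (0 : Fin 1)) =
      b ≫ matchingProj Z 1 0 ≫ Z.map (SimplexCategory.σ (0 : Fin 1)) := by
    rw [matchingProj_comp_σ]
  obtain ⟨g, hg, hg'⟩ := exists_lift_of_rlp (SSet.anodyneExtensions.horn_ι i) _ hZ.rlp_σ
    (b ≫ matchingProj Z 1 1) (f ≫ Z.map (SimplexCategory.σ (0 : Fin 1))) (by
      rw [reassoc_of% hf, Category.assoc, e])
  obtain ⟨q, hq0, hq1⟩ := exists_matching_two f g hg'.symm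
  refine ⟨q, matching_hom_ext fun j => ?_⟩
  fin_cases j
  · exact (Category.assoc _ _ _).trans ((congrArg _ hq0).trans hf)
  · exact (Category.assoc _ _ _).trans ((congrArg _ hq1).trans hg)

end matching

/-! ### Obstruction data compatible with codegeneracies -/

section normalize

variable {Z : PtDiagram.{w} SimplexCategory} {m : ℕ}
  {a : Δ[0] ⟶ (Z.loops (m + 1)).functor.obj ⦋0⦌}

/-- An edge `y₀` between the cofaces of a vertex `a` can be replaced by one whose codegeneracy is
degenerate. The codegeneracy of `y₀` is a loop `l` at `a`, and `y₀` is composed with the inverse of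
the coface of `l`; this is done over `Z^0`, by lifting along the fibration `Z^1 ⟶ Z^0`. -/
theorem exists_normalized_edge (hZ : ReedyFibrant Z.functor)
    {y₀ : Δ[1] ⟶ (Z.loops (m + 1)).functor.obj ⦋1⦌}
    (h : ∀ k : Fin 2, SSet.stdSimplex.δ k ≫ y₀ =
      a ≫ (Z.loops (m + 1)).functor.map (SimplexCategory.δ k)) :
    ∃ y : Δ[1] ⟶ (Z.loops (m + 1)).functor.obj ⦋1⦌,
      (∀ k : Fin 2, SSet.stdSimplex.δ k ≫ y =
        a ≫ (Z.loops (m + 1)).functor.map (SimplexCategory.δ k)) ∧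
      y ≫ (Z.loops (m + 1)).functor.map (SimplexCategory.σ (0 : Fin 1)) =
        SSet.stdSimplex.σ (0 : Fin 1) ≫ a := by
  let L := (Z.loops (m + 1)).functor
  have hσ (k : Fin 2) : L.map (SimplexCategory.δ k) ≫ L.map (SimplexCategory.σ (0 : Fin 1)) = 𝟙 _ :=
    by
    rw [← L.map_comp, ← L.map_id]
    congr 1
    exact SimplexCategory.Hom.ext _ _
      (OrderHom.ext _ _ (funext fun x => Subsingleton.elim (α := Fin 1) _ _))
  obtain ⟨l, hl⟩ : ∃ l, l = y₀ ≫ L.map (SimplexCategory.σ (0 : Fin 1)) := ⟨_, rfl⟩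
  have hla (k : Fin 2) : SSet.stdSimplex.δ k ≫ l = a := by
    rw [hl, reassoc_of% (h k)]
    exact (congrArg _ (hσ k)).trans (Category.comp_id _)
  have hc : SSet.horn.IsCompatible (i := (2 : Fin 3)) (fun (j : Fin 3) _ =>
      if j = 0 then l ≫ L.map (SimplexCategory.δ (0 : Fin 2)) else y₀) := by
    rw [SSet.horn.isCompatible_iff]
    intro i j hi hj hij
    fin_cases i <;> fin_cases j <;>
      first | (exact absurd hij (by decide)) | (exact absurd rfl hi) | (exact absurd rfl hj) | skip
    refine Eq.trans ?_ (h 0).symm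
    exact (Category.assoc _ _ _).symm.trans (congrArg (· ≫ _) (hla 0))
  obtain ⟨W, hW, hWσ⟩ := relHom.hasLift (A := (∂Δ[m + 1] : (Δ[m + 1] : SSet.{w}).Subcomplex))
    (Z.functor.map (SimplexCategory.σ (0 : Fin 1))) (Z.map_pt _) hZ.rlp_σ
    (.inr (SSet.anodyneExtensions.horn_ι (2 : Fin 3))) hc.desc (SSet.stdSimplex.σ (0 : Fin 2) ≫ l)
      (by
      refine SSet.horn.hom_ext' fun j hj => ?_
      rw [hc.ι_desc_assoc, SSet.horn.ι_ι_assoc]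
      fin_cases j
      · refine Eq.trans ((Category.assoc _ _ _).trans
          ((congrArg _ (hσ 0)).trans (Category.comp_id _))) ?_
        have e : SSet.stdSimplex.{w}.δ (0 : Fin 3) ≫ SSet.stdSimplex.σ (0 : Fin 2) = 𝟙 _ :=
          SSet.stdSimplex.δ_comp_σ_self (i := (0 : Fin 2))
        exact (Category.id_comp _).symm.trans
          ((congrArg (· ≫ l) e.symm).trans (Category.assoc _ _ _))
      · refine Eq.trans hl.symm ?_
        have e : SSet.stdSimplex.{w}.δ (1 : Fin 3) ≫ SSet.stdSimplex.σ (0 : Fin 2) = 𝟙 _ :=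
          SSet.stdSimplex.δ_comp_σ_succ (i := (0 : Fin 2))
        exact (Category.id_comp _).symm.trans
          ((congrArg (· ≫ l) e.symm).trans (Category.assoc _ _ _))
      · exact absurd rfl hj)
  have hW0 : SSet.stdSimplex.δ 0 ≫ W = l ≫ L.map (SimplexCategory.δ (0 : Fin 2)) := by
    rw [← SSet.horn.ι_ι_assoc (2 : Fin 3) 0 (by decide), hW, hc.ι_desc]
    rfl
  have hW1 : SSet.stdSimplex.δ 1 ≫ W = y₀ := by
    rw [← SSet.horn.ι_ι_assoc (2 : Fin 3) 1 (by decide), hW, hc.ι_desc]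
    rfl
  refine ⟨SSet.stdSimplex.δ 2 ≫ W, fun k => ?_, ?_⟩
  · fin_cases k
    · have e : SSet.stdSimplex.{w}.δ (0 : Fin 2) ≫ SSet.stdSimplex.δ (2 : Fin 3) =
          SSet.stdSimplex.δ (1 : Fin 2) ≫ SSet.stdSimplex.δ (0 : Fin 3) :=
        SSet.stdSimplex.δ_comp_δ (i := (0 : Fin 2)) (j := 1) (by decide)
      refine ((Category.assoc _ _ _).symm.trans
        ((congrArg (· ≫ W) e).trans (Category.assoc _ _ _))).trans ?_
      rw [hW0, reassoc_of% (hla 1)]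
      rfl
    · have e : SSet.stdSimplex.{w}.δ (1 : Fin 2) ≫ SSet.stdSimplex.δ (2 : Fin 3) =
          SSet.stdSimplex.δ (1 : Fin 2) ≫ SSet.stdSimplex.δ (1 : Fin 3) :=
        SSet.stdSimplex.δ_comp_δ (i := (1 : Fin 2)) (j := 1) le_rfl
      refine ((Category.assoc _ _ _).symm.trans
        ((congrArg (· ≫ W) e).trans (Category.assoc _ _ _))).trans ?_
      rw [hW1]
      exact h 1
  · refine (Category.assoc _ _ _).trans ((congrArg _ hWσ).trans ?_)
    have e : SSet.stdSimplex.{w}.δ (2 : Fin 3) ≫ SSet.stdSimplex.σ (0 : Fin 2) =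
        SSet.stdSimplex.σ (0 : Fin 1) ≫ SSet.stdSimplex.δ (1 : Fin 2) :=
      SSet.stdSimplex.δ_comp_σ_of_gt (i := (1 : Fin 2)) (j := (0 : Fin 1)) (by decide)
    rw [reassoc_of% e, hla]

/-- In a Reedy fibrant cosimplicial space a normalized edge has a filling which is compatible with
the codegeneracies: lift along the matching map in degree `2`. -/
theorem exists_normalized_obs (hZ : ReedyFibrant Z.functor)
    {y : Δ[1] ⟶ (Z.loops (m + 1)).functor.obj ⦋1⦌}
    (h : ∀ k : Fin 2, SSet.stdSimplex.δ k ≫ y =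
      a ≫ (Z.loops (m + 1)).functor.map (SimplexCategory.δ k))
    (hσ : y ≫ (Z.loops (m + 1)).functor.map (SimplexCategory.σ (0 : Fin 1)) =
        SSet.stdSimplex.σ (0 : Fin 1) ≫ a) (n : Fin (m + 2)) :
    ∃ Φ, Obs Z n a y Φ ∧ ∀ i : Fin 2, relHom.un Φ ≫ Z.functor.map (SimplexCategory.σ i) =
      Δ[m + 1] ◁ SSet.stdSimplex.σ i ≫ relHom.un y := by
  let F := Z.functor
  have hu (k : Fin 2) : Δ[m + 1] ◁ SSet.stdSimplex.δ k ≫ relHom.un y =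
      relHom.un a ≫ F.map (SimplexCategory.δ k) := by
    rw [← relHom.un_comp, h, un_comp_functor_map]
  have huσ : relHom.un y ≫ F.map (SimplexCategory.σ (0 : Fin 1)) =
      Δ[m + 1] ◁ SSet.stdSimplex.σ (0 : Fin 1) ≫ relHom.un a := by
    rw [← relHom.un_comp, ← hσ, un_comp_functor_map]
  have hΛ : Λ[m + 1, n].ι ▷ Δ[1] ≫ relHom.un y = SSet.const (Z.pt ⦋1⦌) := by
    rw [← un_comp_incl (n := n), relHom.whiskerRight_un]
  obtain ⟨b, hb0, hb1⟩ := exists_matching_two (Z := F)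
    (Δ[m + 1] ◁ SSet.stdSimplex.σ (0 : Fin 2) ≫ relHom.un y)
    (Δ[m + 1] ◁ SSet.stdSimplex.σ (1 : Fin 2) ≫ relHom.un y) (by
      rw [Category.assoc, Category.assoc, huσ, ← whiskerLeft_comp_assoc, ← whiskerLeft_comp_assoc]
      congr 2
      exact SSet.stdSimplex.ext₀)
  have hb (i : Fin 2) : b ≫ matchingProj F 1 i = Δ[m + 1] ◁ SSet.stdSimplex.σ i ≫ relHom.un y := by
    fin_cases i
    · exact hb0
    · exact hb1
  have hid (k : Fin 3) (i : Fin 2) : relHom.un y ≫ F.map (SimplexCategory.δ k) ≫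
    F.map (SimplexCategory.σ i) =
      Δ[m + 1] ◁ SSet.stdSimplex.δ k ≫ Δ[m + 1] ◁ SSet.stdSimplex.σ i ≫ relHom.un y := by
    have e1 (k : Fin 3) (i : Fin 2) (h1 : SimplexCategory.δ k ≫ SimplexCategory.σ i = 𝟙 _)
        (h2 : SSet.stdSimplex.{w}.δ k ≫ SSet.stdSimplex.σ i = 𝟙 _) :
        relHom.un y ≫ F.map (SimplexCategory.δ k) ≫ F.map (SimplexCategory.σ i) =
      Δ[m + 1] ◁ SSet.stdSimplex.δ k ≫ Δ[m + 1] ◁ SSet.stdSimplex.σ i ≫ relHom.un y := by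
      rw [← F.map_comp, h1, F.map_id, Category.comp_id, ← whiskerLeft_comp_assoc, h2,
        whiskerLeft_id,
        Category.id_comp]
    have e2 (k : Fin 3) (i : Fin 2) (q : Fin 2)
        (h1 : SimplexCategory.δ k ≫ SimplexCategory.σ i = SimplexCategory.σ (0 : Fin 1) ≫
          SimplexCategory.δ q)
        (h2 : SSet.stdSimplex.{w}.δ k ≫ SSet.stdSimplex.σ i = SSet.stdSimplex.σ (0 : Fin 1) ≫
          SSet.stdSimplex.δ q) :
        relHom.un y ≫ F.map (SimplexCategory.δ k) ≫ F.map (SimplexCategory.σ i) =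
      Δ[m + 1] ◁ SSet.stdSimplex.δ k ≫ Δ[m + 1] ◁ SSet.stdSimplex.σ i ≫ relHom.un y := by
      rw [← F.map_comp, h1, F.map_comp, reassoc_of% huσ, ← whiskerLeft_comp_assoc, h2,
        whiskerLeft_comp_assoc, hu]
    fin_cases i <;> fin_cases k
    · exact e1 0 0 (SimplexCategory.δ_comp_σ_self (i := (0 : Fin 2)))
        (SSet.stdSimplex.δ_comp_σ_self (i := (0 : Fin 2)))
    · exact e1 1 0 (SimplexCategory.δ_comp_σ_succ (i := (0 : Fin 2)))
        (SSet.stdSimplex.δ_comp_σ_succ (i := (0 : Fin 2)))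
    · exact e2 2 0 1 (SimplexCategory.δ_comp_σ_of_gt (i := (1 : Fin 2)) (j := (0 : Fin 1))
        (by decide))
        (SSet.stdSimplex.δ_comp_σ_of_gt (i := (1 : Fin 2)) (j := (0 : Fin 1)) (by decide))
    · exact e2 0 1 0 (SimplexCategory.δ_comp_σ_of_le (i := (0 : Fin 2)) (j := (0 : Fin 1))
        (by decide))
        (SSet.stdSimplex.δ_comp_σ_of_le (i := (0 : Fin 2)) (j := (0 : Fin 1)) (by decide))
    · exact e1 1 1 (SimplexCategory.δ_comp_σ_self (i := (1 : Fin 2)))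
        (SSet.stdSimplex.δ_comp_σ_self (i := (1 : Fin 2)))
    · exact e1 2 1 (SimplexCategory.δ_comp_σ_succ (i := (1 : Fin 2)))
        (SSet.stdSimplex.δ_comp_σ_succ (i := (1 : Fin 2)))
  have key {i j : Fin 2} (hij : i ≤ j) :
      SSet.stdSimplex.δ j ≫
        MonoidalClosed.curry (relHom.un y ≫ F.map (SimplexCategory.δ i.castSucc)) =
      SSet.stdSimplex.δ i ≫ MonoidalClosed.curry (relHom.un y ≫ F.map (SimplexCategory.δ j.succ)) :=
        by
    rw [← MonoidalClosed.curry_natural_left, ← MonoidalClosed.curry_natural_left,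
      reassoc_of% (hu i), reassoc_of% (hu j), map_δ_comp_δ _ hij]
  have hc : BoundaryCompatible fun k : Fin 3 =>
      MonoidalClosed.curry (relHom.un y ≫ F.map (SimplexCategory.δ k)) := by
    intro i j hij
    fin_cases i <;> fin_cases j
    · exact key (i := 0) (j := 0) (by decide)
    · exact key (i := 0) (j := 1) (by decide)
    · exact absurd hij (by decide)
    · exact key (i := 1) (j := 1) (by decide)
  obtain ⟨f, hf⟩ := exists_tensor_desc _ hc
  obtain ⟨Φ, h1, h2, h3⟩ := exists_lift_tensor (A := Λ[m + 1, n])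
    (S := (∂Δ[2] : (Δ[2] : SSet.{w}).Subcomplex))
    (.inl (SSet.anodyneExtensions.horn_ι n)) (matchingMap F 2) (hZ 2) f (SSet.const (Z.pt _)) b
    (tensor_boundary_hom_ext fun k => by
      rw [whisker_exchange_assoc, hf, reassoc_of% hΛ, SSet.comp_const, SSet.comp_const,
        SSet.const_comp,
        Z.map_pt])
    (tensor_boundary_hom_ext fun k => matching_hom_ext fun i => by
      rw [Category.assoc, Category.assoc, Category.assoc, Category.assoc, matchingMap_proj,
        reassoc_of% (hf k), ← whiskerLeft_comp_assoc, SSet.boundary.ι_ι, hb, hid])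
    (matching_hom_ext fun i => by
      rw [Category.assoc, Category.assoc, matchingMap_proj, hb, ← whisker_exchange_assoc, hΛ,
        SSet.comp_const, SSet.const_comp, Z.map_pt])
  refine ⟨relHom.mk Φ h2, ⟨h, fun k => relHom.un_injective ?_⟩, fun i => ?_⟩
  · rw [relHom.un_comp, relHom.un_mk, ← Category.assoc, un_comp_functor_map, un_comp_incl, ← hf,
      ← h1,
      ← whiskerLeft_comp_assoc, SSet.boundary.ι_ι]
  · rw [relHom.un_mk, ← matchingMap_proj, reassoc_of% h3, hb]

end normalize

/-! ### Maps from the skeleta of the simplices -/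

section skeleton

variable {s : ℕ} {T : SSet.{w}} {F : SimplexCategory ⥤ SSet.{w}}

/-- The simplices of the `s`-skeleton of `Δ[p]` factor through some `[k]` with `k ≤ s`. -/
theorem exists_factor_of_mem_skeleton {p n : SimplexCategory}
    {x : (SSet.stdSimplex.{w}.obj p : SSet.{w}).obj (op n)}
    (hx : x ∈ ((SSet.stdSimplex.obj p : SSet.{w}).skeleton (s + 1)).obj (op n)) :
    ∃ (k : SimplexCategory) (_ : k.len ≤ s) (e : n ⟶ k) (ν : k ⟶ p),
      e ≫ ν = SSet.stdSimplex.objEquiv x := by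
  let Q : (SSet.stdSimplex.{w}.obj p : SSet.{w}).Subcomplex :=
    { obj n := { x | ∃ (k : SimplexCategory) (_ : k.len ≤ s) (e : n.unop ⟶ k) (ν : k ⟶ p),
        e ≫ ν = SSet.stdSimplex.objEquiv x }
      map := by
        rintro n n' g x ⟨k, hk, e, ν, hx⟩
        refine ⟨k, hk, g.unop ≫ e, ν, ?_⟩
        rw [Category.assoc, hx]
        rfl }
  have h : (SSet.stdSimplex.obj p : SSet.{w}).skeleton (s + 1) ≤ Q :=
    iSup_le fun i => iSup_le fun y => by
      rw [SSet.Subcomplex.ofSimplex_le_iff]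
      exact ⟨⦋i⦌, Nat.le_of_lt_succ i.2, 𝟙 _, SSet.stdSimplex.objEquiv y.1, Category.id_comp _⟩
  exact h _ hx

variable (s) in
/-- The inclusion of `Δ[k]` in its `s`-skeleton, for `k ≤ s`. -/
def skeletonLift (k : SimplexCategory) (hk : k.len ≤ s) :
    (SSet.stdSimplex.obj k : SSet.{w}) ⟶ (cosimplicialSk s).obj k :=
  SSet.Subcomplex.lift (𝟙 _) (by
    have h : (SSet.stdSimplex.obj k : SSet.{w}).skeleton (s + 1) = ⊤ :=
      top_le_iff.1 ((skeleton_stdSimplex k.len).ge.trans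
        ((SSet.stdSimplex.obj k : SSet.{w}).skeleton.monotone (Nat.succ_le_succ hk)))
    rw [h]
    exact le_top)

/-- Natural maps on the `s`-skeleta are determined on the `Δ[k]` for `k ≤ s`. -/
theorem cosimplicialSk_hom_ext {f g : cosimplicialSk s ⋙ tensorLeft T ⟶ F}
    (h : ∀ (k : SimplexCategory) (hk : k.len ≤ s),
      T ◁ skeletonLift s k hk ≫ NatTrans.app f k = T ◁ skeletonLift s k hk ≫
        NatTrans.app g k) : f = g := by
  apply NatTrans.ext
  funext p
  ext ⟨n⟩ x
  obtain ⟨k, hk, e, ν, hx⟩ := exists_factor_of_mem_skeleton x.2.2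
  let y : (T ⊗ (SSet.stdSimplex.obj k : SSet.{w})).obj (op n) :=
    (x.1, SSet.stdSimplex.objEquiv.symm e)
  have hxy : (T ◁ skeletonLift s k hk ≫ T ◁ (cosimplicialSk s).map ν).app (op n) y = x := by
    refine Prod.ext rfl (Subtype.ext ?_)
    exact SSet.stdSimplex.objEquiv.injective hx
  have hf := f.naturality ν
  have hg := g.naturality ν
  change T ◁ (cosimplicialSk s).map ν ≫ NatTrans.app f p = _ at hf
  change T ◁ (cosimplicialSk s).map ν ≫ NatTrans.app g p = _ at hg
  have e1 : (T ◁ skeletonLift s k hk ≫ T ◁ (cosimplicialSk s).map ν) ≫ NatTrans.app f p =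
      (T ◁ skeletonLift s k hk ≫ T ◁ (cosimplicialSk s).map ν) ≫ NatTrans.app g p := by
    rw [Category.assoc, Category.assoc, hf, hg, reassoc_of% (h k hk)]
  have := congrArg (fun q : T ⊗ (SSet.stdSimplex.obj k : SSet.{w}) ⟶ F.obj p => q.app (op n) y) e1
  rw [← hxy]
  exact this

/-- The value on the simplex `(u, e ≫ ν)` of `T ⊗ Δ[p]` of a map which is given on `T ⊗ Δ[k]`. -/
def skeletonValue (θ : ∀ k : SimplexCategory, T ⊗ (SSet.stdSimplex.obj k : SSet.{w}) ⟶ F.obj k)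
    {n p : SimplexCategory} (u : T.obj (op n)) (k : SimplexCategory) (e : n ⟶ k) (ν : k ⟶ p) :
    (F.obj p).obj (op n) :=
  (F.map ν).app _ ((θ k).app (op n) (u, SSet.stdSimplex.objEquiv.symm e))

variable {θ : ∀ k : SimplexCategory, T ⊗ (SSet.stdSimplex.obj k : SSet.{w}) ⟶ F.obj k}

theorem skeletonValue_comp
    (hθ : ∀ (k l : SimplexCategory) (_ : k.len ≤ s) (_ : l.len ≤ s) (α : k ⟶ l),
    T ◁ SSet.stdSimplex.map α ≫ θ l = θ k ≫ F.map α) {n p k l : SimplexCategory} (hk : k.len ≤ s)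
    (hl : l.len ≤ s) (u : T.obj (op n)) (e : n ⟶ k) (α : k ⟶ l) (ν : l ⟶ p) :
    skeletonValue θ u k e (α ≫ ν) = skeletonValue θ u l (e ≫ α) ν := by
  have := congrArg (fun q : T ⊗ (SSet.stdSimplex.obj k : SSet.{w}) ⟶ F.obj l =>
    (F.map ν).app (op n) (q.app (op n) (u, SSet.stdSimplex.objEquiv.symm e))) (hθ k l hk hl α)
  refine Eq.trans ?_ this.symm
  refine congrArg (fun q : F.obj k ⟶ F.obj p =>
    q.app (op n) ((θ k).app (op n) (u, SSet.stdSimplex.objEquiv.symm e))) (F.map_comp α ν)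

/-- The value does not depend on the factorization: it can be computed with the factorization into
an epimorphism and a monomorphism. -/
theorem skeletonValue_eq_image
    (hθ : ∀ (k l : SimplexCategory) (_ : k.len ≤ s) (_ : l.len ≤ s) (α : k ⟶ l),
    T ◁ SSet.stdSimplex.map α ≫ θ l = θ k ≫ F.map α) {n p k : SimplexCategory} (hk : k.len ≤ s)
    (u : T.obj (op n)) (e : n ⟶ k) (ν : k ⟶ p) (f : n ⟶ p) (h : e ≫ ν = f) :
    skeletonValue θ u k e ν = skeletonValue θ u (image f) (factorThruImage f) (image.ι f) := by
  obtain ⟨j, e₁, e₂, he₁, he₂, rfl⟩ : ∃ (j : SimplexCategory) (e₁ : n ⟶ j) (e₂ : j ⟶ k),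
      IsSplitEpi e₁ ∧ Mono e₂ ∧ e₁ ≫ e₂ = e :=
    ⟨image e, factorThruImage e, image.ι e, isSplitEpi_of_epi _, inferInstance, image.fac e⟩
  have hf : factorThruImage f ≫ image.ι f = f := image.fac f
  have h1 : (section_ e₁ ≫ factorThruImage f) ≫ image.ι f = e₂ ≫ ν := by
    rw [Category.assoc, hf, ← h, Category.assoc, IsSplitEpi.id_assoc]
  have h2 : e₁ ≫ section_ e₁ ≫ factorThruImage f = factorThruImage f := by
    rw [← cancel_mono (image.ι f), Category.assoc, h1, hf, ← h, Category.assoc]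
  have hj : j.len ≤ s := (SimplexCategory.len_le_of_mono e₂).trans hk
  have : Epi (section_ e₁ ≫ factorThruImage f) := epi_of_epi_fac h2
  have hl : (image f).len ≤ s :=
    (SimplexCategory.len_le_of_epi (section_ e₁ ≫ factorThruImage f)).trans hj
  rw [← skeletonValue_comp hθ hj hk, ← h1, skeletonValue_comp hθ hj hl, h2]

/-- A compatible family of maps on `T ⊗ Δ[k]` for `k ≤ s` extends to the `s`-skeleta of all
simplices. -/
theorem exists_cosimplicialSk_hom (hθ : ∀ (k l : SimplexCategory) (_ : k.len ≤ s) (_ : l.len ≤ s)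
    (α : k ⟶ l), T ◁ SSet.stdSimplex.map α ≫ θ l = θ k ≫ F.map α) :
    ∃ f : cosimplicialSk s ⋙ tensorLeft T ⟶ F, ∀ (k : SimplexCategory) (hk : k.len ≤ s),
      T ◁ skeletonLift s k hk ≫ NatTrans.app f k = θ k := by
  -- the value at a simplex is computed with its image factorization
  let V (p : SimplexCategory) (n : SimplexCategoryᵒᵖ)
      (x : (T ⊗ ((SSet.stdSimplex.obj p : SSet.{w}).skeleton (s + 1) : SSet.{w})).obj n) :
        (F.obj p).obj n :=
    let f : n.unop ⟶ p := SSet.stdSimplex.objEquiv x.2.1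
    skeletonValue θ (n := n.unop) x.1 (image f) (factorThruImage f) (image.ι f)
  have hV (p : SimplexCategory) (n : SimplexCategoryᵒᵖ)
      (x : (T ⊗ ((SSet.stdSimplex.obj p : SSet.{w}).skeleton (s + 1) : SSet.{w})).obj n)
      (k : SimplexCategory) (hk : k.len ≤ s) (e : n.unop ⟶ k) (ν : k ⟶ p)
      (h : e ≫ ν = SSet.stdSimplex.objEquiv x.2.1) : V p n x =
        skeletonValue θ (n := n.unop) x.1 k e ν :=
    (skeletonValue_eq_image hθ hk _ _ _ _ h).symm
  let Φ (p : SimplexCategory) :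
      T ⊗ ((SSet.stdSimplex.obj p : SSet.{w}).skeleton (s + 1) : SSet.{w}) ⟶ F.obj p :=
    { app n := ↾fun x => V p n x
      naturality n n' g := by
        ext x
        obtain ⟨k, hk, e, ν, hx⟩ := exists_factor_of_mem_skeleton (n := n.unop) x.2.2
        refine (hV p n' ((T ⊗ ((SSet.stdSimplex.obj p : SSet.{w}).skeleton (s + 1) : SSet.{w})).map
          g x)
          k hk (g.unop ≫ e) ν ?_).trans ?_
        · rw [Category.assoc, hx]; rfl
        · refine Eq.trans ?_ (congrArg ((F.obj p).map g) (hV p n x k hk e ν hx)).symm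
          exact NatTrans.naturality_apply (θ k ≫ F.map ν) g
            ((x.1, SSet.stdSimplex.objEquiv.symm e) :
              (T ⊗ (SSet.stdSimplex.obj k : SSet.{w})).obj n) }
  refine ⟨{ app p := Φ p, naturality := fun p q α => ?_ }, fun k hk => ?_⟩
  · ext n x
    obtain ⟨k, hk, e, ν, hx⟩ := exists_factor_of_mem_skeleton (n := n.unop) x.2.2
    refine (hV q n ((T ◁ (cosimplicialSk s).map α).app n x) k hk e (ν ≫ α) ?_).trans ?_
    · rw [← Category.assoc, hx]; rfl
    · refine Eq.trans ?_ (congrArg ((F.map α).app n) (hV p n x k hk e ν hx)).symm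
      exact congrArg (fun q' : F.obj k ⟶ F.obj q => q'.app n ((θ k).app n
        ((x.1, SSet.stdSimplex.objEquiv.symm e) : (T ⊗ (SSet.stdSimplex.obj k : SSet.{w})).obj n)))
        (F.map_comp ν α)
  · ext n x
    refine (hV k n ((T ◁ skeletonLift s k hk).app n x) k hk (SSet.stdSimplex.objEquiv x.2) (𝟙 k)
      (Category.comp_id _)).trans ?_
    exact congrArg (fun q' : F.obj k ⟶ F.obj k => q'.app n ((θ k).app n x)) (F.map_id k)

end skeleton

/-! ### Simplices of the total spaces -/

section level

variable {Z : PtDiagram.{w} SimplexCategory} {s M M' : ℕ}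

/-- The map `Δ[M] ⊗ Δ[k] ⟶ Z^k`, for `k ≤ s`, which belongs to an `M`-simplex of `Tot_s Z`. -/
noncomputable def level (f : Δ[M] ⟶ Tot s Z) (k : SimplexCategory) (hk : k.len ≤ s) :
    Δ[M] ⊗ (SSet.stdSimplex.obj k : SSet.{w}) ⟶ Z.functor.obj k :=
  Δ[M] ◁ skeletonLift s k hk ≫ NatTrans.app (SSet.yonedaEquiv f) k

theorem component_eq_level (f : Δ[M] ⟶ Tot s Z) : component f = level f ⦋s⦌ le_rfl := rfl

theorem level_map_comp (u : ⦋M'⦌ ⟶ ⦋M⦌) (f : Δ[M] ⟶ Tot s Z) (k : SimplexCategory)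
    (hk : k.len ≤ s) :
    level (SSet.stdSimplex.map u ≫ f) k hk = SSet.stdSimplex.map u ▷ _ ≫ level f k hk := by
  have e : SSet.yonedaEquiv (SSet.stdSimplex.map u ≫ f) = (Tot s Z).map u.op (SSet.yonedaEquiv f) :=
    (SSet.yonedaEquiv_naturality u f).symm
  rw [level, e]
  exact whisker_exchange_assoc _ _ _

theorem level_naturality (f : Δ[M] ⟶ Tot s Z) {k l : SimplexCategory} (hk : k.len ≤ s)
    (hl : l.len ≤ s)
    (α : k ⟶ l) : Δ[M] ◁ SSet.stdSimplex.map α ≫ level f l hl = level f k hk ≫ Z.functor.map α := by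
  have h := NatTrans.naturality (SSet.yonedaEquiv f) α
  change Δ[M] ◁ (cosimplicialSk s).map α ≫ _ = _ at h
  rw [level, level, Category.assoc]
  refine Eq.trans ?_ (congrArg (Δ[M] ◁ skeletonLift s k hk ≫ ·) h)
  rfl

theorem level_res (f : Δ[M] ⟶ Tot (s + 1) Z) (k : SimplexCategory) (hk : k.len ≤ s) :
    level (f ≫ Tot.res s Z) k hk = level f k (hk.trans (Nat.le_succ s)) := rfl

theorem level_const (k : SimplexCategory) (hk : k.len ≤ s) :
    level (SSet.const (Tot.pt s Z) : Δ[M] ⟶ Tot s Z) k hk = SSet.const (Z.pt k) := rfl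

theorem level_ext {f g : Δ[M] ⟶ Tot s Z}
    (h : ∀ (k : SimplexCategory) (hk : k.len ≤ s), level f k hk = level g k hk) : f = g :=
  SSet.yonedaEquiv.injective (cosimplicialSk_hom_ext h)

/-- Simplices of `Tot_s Z` are compatible families of maps in the cosimplicial degrees `k ≤ s`. -/
theorem exists_level (θ : ∀ k : SimplexCategory,
    Δ[M] ⊗ (SSet.stdSimplex.obj k : SSet.{w}) ⟶ Z.functor.obj k)
    (hθ : ∀ (k l : SimplexCategory) (_ : k.len ≤ s) (_ : l.len ≤ s) (α : k ⟶ l),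
      Δ[M] ◁ SSet.stdSimplex.map α ≫ θ l = θ k ≫ Z.functor.map α) :
    ∃ f : Δ[M] ⟶ Tot s Z, ∀ k hk, level f k hk = θ k := by
  obtain ⟨f, hf⟩ := exists_cosimplicialSk_hom hθ
  obtain ⟨g, rfl⟩ := (SSet.yonedaEquiv (X := Tot s Z) (n := ⦋M⦌)).surjective f
  exact ⟨g, hf⟩

end level

/-! ### Naturality in low cosimplicial degrees -/

section truncated

open SimplexCategory

/-- Naturality of a family of maps on `T ⊗ Δ[k]` for `k ≤ d` can be checked on the cofaces and the
codegeneracies. -/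
theorem naturality_of_generators {T : SSet.{w}} {F : SimplexCategory ⥤ SSet.{w}} {d : ℕ}
    (θ : ∀ k : SimplexCategory, T ⊗ (SSet.stdSimplex.obj k : SSet.{w}) ⟶ F.obj k)
    (hδ : ∀ (k : ℕ) (_ : k < d) (i : Fin (k + 2)),
      T ◁ SSet.stdSimplex.δ i ≫ θ ⦋k + 1⦌ = θ ⦋k⦌ ≫ F.map (SimplexCategory.δ i))
    (hσ : ∀ (k : ℕ) (_ : k < d) (i : Fin (k + 1)),
      T ◁ SSet.stdSimplex.σ i ≫ θ ⦋k⦌ = θ ⦋k + 1⦌ ≫ F.map (SimplexCategory.σ i))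
    (k l : SimplexCategory) (hk : k.len ≤ d) (hl : l.len ≤ d) (α : k ⟶ l) :
    T ◁ SSet.stdSimplex.map α ≫ θ l = θ k ≫ F.map α := by
  let W : MorphismProperty (Truncated d) := fun a b f =>
    T ◁ SSet.stdSimplex.map f.hom ≫ θ b.obj = θ a.obj ≫ F.map f.hom
  have : W.IsMultiplicative :=
    { id_mem := fun a => by
        change T ◁ SSet.stdSimplex.map (𝟙 a.obj) ≫ θ a.obj = θ a.obj ≫ F.map (𝟙 a.obj)
        rw [F.map_id, Category.comp_id]
        have e : SSet.stdSimplex.{w}.map (𝟙 a.obj) = 𝟙 _ := CategoryTheory.Functor.map_id _ _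
        rw [e, whiskerLeft_id, Category.id_comp]
      comp_mem := fun {a b c} f g hf hg => by
        change T ◁ SSet.stdSimplex.map (f.hom ≫ g.hom) ≫ θ c.obj = θ a.obj ≫ F.map (f.hom ≫ g.hom)
        have e : SSet.stdSimplex.{w}.map (f.hom ≫ g.hom) = _ :=
          CategoryTheory.Functor.map_comp _ _ _
        rw [e, whiskerLeft_comp_assoc, F.map_comp]
        have hf' : T ◁ SSet.stdSimplex.map f.hom ≫ θ b.obj = θ a.obj ≫ F.map f.hom := hf
        have hg' : T ◁ SSet.stdSimplex.map g.hom ≫ θ c.obj = θ b.obj ≫ F.map g.hom := hg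
        rw [hg', reassoc_of% hf'] }
  have hW : W = ⊤ := Truncated.morphismProperty_eq_top W (fun n hn i => hδ n hn i)
    (fun n hn i => hσ n hn i)
  have h : W (Truncated.Hom.tr α hk hl) := by rw [hW]; trivial
  exact h

end truncated

/-! ### The differential of the tower of total spaces -/

section tower

variable {Z : PtDiagram.{w} SimplexCategory} {M M' m : ℕ}

/-- The simplex of `Z^0` which corresponds to a simplex of `Tot_0 Z`. -/
noncomputable def evalZero (f : Δ[M] ⟶ Tot 0 Z) : Δ[M] ⟶ Z.functor.obj ⦋0⦌ :=
  (exists_tens0 (level f ⦋0⦌ le_rfl)).choose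

theorem tens0_evalZero (f : Δ[M] ⟶ Tot 0 Z) : level f ⦋0⦌ le_rfl = tens0 (evalZero f) :=
  (exists_tens0 (level f ⦋0⦌ le_rfl)).choose_spec

theorem evalZero_map_comp (u : ⦋M'⦌ ⟶ ⦋M⦌) (f : Δ[M] ⟶ Tot 0 Z) :
    evalZero (SSet.stdSimplex.map u ≫ f) = SSet.stdSimplex.map u ≫ evalZero f := by
  refine tens0_injective ?_
  rw [← tens0_evalZero]
  refine (level_map_comp u f ⦋0⦌ le_rfl).trans ?_
  rw [tens0_evalZero, tens0, tens0]
  exact CartesianMonoidalCategory.whiskerRight_fst_assoc _ _ _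

theorem evalZero_δ (i : Fin (M + 2)) (f : Δ[M + 1] ⟶ Tot 0 Z) :
    evalZero (SSet.stdSimplex.δ i ≫ f) = SSet.stdSimplex.δ i ≫ evalZero f := evalZero_map_comp _ f

theorem evalZero_const :
    evalZero (SSet.const (Tot.pt 0 Z) : Δ[M] ⟶ Tot 0 Z) = SSet.const (Z.pt ⦋0⦌) :=
  tens0_injective ((tens0_evalZero _).symm.trans (SSet.comp_const _ _).symm)

/-- The simplex with trivial boundary of `Z^0` which corresponds to one of `Tot_0 Z`. -/
noncomputable def evalZeroPt (x : (Tot 0 Z).PtSimplex (m + 1) (Tot.pt 0 Z)) :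
    (Z.functor.obj ⦋0⦌).PtSimplex (m + 1) (Z.pt ⦋0⦌) :=
  ptMkδ (evalZero x.map) fun i => by rw [← evalZero_δ, x.δ_map, evalZero_const]

theorem mk_evalZeroPt {x x' : (Tot 0 Z).PtSimplex (m + 1) (Tot.pt 0 Z)} (h : pi.mk x = pi.mk x') :
    pi.mk (evalZeroPt x) = pi.mk (evalZeroPt x') := by
  refine congrArg (Quot.lift (fun x => pi.mk (evalZeroPt x)) ?_) h
  rintro x x' ⟨r⟩
  exact Quot.sound ⟨{
    map := evalZero r.map
    δ_castSucc_map := by rw [← evalZero_δ, r.δ_castSucc_map]; rfl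
    δ_succ_map := by rw [← evalZero_δ, r.δ_succ_map]; rfl
    δ_map_of_lt := fun j hj => by rw [← evalZero_δ, r.δ_map_of_lt j hj, evalZero_const]
    δ_map_of_gt := fun j hj => by rw [← evalZero_δ, r.δ_map_of_gt j hj, evalZero_const] }⟩

theorem level_δ {s : ℕ} (i : Fin (M + 2)) (f : Δ[M + 1] ⟶ Tot s Z) (k : SimplexCategory)
    (hk : k.len ≤ s) :
    level (SSet.stdSimplex.δ i ≫ f) k hk = SSet.stdSimplex.δ i ▷ _ ≫ level f k hk :=
      level_map_comp _ f k hk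

/-- The data for the differential in the tower are obstruction data for the horn of index `0`. -/
theorem TowerD2.exists_obs {x₀ : (Tot 0 Z).PtSimplex (m + 1) (Tot.pt 0 Z)}
    {z : (Tot 2 Z).PtSimplex m (Tot.pt 2 Z)} (h : TowerD2 Z (pi.mk x₀) z) :
    ∃ (g : _) (y : _) (Φ : _) (o : Obs Z 0 (vertex g) y Φ),
      component z.map = relHom.un o.z.map ∧ component x₀.map = tens0 (evalZeroPt x₀).map ∧
        pi.mk (evalZeroPt x₀) = pi.mk g := by
  obtain ⟨x, hx, θ, hθ, hθi, hθ0⟩ := h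
  have hb (k : SimplexCategory) (hk : k.len ≤ 1) (i : Fin (m + 2)) :
      SSet.stdSimplex.δ i ▷ _ ≫ level θ k (hk.trans (by decide)) = SSet.const (Z.pt k) := by
    rw [← level_res θ k hk, ← level_δ, hθ, x.δ_map, level_const]
  have hbi (i : Fin (m + 2)) (hi : i ≠ 0) :
      SSet.stdSimplex.δ i ▷ _ ≫ level θ ⦋2⦌ le_rfl = SSet.const (Z.pt ⦋2⦌) := by
    rw [← level_δ, hθi i hi, level_const]
  let a : Δ[0] ⟶ (Z.loops (m + 1)).functor.obj ⦋0⦌ := relHom.mk (level θ ⦋0⦌ (by decide))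
    (boundary_tensor_hom_ext fun i => by
      rw [← comp_whiskerRight_assoc, SSet.boundary.ι_ι, hb _ (by decide), SSet.comp_const])
  let y : Δ[1] ⟶ (Z.loops (m + 1)).functor.obj ⦋1⦌ := relHom.mk (level θ ⦋1⦌ (by decide))
    (boundary_tensor_hom_ext fun i => by
      rw [← comp_whiskerRight_assoc, SSet.boundary.ι_ι, hb _ (by decide), SSet.comp_const])
  let Φ : Δ[2] ⟶ (Z.paths (0 : Fin (m + 2))).functor.obj ⦋2⦌ := relHom.mk (level θ ⦋2⦌ (by decide))
    (horn_tensor_hom_ext fun i hi => by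
      rw [← comp_whiskerRight_assoc, SSet.horn.ι_ι, hbi _ hi, SSet.comp_const])
  obtain ⟨g, hg⟩ := exists_vertex a
  have hun : tens0 g.map = level θ ⦋0⦌ (by decide) := by
    rw [← un_vertex, ← hg]
    exact relHom.un_mk _ _
  have o : Obs Z 0 (vertex g) y Φ := by
    rw [← hg]
    refine ⟨fun k => relHom.un_injective ?_, fun k => relHom.un_injective ?_⟩
    · rw [relHom.un_comp, un_comp_functor_map, relHom.un_mk, relHom.un_mk]
      exact level_naturality θ _ _ _
    · rw [relHom.un_comp, relHom.un_mk, ← Category.assoc, un_comp_functor_map, un_comp_incl,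
        relHom.un_mk]
      exact level_naturality θ _ _ _
  refine ⟨g, y, Φ, o, ?_, tens0_evalZero _, ?_⟩
  · rw [component_eq_level, ← hθ0, level_δ]
    refine Eq.trans ?_ (un_comp_face Φ).symm
    rw [relHom.un_mk]
  · refine (mk_evalZeroPt hx).symm.trans (congrArg pi.mk (ptSimplex_ext (tens0_injective ?_)))
    refine (tens0_evalZero _).symm.trans ?_
    rw [hun]
    change level (x.map ≫ Tot.res 0 Z) ⦋0⦌ _ = _
    rw [level_res, ← hθ, level_res]

/-- In a Reedy fibrant cosimplicial space every class whose cofaces agree has data for the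
differential in the tower, coming from obstruction data which are compatible with the
codegeneracies. -/
theorem exists_towerD2 (hZ : ReedyFibrant Z.functor)
    (g : (Z.functor.obj ⦋0⦌).PtSimplex (m + 1) (Z.pt ⦋0⦌))
    {y₀ : Δ[1] ⟶ (Z.loops (m + 1)).functor.obj ⦋1⦌}
    (h : ∀ k : Fin 2, SSet.stdSimplex.δ k ≫ y₀ =
      vertex g ≫ (Z.loops (m + 1)).functor.map (SimplexCategory.δ k)) :
    ∃ (x₀ : (Tot 0 Z).PtSimplex (m + 1) (Tot.pt 0 Z)) (z : (Tot 2 Z).PtSimplex m (Tot.pt 2 Z))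
      (y : _) (Φ : _) (o : Obs Z 0 (vertex g) y Φ),
      TowerD2 Z (pi.mk x₀) z ∧ component x₀.map = tens0 g.map ∧
        component z.map = relHom.un o.z.map := by
  obtain ⟨y, hy, hyσ⟩ := exists_normalized_edge hZ h
  obtain ⟨Φ, o, hΦσ⟩ := exists_normalized_obs hZ hy hyσ 0
  -- only the degrees `k ≤ 2` matter; the value in the others is arbitrary
  let θ (k : SimplexCategory) : Δ[m + 1] ⊗ (SSet.stdSimplex.obj k : SSet.{w}) ⟶ Z.functor.obj k :=
    SimplexCategory.rec (fun n => match n with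
      | 0 => relHom.un (vertex g)
      | 1 => relHom.un y
      | 2 => relHom.un Φ
      | n + 3 => SSet.const (Z.pt ⦋n + 3⦌)) k
  have hδ : ∀ (k : ℕ) (_ : k < 2) (i : Fin (k + 2)),
      Δ[m + 1] ◁ SSet.stdSimplex.δ i ≫ θ ⦋k + 1⦌ = θ ⦋k⦌ ≫ Z.functor.map (SimplexCategory.δ i) := by
    intro k hk i
    obtain _ | _ | k := k
    · have := congrArg relHom.un (o.δ_y i)
      rwa [relHom.un_comp, un_comp_functor_map] at this
    · have := congrArg relHom.un (o.δ_Φ i)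
      rwa [relHom.un_comp, ← Category.assoc, un_comp_functor_map, un_comp_incl] at this
    · omega
  have hσ : ∀ (k : ℕ) (_ : k < 2) (i : Fin (k + 1)),
      Δ[m + 1] ◁ SSet.stdSimplex.σ i ≫ θ ⦋k⦌ = θ ⦋k + 1⦌ ≫ Z.functor.map (SimplexCategory.σ i) := by
    intro k hk i
    obtain _ | _ | k := k
    · obtain rfl : i = 0 := Subsingleton.elim (α := Fin 1) _ _
      have := congrArg relHom.un hyσ
      rw [un_comp_functor_map, relHom.un_comp] at this
      exact this.symm
    · exact (hΦσ i).symm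
    · omega
  obtain ⟨f, hf⟩ := exists_level (s := 2) θ (naturality_of_generators θ hδ hσ)
  have hcases (k : SimplexCategory) (P : SimplexCategory → Prop) (h0 : P ⦋0⦌) (h1 : P ⦋1⦌)
      (h2 : 2 ≤ k.len → P ⦋2⦌) (hk : k.len ≤ 2) : P k := by
    induction k using SimplexCategory.rec with
    | _ n =>
      obtain _ | _ | _ | n := n
      · exact h0
      · exact h1
      · exact h2 le_rfl
      · exact absurd hk (by simp)
  have hb0 (i : Fin (m + 2)) : SSet.stdSimplex.δ i ▷ _ ≫ θ ⦋0⦌ = SSet.const (Z.pt ⦋0⦌) :=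
    δ_whiskerRight_un (vertex g) i
  have hb1 (i : Fin (m + 2)) : SSet.stdSimplex.δ i ▷ _ ≫ θ ⦋1⦌ = SSet.const (Z.pt ⦋1⦌) :=
    δ_whiskerRight_un y i
  have hfi (i : Fin (m + 2)) (hi : i ≠ 0) : SSet.stdSimplex.δ i ≫ f = SSet.const (Tot.pt 2 Z) := by
    refine level_ext fun k hk => ?_
    rw [level_const, level_δ, hf]
    exact hcases k (fun k => SSet.stdSimplex.δ i ▷ _ ≫ θ k = SSet.const (Z.pt k)) (hb0 i) (hb1 i)
      (fun _ => δ_whiskerRight_un_horn Φ i hi) hk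
  have hx (i : Fin (m + 2)) : SSet.stdSimplex.δ i ≫ f ≫ Tot.res 1 Z = SSet.const (Tot.pt 1 Z) := by
    refine level_ext fun k hk => ?_
    rw [level_const, level_δ, level_res, hf]
    exact hcases k (fun k => SSet.stdSimplex.δ i ▷ _ ≫ θ k = SSet.const (Z.pt k)) (hb0 i) (hb1 i)
      (fun h => absurd (h.trans hk) (by decide)) (hk.trans (by decide))
  have hz : (∂Δ[m] : (Δ[m] : SSet.{w}).Subcomplex).ι ≫ SSet.stdSimplex.δ 0 ≫ f =
      SSet.const (Tot.pt 2 Z) := by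
    obtain _ | m := m
    · exact SSet.boundary.hom_ext₀
    · refine SSet.boundary.hom_ext fun i => ?_
      have e : SSet.stdSimplex.{w}.δ i ≫ SSet.stdSimplex.δ (0 : Fin (m + 3)) =
          SSet.stdSimplex.δ (0 : Fin (m + 2)) ≫ SSet.stdSimplex.δ i.succ :=
        (SSet.stdSimplex.δ_comp_δ (i := (0 : Fin (m + 2))) (j := i) (Fin.zero_le _)).symm
      rw [SSet.boundary.ι_ι_assoc, reassoc_of% e, hfi _ (Fin.succ_ne_zero _), SSet.comp_const,
        SSet.comp_const]
  let x : (Tot 1 Z).PtSimplex (m + 1) (Tot.pt 1 Z) := ptMkδ (f ≫ Tot.res 1 Z) hx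
  refine ⟨mapPt (Tot.res 0 Z) (Tot.res_pt 0 Z) x, ptMk (SSet.stdSimplex.δ 0 ≫ f) hz, y, Φ, o,
    ⟨x, rfl, f, rfl, hfi, rfl⟩, ?_, ?_⟩
  · rw [component_eq_level]
    change level (x.map ≫ Tot.res 0 Z) _ _ = _
    rw [level_res]
    change level (f ≫ Tot.res 1 Z) _ _ = _
    rw [level_res, hf]
    exact un_vertex g
  · rw [component_eq_level]
    change level (SSet.stdSimplex.δ 0 ≫ f) _ _ = _
    rw [level_δ, hf]
    exact (un_comp_face Φ).symm

end tower

/-! ### Comparison along a levelwise weak equivalence -/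

section map

variable {m : ℕ} {K L : SSet.{w}} {k : K _⦋0⦌} {l : L _⦋0⦌}

/-- Naturality of `vertex`. -/
theorem vertex_comp_map (g : K.PtSimplex m k) (φ : K ⟶ L) (h : φ.app _ k = l) :
    vertex g ≫ relHom.map _ φ h = vertex (mapPt φ h g) :=
  relHom.un_injective (by
    rw [relHom.un_comp_map, un_vertex, un_vertex, tens0, Category.assoc]
    rfl)

/-- Simplices in the same homotopy class are connected by an edge of the loop complex. -/
theorem exists_edge [SSet.KanComplex K] {f g : K.PtSimplex (m + 1) k} (h : pi.mk f = pi.mk g) :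
    ∃ W : Δ[1] ⟶ loops (m + 1) K k,
      SSet.stdSimplex.δ 1 ≫ W = vertex f ∧ SSet.stdSimplex.δ 0 ≫ W = vertex g := by
  obtain ⟨H⟩ := homotopy_of_isBd (pi.mk_eq_mk.1 h)
  refine ⟨relHom.mk H.h (homotopy_rel H), relHom.un_injective ?_, relHom.un_injective ?_⟩
  · rw [relHom.un_comp, relHom.un_mk, un_vertex, homotopy_δ_one]
  · rw [relHom.un_comp, relHom.un_mk, un_vertex, homotopy_δ_zero]

variable {Y Z : PtDiagram.{w} SimplexCategory}

/-- The map induced by a morphism of pointed diagrams. -/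
noncomputable abbrev PtDiagram.Hom.relHom (r : Y.Hom Z) {B : SSet.{w}} (A : B.Subcomplex)
    (d : SimplexCategory) : (Y.relHom A).functor.obj d ⟶ (Z.relHom A).functor.obj d :=
  CechDiff.relHom.map A (r.hom.app d) (r.hom_pt d)

theorem PtDiagram.Hom.relHom_naturality (r : Y.Hom Z) {B T : SSet.{w}} {A : B.Subcomplex}
    {d e : SimplexCategory} (f : d ⟶ e) (g : T ⟶ (Y.relHom A).functor.obj d) :
    (g ≫ (Y.relHom A).functor.map f) ≫ r.relHom A e = (g ≫ r.relHom A d) ≫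
      (Z.relHom A).functor.map f :=
  CechDiff.relHom.un_injective (by
    rw [CechDiff.relHom.un_comp_map, un_comp_functor_map, un_comp_functor_map,
      CechDiff.relHom.un_comp_map, Category.assoc, Category.assoc, r.hom.naturality])

/-- The image of obstruction data under a morphism. -/
theorem Obs.map {n : Fin (m + 2)} {a : Δ[0] ⟶ (Y.loops (m + 1)).functor.obj ⦋0⦌}
    {y : Δ[1] ⟶ (Y.loops (m + 1)).functor.obj ⦋1⦌} {Φ : Δ[2] ⟶ (Y.paths n).functor.obj ⦋2⦌}
    (o : Obs Y n a y Φ) (r : Y.Hom Z) :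
    Obs Z n (a ≫ r.relHom _ _) (y ≫ r.relHom _ _) (Φ ≫ r.relHom _ _) where
  δ_y k := by
    rw [← r.relHom_naturality, ← o.δ_y, Category.assoc]
  δ_Φ k := relHom.un_injective (by
    have := congrArg relHom.un (o.δ_Φ k)
    rw [relHom.un_comp, ← Category.assoc, un_comp_functor_map, un_comp_incl] at this
    rw [relHom.un_comp, relHom.un_comp_map, ← Category.assoc, this, ← Category.assoc,
      un_comp_functor_map, un_comp_incl, relHom.un_comp_map, Category.assoc, Category.assoc,
      r.hom.naturality])

theorem Obs.mk_map_z {n : Fin (m + 2)} {a : Δ[0] ⟶ (Y.loops (m + 1)).functor.obj ⦋0⦌}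
    {y : Δ[1] ⟶ (Y.loops (m + 1)).functor.obj ⦋1⦌} {Φ : Δ[2] ⟶ (Y.paths n).functor.obj ⦋2⦌}
    (o : Obs Y n a y Φ) (r : Y.Hom Z) :
    pi.mk (o.map r).z = piMap 2 (r.relHom _ _) (relHom.map_pt _ (r.hom_pt _)) (pi.mk o.z) := by
  refine congrArg pi.mk (ptSimplex_ext (relHom.un_injective ?_))
  refine (un_comp_face _).trans ?_
  refine Eq.trans ?_ (relHom.un_comp_map _ (r.hom_pt _) _).symm
  rw [relHom.un_comp_map]
  exact (Category.assoc _ _ _).symm.trans (congrArg (· ≫ _) (un_comp_face Φ).symm)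

theorem piMap_comp {t : ℕ} {K₁ K₂ K₃ K₄ : SSet.{w}} {k₁ : K₁ _⦋0⦌} {k₂ : K₂ _⦋0⦌} {k₃ : K₃ _⦋0⦌}
    {k₄ : K₄ _⦋0⦌} {f : K₁ ⟶ K₂} {g : K₂ ⟶ K₄} {f' : K₁ ⟶ K₃} {g' : K₃ ⟶ K₄} (e : f ≫ g = f' ≫ g')
    (hf : f.app _ k₁ = k₂) (hg : g.app _ k₂ = k₄) (hf' : f'.app _ k₁ = k₃) (hg' : g'.app _ k₃ = k₄)
    (c : pi t K₁ k₁) : piMap t g hg (piMap t f hf c) = piMap t g' hg' (piMap t f' hf' c) := by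
  obtain ⟨x, rfl⟩ := pi.mk_surjective c
  refine congrArg pi.mk (ptSimplex_ext ?_)
  change (x.map ≫ f) ≫ g = (x.map ≫ f') ≫ g'
  rw [Category.assoc, e, Category.assoc]

variable [SSet.KanComplex (Y.functor.obj ⦋2⦌)]
  [SSet.KanComplex (Z.functor.obj ⦋0⦌)] [SSet.KanComplex (Z.functor.obj ⦋1⦌)]
  [SSet.KanComplex (Z.functor.obj ⦋2⦌)]

/-- Obstructions in weakly equivalent cosimplicial spaces, for corresponding homotopy classes,
differ by a coboundary. -/
theorem Obs.exists_coboundary_of_hom (r : Y.Hom Z)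
    (hr : ∀ p, Function.Bijective (piMap (m + 2) (r.hom.app p) (r.hom_pt p)))
    {n : Fin (m + 2)} {g : (Y.functor.obj ⦋0⦌).PtSimplex (m + 1) (Y.pt ⦋0⦌)}
    {y : Δ[1] ⟶ (Y.loops (m + 1)).functor.obj ⦋1⦌} {Φ : Δ[2] ⟶ (Y.paths n).functor.obj ⦋2⦌}
    (o : Obs Y n (vertex g) y Φ) {g' : (Z.functor.obj ⦋0⦌).PtSimplex (m + 1) (Z.pt ⦋0⦌)}
    {y' : Δ[1] ⟶ (Z.loops (m + 1)).functor.obj ⦋1⦌} {Φ' : Δ[2] ⟶ (Z.paths n).functor.obj ⦋2⦌}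
    (o' : Obs Z n (vertex g') y' Φ')
    (hg : piMap (m + 1) (r.hom.app ⦋0⦌) (r.hom_pt _) (pi.mk g) = pi.mk g')
    {e e' : pi (m + 2) (Y.functor.obj ⦋2⦌) (Y.pt ⦋2⦌)} (he : kappa m _ _ e = pi.mk o.z)
    (he' : kappa m _ _ (piMap (m + 2) (r.hom.app ⦋2⦌) (r.hom_pt _) e') = pi.mk o'.z) :
    ∃ η : pi (m + 2) (Y.functor.obj ⦋1⦌) (Y.pt ⦋1⦌),
      e' * piMap (m + 2) (Y.functor.map (SimplexCategory.δ (1 : Fin 3))) (Y.map_pt _) η =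
        e * piMap (m + 2) (Y.functor.map (SimplexCategory.δ (0 : Fin 3))) (Y.map_pt _) η *
          piMap (m + 2) (Y.functor.map (SimplexCategory.δ (2 : Fin 3))) (Y.map_pt _) η := by
  obtain ⟨W, hW1, hW0⟩ := exists_edge (f := mapPt (r.hom.app ⦋0⦌) (r.hom_pt _) g) (g := g') hg
  obtain ⟨ζ, hζ⟩ := (o.map r).exists_coboundary o' W
    (hW1.trans (vertex_comp_map g _ (r.hom_pt _)).symm) hW0
  obtain ⟨ζ', rfl⟩ := (kappa_bijective (m := m)).2 ζ
  obtain ⟨η, rfl⟩ := (hr ⦋1⦌).2 ζ'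
  have key (k : Fin 3) : loopsMap Z m (SimplexCategory.δ k)
      (kappa m _ _ (piMap (m + 2) (r.hom.app ⦋1⦌) (r.hom_pt _) η)) =
      kappa m _ _ (piHom (m + 1) (r.hom.app ⦋2⦌) (r.hom_pt _)
        (piMap (m + 2) (Y.functor.map (SimplexCategory.δ k)) (Y.map_pt _) η)) := by
    refine (kappa_piMap _ (Z.map_pt _) _).symm.trans (congrArg (kappa m _ _) ?_)
    exact piMap_comp (r.hom.naturality _).symm _ _ _ _ _
  have he2 : pi.mk (o.map r).z = kappa m _ _ (piHom (m + 1) (r.hom.app ⦋2⦌) (r.hom_pt _) e) := by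
    rw [o.mk_map_z, ← he]
    exact (kappa_piMap _ (r.hom_pt _) _).symm
  have he2' : pi.mk o'.z = kappa m _ _ (piHom (m + 1) (r.hom.app ⦋2⦌) (r.hom_pt _) e') := he'.symm
  rw [key, key, key, he2, he2', ← map_mul, ← map_mul, ← map_mul, ← map_mul, ← map_mul,
    ← map_mul] at hζ
  exact ⟨η, (hr ⦋2⦌).1 ((kappa_bijective (m := m)).1 hζ)⟩

end map

/-! ### The cohomology class of the obstruction -/

section obsClass

variable {C : Type u} [Category.{v} C] {X : PtDiagram.{w} Cᵒᵖ}
  {U : SimplicialObject (FormalCoproduct.{w} C)} [∀ V, SSet.KanComplex (X.functor.obj V)] {m : ℕ}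

/-- The components of the obstruction form a Čech cocycle. -/
theorem Obs.components_mem_cechZ2 {n : Fin (m + 2)}
    {a : Δ[0] ⟶ ((X.cosimplicial U).loops (m + 1)).functor.obj ⦋0⦌}
    {y : Δ[1] ⟶ ((X.cosimplicial U).loops (m + 1)).functor.obj ⦋1⦌}
    {Φ : Δ[2] ⟶ ((X.cosimplicial U).paths n).functor.obj ⦋2⦌} (o : Obs (X.cosimplicial U) n a y Φ)
    {e : pi (m + 2) ((X.cosimplicial U).functor.obj ⦋2⦌) ((X.cosimplicial U).pt ⦋2⦌)}
    (he : kappa m _ _ e = pi.mk o.z) : components X U (m + 1) 2 e ∈ cechZ2 X U m := by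
  have h := o.cocycle
  have key (k : Fin 4) : loopsMap (X.cosimplicial U) m (SimplexCategory.δ k) (pi.mk o.z) =
      kappa m _ _ (cofaceHom X U (m + 1) 2 k e) := by
    rw [← he]
    exact (kappa_piMap _ ((X.cosimplicial U).map_pt _) _).symm
  rw [key, key, key, key, ← map_mul, ← map_mul] at h
  have h' := congrArg (components X U (m + 1) 3) (kappa_injective h)
  rw [map_mul, map_mul] at h'
  rw [MonoidHom.mem_ker, cobd_two, coface_components, coface_components, coface_components,
    coface_components, mul_inv_eq_one, ← div_eq_mul_inv, div_mul_eq_mul_div, div_eq_iff_eq_mul, h',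
      mul_comm]

/-- Cocycles which differ by the coboundary of the components of `η` have the same class. -/
theorem mk_eq_mk_of_coboundary {c c' : cechZ2 X U m}
    {e e' : pi (m + 2) ((X.cosimplicial U).functor.obj ⦋2⦌) ((X.cosimplicial U).pt ⦋2⦌)}
    (he : components X U (m + 1) 2 e = c.1) (he' : components X U (m + 1) 2 e' = c'.1)
    {η : pi (m + 2) ((X.cosimplicial U).functor.obj ⦋1⦌) ((X.cosimplicial U).pt ⦋1⦌)}
    (h : e' * cofaceHom X U (m + 1) 1 1 η =
      e * cofaceHom X U (m + 1) 1 0 η * cofaceHom X U (m + 1) 1 2 η) :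
    (c : CechH2 X U m) = c' := by
  rw [QuotientGroup.eq, Subgroup.mem_subgroupOf]
  refine ⟨components X U (m + 1) 1 η, ?_⟩
  rw [cobd_one, coface_components, coface_components, coface_components]
  have h' := congrArg (components X U (m + 1) 2) h
  rw [map_mul, map_mul, map_mul, he, he'] at h'
  change _ = c.1⁻¹ * c'.1
  rw [eq_mul_inv_of_mul_eq h', ← mul_assoc, ← mul_assoc, inv_mul_cancel_left]
  exact mul_right_comm _ _ _

/-- The class `b` is obtained from a representative of the class `a` by a choice of homotopies on
the double intersections and of a filling on the triple intersections. -/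
def IsObsClass (a : cechH0 X U m) (b : CechH2 X U m) : Prop :=
  ∃ (g : _) (y : _) (Φ : _) (o : Obs (X.cosimplicial U) 0 (vertex g) y Φ)
    (e : pi (m + 2) ((X.cosimplicial U).functor.obj ⦋2⦌) ((X.cosimplicial U).pt ⦋2⦌))
    (c : cechZ2 X U m), components X U m 0 (pi.mk g) = a.1 ∧ kappa m _ _ e = pi.mk o.z ∧
      components X U (m + 1) 2 e = c.1 ∧ (c : CechH2 X U m) = b

/-- The cofaces of an element of `Ȟ⁰` agree, so representatives of them are connected by an edge. -/
theorem exists_obs_edge (a : cechH0 X U m) {g : _} (hg : components X U m 0 (pi.mk g) = a.1) :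
    ∃ y : Δ[1] ⟶ ((X.cosimplicial U).loops (m + 1)).functor.obj ⦋1⦌,
      ∀ k : Fin 2, SSet.stdSimplex.δ k ≫ y =
        vertex g ≫ ((X.cosimplicial U).loops (m + 1)).functor.map (SimplexCategory.δ k) := by
  have h : coface X U m 0 1 a.1 = coface X U m 0 0 a.1 := a.2
  rw [← hg, coface_components, coface_components] at h
  obtain ⟨W, h1, h0⟩ := exists_edge (components_injective h)
  refine ⟨W, fun k => ?_⟩
  fin_cases k
  · exact h0.trans (vertex_comp_map _ _ _).symm
  · exact h1.trans (vertex_comp_map _ _ _).symm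

theorem exists_isObsClass (a : cechH0 X U m) : ∃ b, IsObsClass a b := by
  obtain ⟨e₀, he₀⟩ := components_surjective a.1
  obtain ⟨g, rfl⟩ := pi.mk_surjective e₀
  obtain ⟨y, hy⟩ := exists_obs_edge a he₀
  obtain ⟨Φ, o⟩ := exists_obs (0 : Fin (m + 2)) hy
  obtain ⟨e, he⟩ := kappa_surjective (pi.mk o.z)
  exact ⟨_, g, y, Φ, o, e, ⟨_, o.components_mem_cechZ2 he⟩, he₀, he, rfl, rfl⟩

/-- The identity morphism of a pointed diagram. -/
def PtDiagram.Hom.id {D : Type u} [Category.{v} D] (Y : PtDiagram.{w} D) : Y.Hom Y where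
  hom := 𝟙 _
  hom_pt _ := rfl

theorem piMap_id {t : ℕ} {K : SSet.{w}} {k : K _⦋0⦌} (h : (𝟙 K : K ⟶ K).app _ k = k)
    (c : pi t K k) :
    piMap t (𝟙 K) h c = c := by
  obtain ⟨x, rfl⟩ := pi.mk_surjective c
  rfl

/-- The class `b` is independent of all the choices. -/
theorem IsObsClass.unique {a : cechH0 X U m} {b b' : CechH2 X U m} (h : IsObsClass a b)
    (h' : IsObsClass a b') : b = b' := by
  obtain ⟨g, y, Φ, o, e, c, hg, he, hc, rfl⟩ := h
  obtain ⟨g', y', Φ', o', e', c', hg', he', hc', rfl⟩ := h'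
  have hgg : (pi.mk g : pi (m + 1) _ _) = pi.mk g' := components_injective (hg.trans hg'.symm)
  obtain ⟨η, hη⟩ := o.exists_coboundary_of_hom (PtDiagram.Hom.id _) (fun p => by
    have : piMap (m + 2) ((PtDiagram.Hom.id (X.cosimplicial U)).hom.app p)
      ((PtDiagram.Hom.id (X.cosimplicial U)).hom_pt p) = _root_.id := funext fun c => piMap_id _ c
    rw [this]
    exact Function.bijective_id) o' ((piMap_id _ _).trans hgg) he
    ((congrArg _ (piMap_id _ _)).trans he')
  exact mk_eq_mk_of_coboundary hc hc' hη

end obsClass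

/-! ### Identification with the differential of the spectral sequence -/

section spectral

variable {C : Type u} [Category.{v} C] {X : PtDiagram.{w} Cᵒᵖ}
  {U : SimplicialObject (FormalCoproduct.{w} C)} [∀ V, SSet.KanComplex (X.functor.obj V)] {m : ℕ}

theorem IsWeakEquiv.bijective {A B : SSet.{w}} {f : A ⟶ B} (hf : IsWeakEquiv f) (n : ℕ) {a : A _⦋0⦌}
    {b : B _⦋0⦌} (h : f.app _ a = b) : Function.Bijective (piMap n f h) := by
  subst h
  exact hf n a

/-- The class represented by the map adjoint to a `2`-simplex of the loop complex. -/
theorem represents_un_iff {K : SSet.{w}} {k : K _⦋0⦌} [SSet.KanComplex K]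
    (f : (loops m K k).PtSimplex 2 (relHom.pt _ K k)) {c : pi (m + 2) K k} :
    Represents (relHom.un f.map) c ↔ kappa m K k c = pi.mk f := by
  have h' : Δ[m] ◁ (∂Δ[2] : (Δ[2] : SSet.{w}).Subcomplex).ι ≫ relHom.un f.map = SSet.const k := by
    rw [← relHom.un_comp, ptSimplex_comm, relHom.un_const]
  rw [represents_two_iff (relHom.whiskerRight_un f.map) h', curryPt_un]

/-- The differential of the tower of total spaces is the one computed in `X_U`. -/
theorem isSpectralD2_iff {Z : PtDiagram.{w} SimplexCategory} (hZ : ReedyFibrant Z.functor)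
    (r : (X.cosimplicial U).Hom Z) (hr : ∀ p, IsWeakEquiv (r.hom.app p)) (a : cechH0 X U m)
    (b : CechH2 X U m) : IsSpectralD2 r a b ↔ IsObsClass a b := by
  have := hZ.kanComplex_zero
  have := hZ.kanComplex_one
  have := hZ.kanComplex_two
  have hb (p : SimplexCategory) := (hr p).bijective (m + 2) (r.hom_pt p)
  obtain ⟨e₀, he₀⟩ := components_surjective a.1
  obtain ⟨g, rfl⟩ := pi.mk_surjective e₀
  obtain ⟨y, hy⟩ := exists_obs_edge a he₀
  obtain ⟨Φ, o⟩ := exists_obs (0 : Fin (m + 2)) hy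
  obtain ⟨e, he⟩ := kappa_surjective (pi.mk o.z)
  have hc := o.components_mem_cechZ2 he
  constructor
  · rintro ⟨e', x₀, z, e₂, c, he', hx₀, hD, hz, hc', rfl⟩
    obtain rfl : e' = pi.mk g := components_injective ((hasComponents_iff.1 he').trans he₀.symm)
    obtain ⟨g', y', Φ', o', hzo, hx, hg'⟩ := hD.exists_obs
    rw [hzo] at hz
    rw [hx] at hx₀
    obtain ⟨g'', hg'', hg3⟩ := represents_zero_iff.1 hx₀
    have h1 := ptSimplex_ext (tens0_injective hg'')
    rw [h1] at hg'
    obtain ⟨η, hη⟩ := o.exists_coboundary_of_hom r hb o' (hg3.symm.trans hg') he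
      ((represents_un_iff _).1 hz)
    exact ⟨g, y, Φ, o, e, ⟨_, hc⟩, he₀, he, rfl,
      mk_eq_mk_of_coboundary rfl (hasComponents_iff.1 hc') hη⟩
  · intro h
    -- the image of the edge `y` in `Z`, normalized, gives data in the tower; the class which their
    -- obstruction represents differs from that of `o` by a coboundary
    obtain ⟨x₀, z, y', Φ', o', hD, hx, hz⟩ :=
      exists_towerD2 hZ (mapPt (r.hom.app ⦋0⦌) (r.hom_pt _) g)
      (y₀ := y ≫ r.relHom _ _) (fun k => by
        have h1 := (o.map r).δ_y k
        refine h1.trans (congrArg (· ≫ _) ?_)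
        exact vertex_comp_map _ _ _)
    obtain ⟨e'', he''⟩ := kappa_surjective (pi.mk o'.z)
    obtain ⟨e', rfl⟩ := (hb ⦋2⦌).2 e''
    obtain ⟨η, hη⟩ := o.exists_coboundary_of_hom r hb o' rfl he he''
    have hη' := hη
    rw [← eq_mul_inv_iff_mul_eq] at hη'
    have hc' : components X U (m + 1) 2 e' ∈ cechZ2 X U m := by
      have h1 : components X U (m + 1) 2 e' = components X U (m + 1) 2 e *
          cobd X U m 1 (components X U (m + 1) 1 η) := by
        rw [hη', cobd_one, coface_components, coface_components, coface_components]
        rw [map_mul, map_mul, map_mul, map_inv, mul_assoc, mul_assoc, mul_assoc]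
        exact congrArg _ (congrArg _ (mul_comm _ _))
      rw [h1]
      exact mul_mem hc (MonoidHom.mem_ker.2 (cobd_cobd _))
    refine ⟨pi.mk g, x₀, z, e', ⟨_, hc'⟩, hasComponents_iff.2 he₀, ?_, hD, ?_,
      hasComponents_iff.2 rfl, ?_⟩
    · rw [hx]
      exact represents_zero_iff.2 ⟨_, rfl, rfl⟩
    · rw [hz]
      exact (represents_un_iff _).2 he''
    · have h1 : IsObsClass a (((⟨_, hc⟩ : cechZ2 X U m)) : CechH2 X U m) :=
        ⟨g, y, Φ, o, e, ⟨_, hc⟩, he₀, he, rfl, rfl⟩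
      rw [h.unique h1]
      exact (mk_eq_mk_of_coboundary rfl rfl hη).symm

end spectral

/-! ### Obstruction data in terms of maps on products of simplices -/

section un

variable {Y : PtDiagram.{w} SimplexCategory} {m : ℕ} {n : Fin (m + 2)}

theorem δ_comp_iff {g : (Y.functor.obj ⦋0⦌).PtSimplex (m + 1) (Y.pt ⦋0⦌)}
    {y : Δ[1] ⟶ (Y.loops (m + 1)).functor.obj ⦋1⦌} (k : Fin 2) :
    SSet.stdSimplex.δ k ≫ y = vertex g ≫ (Y.loops (m + 1)).functor.map (SimplexCategory.δ k) ↔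
      Δ[m + 1] ◁ SSet.stdSimplex.δ k ≫ relHom.un y =
        tens0 g.map ≫ Y.functor.map (SimplexCategory.δ k) := by
  rw [← relHom.un_comp, ← un_vertex, ← un_comp_functor_map]
  exact ⟨congrArg relHom.un, fun h => relHom.un_injective h⟩

theorem δ_comp_eq_comp_incl_iff {y : Δ[1] ⟶ (Y.loops (m + 1)).functor.obj ⦋1⦌}
    {Φ : Δ[2] ⟶ (Y.paths n).functor.obj ⦋2⦌} (k : Fin 3) :
    SSet.stdSimplex.δ k ≫ Φ = y ≫ Y.incl n _ ≫ (Y.paths n).functor.map (SimplexCategory.δ k) ↔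
      Δ[m + 1] ◁ SSet.stdSimplex.δ k ≫ relHom.un Φ =
        relHom.un y ≫ Y.functor.map (SimplexCategory.δ k) := by
  rw [← un_comp_incl (n := n), ← un_comp_functor_map, ← relHom.un_comp, Category.assoc]
  exact ⟨congrArg relHom.un, fun h => relHom.un_injective h⟩

end un

/-! ### Spheres, homotopies and fills -/

section sphere

variable {C : Type u} [Category.{v} C] {X : PtDiagram.{w} Cᵒᵖ}
  {U : SimplicialObject (FormalCoproduct.{w} C)} {m : ℕ}

/-- The edge of the loops on `X_U^1` given by a family of homotopies. -/
noncomputable def homotopyEdge {δ : Sphere X U (m + 1)} (y : δ.Homotopies) :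
    Δ[1] ⟶ ((X.cosimplicial U).loops (m + 1)).functor.obj ⦋1⦌ :=
  relHom.mk (evalLift fun a => (y a).h) (eval_hom_ext fun a => homotopy_rel (y a))

theorem un_homotopyEdge {δ : Sphere X U (m + 1)} (y : δ.Homotopies) :
    relHom.un (homotopyEdge y) = evalLift fun a => (y a).h := relHom.un_mk _ _

theorem δ_homotopyEdge {δ : Sphere X U (m + 1)} (y : δ.Homotopies) (k : Fin 2) :
    SSet.stdSimplex.δ k ≫ homotopyEdge y = vertex (evalPt δ) ≫
      ((X.cosimplicial U).loops (m + 1)).functor.map (SimplexCategory.δ k) := by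
  refine (δ_comp_iff k).2 ((congrArg (_ ◁ _ ≫ ·) (un_homotopyEdge y)).trans
    (eval_hom_ext fun a => ?_))
  fin_cases k
  · exact homotopy_δ_zero (y a)
  · exact homotopy_δ_one (y a)

theorem IsBoundaryMap.unique {δ : Sphere X U (m + 1)} {y : δ.Homotopies} {w w' : _}
    (h : IsBoundaryMap y w) (h' : IsBoundaryMap y w') : w' = w :=
  tensor_boundary_hom_ext fun k => eval_hom_ext fun b => (h' k b).trans (h k b).symm

theorem Obs.isBoundaryMap {δ : Sphere X U (m + 1)} {y : δ.Homotopies} {n : Fin (m + 2)}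
    {Φ : Δ[2] ⟶ ((X.cosimplicial U).paths n).functor.obj ⦋2⦌}
    (o : Obs (X.cosimplicial U) n (vertex (evalPt δ)) (homotopyEdge y) Φ) :
    IsBoundaryMap y (Δ[m + 1] ◁ (∂Δ[2] : (Δ[2] : SSet.{w}).Subcomplex).ι ≫ relHom.un Φ) := by
  intro k b
  have h := ((δ_comp_eq_comp_incl_iff k).1 (o.δ_Φ k)).trans (congrArg (· ≫ _) (un_homotopyEdge y))
  have h' : Δ[m + 1] ◁ SSet.boundary.ι k ≫
      Δ[m + 1] ◁ (∂Δ[2] : (Δ[2] : SSet.{w}).Subcomplex).ι ≫ relHom.un Φ =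
        Δ[m + 1] ◁ SSet.stdSimplex.δ k ≫ relHom.un Φ := by
    rw [← whiskerLeft_comp_assoc, SSet.boundary.ι_ι]
  exact (Category.assoc _ _ _).symm.trans
    (congrArg (· ≫ evalProj X.functor (U _⦋2⦌) b) (h'.trans h))

/-- Obstruction data are fills of the boundary map relative to `Λ[m + 1, n]`. -/
theorem Obs.isFill {δ : Sphere X U (m + 1)} {y : δ.Homotopies} {n : Fin (m + 2)}
    {Φ : Δ[2] ⟶ ((X.cosimplicial U).paths n).functor.obj ⦋2⦌}
    (o : Obs (X.cosimplicial U) n (vertex (evalPt δ)) (homotopyEdge y) Φ) {w : _}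
    (hw : IsBoundaryMap y w) : IsFill n w (relHom.un Φ) :=
  ⟨hw.unique o.isBoundaryMap, relHom.whiskerRight_un Φ⟩

/-- Fills of the boundary map relative to `Λ[m + 1, n]` are obstruction data. -/
theorem IsFill.obs {δ : Sphere X U (m + 1)} {y : δ.Homotopies} {n : Fin (m + 2)} {w Φ : _}
    (hw : IsBoundaryMap y w) (h : IsFill n w Φ) :
    Obs (X.cosimplicial U) n (vertex (evalPt δ)) (homotopyEdge y) (relHom.mk Φ h.2) := by
  refine ⟨δ_homotopyEdge y, fun k => (δ_comp_eq_comp_incl_iff k).2 ?_⟩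
  have h' : Δ[m + 1] ◁ SSet.stdSimplex.δ k ≫ Φ = Δ[m + 1] ◁ SSet.boundary.ι k ≫ w := by
    rw [← SSet.boundary.ι_ι, whiskerLeft_comp_assoc, h.1]
  refine (congrArg (_ ◁ _ ≫ ·) (relHom.un_mk _ _)).trans (h'.trans ?_)
  refine Eq.trans ?_ (congrArg (· ≫ _) (un_homotopyEdge y)).symm
  exact eval_hom_ext fun b => hw k b

theorem represents_un_comp_iff {K L : SSet.{w}} [SSet.KanComplex K] [SSet.KanComplex L] {k : K _⦋0⦌}
    {l : L _⦋0⦌} (f : (loops m K k).PtSimplex 2 (relHom.pt _ K k)) {e : pi (m + 2) K k}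
    (he : kappa m K k e = pi.mk f) (φ : K ⟶ L) (h : φ.app _ k = l) {c : pi (m + 2) L l} :
    Represents (relHom.un f.map ≫ φ) c ↔ c = piMap (m + 2) φ h e := by
  have h1 : relHom.un f.map ≫ φ = relHom.un (mapPt (relHom.map _ φ h) (relHom.map_pt φ h) f).map :=
    (relHom.un_comp_map φ h f.map).symm
  have h2 := kappa_piMap φ h e
  rw [he] at h2
  rw [h1, represents_un_iff]
  exact ⟨fun h => kappa_injective (h.trans h2.symm), fun h => (congrArg _ h).trans h2⟩

variable [∀ V, SSet.KanComplex (X.functor.obj V)]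

/-- Classes of a sphere are compatible if and only if the restrictions of the sphere are
homotopic. -/
theorem mk_mem_cechH0_iff (δ : Sphere X U (m + 1)) :
    (fun i => pi.mk (δ i)) ∈ cechH0 X U m ↔
      ∀ a, Nonempty (SSet.RelativeMorphism.Homotopy (δ.restrict 1 a) (δ.restrict 0 a)) := by
  have h : (fun i => pi.mk (δ i)) ∈ cechH0 X U m ↔ ∀ a, pi.mk (δ.restrict 1 a) =
    pi.mk (δ.restrict 0 a) :=
    funext_iff
  rw [h]
  exact forall_congr' fun a => ⟨fun h => homotopy_of_isBd (pi.mk_eq_mk.1 h),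
    fun ⟨h⟩ => pi.mk_eq_of_homotopy h⟩

/-- The cochain represented by a `2`-simplex of the loops on a product is given by the components of
the class whose image under `kappa` is the class of this simplex. -/
theorem represents_evalProj_iff
    (f : (loops m ((X.cosimplicial U).functor.obj ⦋2⦌) ((X.cosimplicial U).pt ⦋2⦌)).PtSimplex 2
      (relHom.pt _ _ _))
    {e : pi (m + 2) ((X.cosimplicial U).functor.obj ⦋2⦌) ((X.cosimplicial U).pt ⦋2⦌)}
    (he : kappa m _ _ e = pi.mk f) (c : Cochain X U (m + 2) 2) :
    (∀ b, Represents (relHom.un f.map ≫ evalProj X.functor (U _⦋2⦌) b) (c b)) ↔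
      c = components X U (m + 1) 2 e :=
  (forall_congr' fun b => represents_un_comp_iff f he (evalProj X.functor (U _⦋2⦌) b) rfl).trans
    funext_iff.symm

end sphere

end CechDiff

theorem mainTheorem5 {C : Type u} [Category.{v} C] (J : GrothendieckTopology C) (S : C)
    (U : CechDiff.OneHypercover.{w} J S) (X : CechDiff.PtDiagram.{w} Cᵒᵖ)
    [∀ V, SSet.KanComplex (X.functor.obj V)] (m : ℕ)
    (Z : CechDiff.PtDiagram.{w} SimplexCategory) (hZ : CechDiff.ReedyFibrant Z.functor)
    (r : (X.cosimplicial U.obj).Hom Z) (hr : ∀ p, CechDiff.IsWeakEquiv (r.hom.app p)) :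
    ∃ d₂ : CechDiff.cechH0 X U.obj m → CechDiff.CechH2 X U.obj m,
      (∀ a b, CechDiff.IsSpectralD2 r a b ↔ d₂ a = b) ∧
      (∀ a : CechDiff.cechH0 X U.obj m, ∃ δ : CechDiff.Sphere X U.obj (m + 1),
        ∀ i, CechDiff.pi.mk (δ i) = a.1 i) ∧
      ∀ δ : CechDiff.Sphere X U.obj (m + 1),
        ((fun i => CechDiff.pi.mk (δ i)) ∈ CechDiff.cechH0 X U.obj m ↔
          ∀ a, Nonempty (SSet.RelativeMorphism.Homotopy (δ.restrict 1 a) (δ.restrict 0 a))) ∧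
        ∀ y : δ.Homotopies, ∃ w, CechDiff.IsBoundaryMap y w ∧
          (∀ w', CechDiff.IsBoundaryMap y w' → w' = w) ∧
          ∀ n : Fin (m + 2), (∃ Φ, CechDiff.IsFill n w Φ) ∧
            ∀ Φ, CechDiff.IsFill n w Φ → ∃ c : CechDiff.cechZ2 X U.obj m,
              (∀ c' : CechDiff.Cochain X U.obj (m + 2) 2,
                (∀ b, CechDiff.Represents ((SSet.stdSimplex.δ n ▷ Δ[2]) ≫ Φ ≫
                  CechDiff.evalProj X.functor (U.obj _⦋2⦌) b) (c' b)) ↔ c' = c.1) ∧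
              ∀ h : (fun i => CechDiff.pi.mk (δ i)) ∈ CechDiff.cechH0 X U.obj m,
                (c : CechDiff.CechH2 X U.obj m) = d₂ (⟨_, h⟩ ^ ((-1 : ℤ) ^ (n : ℕ))) := by
  choose d hd using fun a : CechDiff.cechH0 X U.obj m => CechDiff.exists_isObsClass a
  refine ⟨d, fun a b => ?_, fun a => ?_, fun δ => ⟨CechDiff.mk_mem_cechH0_iff δ, fun y => ?_⟩⟩
  · rw [CechDiff.isSpectralD2_iff hZ r hr]
    exact ⟨fun h => (hd a).unique h, fun h => h ▸ hd a⟩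
  · choose δ hδ using fun i => CechDiff.pi.mk_surjective (a.1 i)
    exact ⟨δ, hδ⟩
  · -- `w` is the restriction of a fill to the boundary of `Δ[2]`
    obtain ⟨Φ₀, o₀⟩ := CechDiff.exists_obs (0 : Fin (m + 2)) (CechDiff.δ_homotopyEdge y)
    refine ⟨_, o₀.isBoundaryMap, fun w' hw' => o₀.isBoundaryMap.unique hw',
      fun n => ⟨?_, fun Φ hΦ => ?_⟩⟩
    · obtain ⟨Φ, o⟩ := CechDiff.exists_obs n (CechDiff.δ_homotopyEdge y)
      exact ⟨_, o.isFill o₀.isBoundaryMap⟩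
    · have o := hΦ.obs o₀.isBoundaryMap
      obtain ⟨e, he⟩ := CechDiff.kappa_surjective (CechDiff.pi.mk o.z)
      refine ⟨⟨_, o.components_mem_cechZ2 he⟩, fun c' => ?_, fun h => ?_⟩
      · have hz : CechDiff.relHom.un o.z.map = SSet.stdSimplex.δ n ▷ Δ[2] ≫ Φ :=
          (CechDiff.un_comp_face _).trans (congrArg (_ ▷ _ ≫ ·) (CechDiff.relHom.un_mk _ _))
        rw [← CechDiff.represents_evalProj_iff o.z he c', hz]
        rfl
      · -- turning the paths `n` times leads to the horn of index `0`, which defines `d₂`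
        obtain ⟨g', y', Φ', o', hz, hg⟩ := o.exists_obs_zero
        refine CechDiff.IsObsClass.unique
          ⟨g', y', Φ', o', e, _, ?_, he.trans (congrArg _ hz.symm), rfl, rfl⟩ (hd _)
        rw [hg, map_zpow]
        rfl
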